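/- Let $\zeta_3=e^{2\pi i/3}$, $t=\tfrac13(1+2\zeta_3)$, and let $\rho_1\colon\mathbb Z_3^2\to \mathrm{GL}(3,\mathbb C)$, $\rho_1(a,b)=\mathrm{diag}(\zeta_3^a,\zeta_3^b,\zeta_3^{a+b})$. Consider all holomorphic actions $\Phi$ of $\mathbb Z_3^2$ on three-dimensional complex tori $T=\mathbb C^3/\Lambda$ that have analytic representation $\rho_1$ (i.e. $\Phi(g)(z)=\rho_1(g)z+\tau(g)$ for all $g$), that have finite fixed locus (only finitely many points of $T$ have non-trivial stabilizer) and that are rigid, i.e. $H^1(T,\Theta_T)^{\mathbb Z_3^2}=0$. The quotient $X=T/\mathbb Z_3^2$ carries the sheaf of holomorphic (resp. smooth) functions consisting of the functions whose pullback to $\mathbb C^3$ is holomorphic (resp. smooth); a biholomorphism (resp. diffeomorphism) of quotients is a homeomorphism identifying these sheaves. With the generators $h=(0,2)$ and $k=(1,1)$ of $\mathbb Z_3^2$, each of the following lines defines such a rigid action with finite fixed locus, where always $\Phi(h)(z)=\mathrm{diag}(1,\zeta_3^2,\zeta_3^2)z+\tau(h)$ and $\Phi(k)(z)=\mathrm{diag}(\zeta_3,\zeta_3,\zeta_3^2)z$;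 denote the quotient by the symbol on the left: * $Y_3$: $\Lambda=\mathbb Z[\zeta_3]^3$, $\tau(h)=(t,t,t)$; * $Y_4$: $\Lambda=\mathbb Z[\zeta_3]^3+\mathbb Z(t,t,0)$, $\tau(h)=\tfrac13(1,1,3t)$; * $Y_{4'}$: $\Lambda=\mathbb Z[\zeta_3]^3+\mathbb Z(t,0,t)$, $\tau(h)=\tfrac13(1,3t,2\zeta_3^2)$; * $Y_5$: $\Lambda=\mathbb Z[\zeta_3]^3+\mathbb Z(t,t,t)$, $\tau(h)=\tfrac13(1,1,2)$; * $Y_6$: $\Lambda=\mathbb Z[\zeta_3]^3+\mathbb Z(t,t,t)+\mathbb Z(t,-t,0)$, $\tau(h)=\tfrac13(1,1,2)$. Then there are precisely five biholomorphism classes of quotients of three-dimensional complex tori by rigid holomorphic actions of $\mathbb Z_3^2$ with finite fixed locus and analytic representation $\rho_1$: every such quotient is biholomorphic to one of $Y_3,Y_4,Y_{4'},Y_5,Y_6$, and these five are pairwise not biholomorphic. The map $(z_1,z_2,z_3)\mapsto(-z_1,\overline{z_3},\overline{z_2})$ induces a diffeomorphism $Y_4\to Y_{4'}$, and no other two distinct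 members of this list are diffeomorphic. -/

import Mathlib

open scoped Matrix ContDiff

namespace TorusQuotient

/-- The complex vector space `ℂ³`. -/
abbrev C3 : Type := Fin 3 → ℂ

/-- A holomorphic action of the group `G` on a three-dimensional complex torus `T = ℂ³ / Λ`
with analytic representation `ρ`: a full lattice `Λ` in `ℂ³` and a homomorphism `Φ` from `G` to the
self-bijections of `T`, such that every `Φ g` is of the form `z ↦ ρ(g) z + τ(g)`. -/
structure TorusAction (G : Type) [Group G] (ρ : G →* Matrix (Fin 3) (Fin 3) ℂ) where
  /-- the lattice of the torus -/
  lattice : Submodule ℤ C3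
  [discrete : DiscreteTopology lattice]
  [isLattice : IsZLattice ℝ lattice]
  /-- the action on the torus -/
  Φ : G →* Equiv.Perm (C3 ⧸ lattice)
  analytic : ∀ g : G, ∃ b : C3, ∀ z : C3,
    Φ g (Submodule.Quotient.mk z) = Submodule.Quotient.mk (ρ g *ᵥ z + b)

namespace TorusAction

variable {G : Type} [Group G] {ρ : G →* Matrix (Fin 3) (Fin 3) ℂ}

/-- The torus `T = ℂ³ / Λ`. -/
abbrev Torus (A : TorusAction G ρ) : Type := C3 ⧸ A.lattice

/-- The projection `ℂ³ → T`. -/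
def toTorus (A : TorusAction G ρ) (z : C3) : A.Torus := Submodule.Quotient.mk z

/-- The quotient `X = T / G`, with the quotient topology. -/
abbrev X (A : TorusAction G ρ) : Type := MulAction.orbitRel.Quotient A.Φ.range A.Torus

instance (A : TorusAction G ρ) : TopologicalSpace A.X :=
  inferInstanceAs (TopologicalSpace (Quotient (MulAction.orbitRel A.Φ.range A.Torus)))

/-- The projection `ℂ³ → T → X`. -/
def proj (A : TorusAction G ρ) (z : C3) : A.X :=
  Quotient.mk (MulAction.orbitRel A.Φ.range A.Torus) (A.toTorus z)

/-- The action has only isolated fixed points: since `T` is compact, this means that only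
finitely many points of `T` have a nontrivial stabilizer. -/
def FiniteFixedLocus (A : TorusAction G ρ) : Prop :=
  {x : A.Torus | ∃ g : G, g ≠ 1 ∧ A.Φ g x = x}.Finite

/-! ### The quotient as a complex space and as a smooth space -/

/-- Sections of the structure sheaf of the complex space `X = T / G` over `U`: functions
whose pullback to (the preimage of `U` in) `ℂ³` is holomorphic. -/
def HolomorphicOn (A : TorusAction G ρ) (φ : A.X → ℂ) (U : Set A.X) : Prop :=
  DifferentiableOn ℂ (φ ∘ A.proj) (A.proj ⁻¹' U)

/-- Smooth real functions on an open subset `U` of `X = T / G`: functions whose pullback to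
`ℂ³ = ℝ⁶` is smooth. -/
def SmoothOn (A : TorusAction G ρ) (φ : A.X → ℝ) (U : Set A.X) : Prop :=
  ContDiffOn ℝ ∞ (φ ∘ A.proj) (A.proj ⁻¹' U)

/-- A homeomorphism of the quotients is biholomorphic if it identifies the sheaves of
holomorphic functions. -/
def IsBiholomorphism {A B : TorusAction G ρ} (f : A.X ≃ₜ B.X) : Prop :=
  ∀ U : Set B.X, IsOpen U → ∀ φ : B.X → ℂ,
    B.HolomorphicOn φ U ↔ A.HolomorphicOn (φ ∘ f) (f ⁻¹' U)

/-- A homeomorphism of the quotients is a diffeomorphism if it identifies the sheaves of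
smooth functions. -/
def IsDiffeomorphism {A B : TorusAction G ρ} (f : A.X ≃ₜ B.X) : Prop :=
  ∀ U : Set B.X, IsOpen U → ∀ φ : B.X → ℝ,
    B.SmoothOn φ U ↔ A.SmoothOn (φ ∘ f) (f ⁻¹' U)

def Biholomorphic (A B : TorusAction G ρ) : Prop := ∃ f : A.X ≃ₜ B.X, IsBiholomorphism f

def Diffeomorphic (A B : TorusAction G ρ) : Prop := ∃ f : A.X ≃ₜ B.X, IsDiffeomorphism f

end TorusAction

/-! ### Rigidity

`H¹(T, Θ_T)` is computed by the Dolbeault complex of the holomorphic tangent bundle of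
`T = ℂ³ / Λ`. This bundle is `T × ℂ³`, so that its sections are the `Λ`-periodic maps `ℂ³ → ℂ³`,
and a `(0,1)`-form with values in it is a `Λ`-periodic map `α` on `ℂ³` whose values `α z` are
conjugate-linear maps `ℂ³ → ℂ³`. -/

/-- The derivative `∂̄u` at `z` in the direction `v`: the conjugate-linear part of the real
derivative of `u`. -/
noncomputable def dbar (u : C3 → C3) (z v : C3) : C3 :=
  (1 / 2 : ℂ) • (fderiv ℝ u z v + Complex.I • fderiv ℝ u z (Complex.I • v))

/-- Smooth `(0,1)`-forms on `ℂ³ / Λ` with values in the holomorphic tangent bundle. -/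
structure IsForm01 (Λ : Submodule ℤ C3) (α : C3 → C3 →L[ℝ] C3) : Prop where
  smooth : ContDiff ℝ ∞ α
  periodic : ∀ l ∈ Λ, ∀ z, α (z + l) = α z
  antilinear : ∀ z v, α z (Complex.I • v) = -(Complex.I • α z v)

/-- `∂̄α = 0`. -/
def IsDbarClosed (α : C3 → C3 →L[ℝ] C3) : Prop :=
  ∀ z v w, dbar (fun y => α y w) z v = dbar (fun y => α y v) z w

/-- `η = ∂̄u` for a smooth vector field `u` of type `(1,0)` on `ℂ³ / Λ`. Here `η z v` is the value
of the form `η` at the point `z` and the vector `v`. -/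
def IsDbarExact (Λ : Submodule ℤ C3) (η : C3 → C3 → C3) : Prop :=
  ∃ u : C3 → C3, ContDiff ℝ ∞ u ∧ (∀ l ∈ Λ, ∀ z, u (z + l) = u z) ∧ ∀ z v, η z v = dbar u z v

namespace TorusAction

variable {G : Type} [Group G] {ρ : G →* Matrix (Fin 3) (Fin 3) ℂ}

/-- The action is (infinitesimally) rigid: `H¹(T, Θ_T)^G = 0`. A class `[α]` is `G`-invariant if
for all `g` the form `Φ(g)^* α - α` is exact, where for `Φ(g)(z) = ρ(g) z + b` one has
`(Φ(g)^* α)(z)(v) = ρ(g)⁻¹ α(ρ(g) z + b)(ρ(g) v)`. -/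
def IsRigid (A : TorusAction G ρ) : Prop :=
  ∀ α : C3 → C3 →L[ℝ] C3, IsForm01 A.lattice α → IsDbarClosed α →
    (∀ (g : G) (b : C3), (∀ z, A.Φ g (A.toTorus z) = A.toTorus (ρ g *ᵥ z + b)) →
      IsDbarExact A.lattice
        (fun z v => ρ g⁻¹ *ᵥ (α (ρ g *ᵥ z + b) (ρ g *ᵥ v)) - α z v)) →
    IsDbarExact A.lattice (fun z v => α z v)

end TorusAction

/-! ### The group `ℤ₃²`, the representation `ρ₁` and the five quotients -/

/-- `ζ₃ = exp(2πi/3)`. -/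
noncomputable def ζ : ℂ := Complex.exp (2 * Real.pi * Complex.I / 3)

theorem ζ_pow_three : ζ ^ 3 = 1 := by
  rw [ζ, ← Complex.exp_nat_mul, Complex.exp_eq_one_iff]
  exact ⟨1, by push_cast; ring⟩

theorem ζ_pow_val_add (a b : ZMod 3) : ζ ^ (a + b).val = ζ ^ a.val * ζ ^ b.val := by
  rw [ZMod.val_add, ← pow_add]
  conv_rhs => rw [← Nat.mod_add_div (a.val + b.val) 3, pow_add, pow_mul, ζ_pow_three, one_pow,
    mul_one]

/-- `t = (1 + 2ζ₃)/3`. -/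
noncomputable def t : ℂ := (1 + 2 * ζ) / 3

/-- The group `ℤ₃²`, written multiplicatively. -/
abbrev Z3sq : Type := Multiplicative (ZMod 3 × ZMod 3)

/-- The representation `ρ₁(a,b) = diag(ζ₃^a, ζ₃^b, ζ₃^(a+b))`. -/
noncomputable def ρ₁ : Z3sq →* Matrix (Fin 3) (Fin 3) ℂ where
  toFun g := Matrix.diagonal ![ζ ^ g.toAdd.1.val, ζ ^ g.toAdd.2.val,
    ζ ^ (g.toAdd.1 + g.toAdd.2).val]
  map_one' := by
    rw [← Matrix.diagonal_one]
    congr 1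
    ext i
    fin_cases i <;> simp
  map_mul' g g' := by
    rw [Matrix.diagonal_mul_diagonal]
    congr 1
    ext i
    fin_cases i <;> (simp [ζ_pow_val_add]; try ring)

/-- The generator `h = (0, 2)` of `ℤ₃²`. -/
def h : Z3sq := Multiplicative.ofAdd (0, 2)

/-- The generator `k = (1, 1)` of `ℤ₃²`. -/
def k : Z3sq := Multiplicative.ofAdd (1, 1)

/-- The names of the five quotients. -/
inductive Label
  | Y3 | Y4 | Y4' | Y5 | Y6

/-- The lattice `ℤ[ζ₃]³`, that is, the vectors all of whose coordinates are in `ℤ + ℤ ζ₃`. -/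
noncomputable def eisensteinCube : Submodule ℤ C3 :=
  Submodule.pi Set.univ (fun _ : Fin 3 => Submodule.span ℤ {1, ζ})

/-- The lattices of the five quotients. -/
noncomputable def modelLattice : Label → Submodule ℤ C3
  | .Y3 => eisensteinCube
  | .Y4 => eisensteinCube ⊔ Submodule.span ℤ {![t, t, 0]}
  | .Y4' => eisensteinCube ⊔ Submodule.span ℤ {![t, 0, t]}
  | .Y5 => eisensteinCube ⊔ Submodule.span ℤ {![t, t, t]}
  | .Y6 => eisensteinCube ⊔ Submodule.span ℤ {![t, t, t], ![t, -t, 0]}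

/-- The translation parts `τ(h)` of the five quotients. -/
noncomputable def modelTranslation : Label → C3
  | .Y3 => ![t, t, t]
  | .Y4 => ![1 / 3, 1 / 3, t]
  | .Y4' => ![1 / 3, t, 2 * ζ ^ 2 / 3]
  | .Y5 => ![1 / 3, 1 / 3, 2 / 3]
  | .Y6 => ![1 / 3, 1 / 3, 2 / 3]

/-- `A` is the action that defines the quotient with label `i`: it lives on the torus with
the lattice `modelLattice i`, and
`Φ(h)(z) = diag(1, ζ₃², ζ₃²) z + τ(h)` and `Φ(k)(z) = diag(ζ₃, ζ₃, ζ₃²) z`.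
As `h` and `k` generate `ℤ₃²`, this determines the action. -/
def IsModel (i : Label) (A : TorusAction Z3sq ρ₁) : Prop :=
  A.lattice = modelLattice i ∧
  (∀ z : C3, A.Φ h (A.toTorus z) =
    A.toTorus (Matrix.diagonal ![1, ζ ^ 2, ζ ^ 2] *ᵥ z + modelTranslation i)) ∧
  (∀ z : C3, A.Φ k (A.toTorus z) = A.toTorus (Matrix.diagonal ![ζ, ζ, ζ ^ 2] *ᵥ z))

end TorusQuotient

namespace TorusQuotient

/-! ### Eisenstein integers -/

/-! Rigidity holds for every action. On a torus each closed (0,1)-form with values in the tangent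
bundle is a constant form plus an exact one; this is proved with Fourier series, where the symbol of
∂̄ is bounded away from zero at nonzero frequencies. The group acts on the constant form dz̄_j ⊗ ∂_i
through the inverse of `χ i * χ j`, and no such product is trivial, so no invariant class survives
(`TorusAction.isRigid`).

For the classification, move the fixed point of Φ(k) to the origin. Then h, hk and hk², each of
which fixes one coordinate axis, all have the same translation part a, and finiteness of the fixed
locus means that a_j is not in the projection of Λ to the j-th axis. The intersection of Λ with an
axis is a rank one ℤ[ζ]-module, so it becomes ℤ[ζ] after scaling. The projection of Λ is killed by 3
modulo ℤ[ζ]. It is even killed by 1 - ζ, since otherwise it would contain all 3-torsion and in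
particular a_j. Hence Λ is ℤ[ζ]³ plus multiples of t prescribed by a ternary code of length three
without words of weight one. Commutation of Φ(h) and Φ(k) puts a word into the code that is
supported exactly on the axes which do not split off. Few such codes exist; scaling by units and
interchanging the first two coordinates leaves the five models (`IsAdmissible.exists_label`,
`exists_isCode`).

To separate the models, write X = ℂ³/Γ. Away from a countable closed set Γ acts freely, and the
complement of a countable closed set in ℝ⁶ is simply connected in the sense needed here: it is a
union of two open star-shaped sets with path connected intersection. A homeomorphism of quotients
therefore lifts and induces an isomorphism of the groups Γ. This isomorphism preserves the lattices,
so it yields a real linear map L matching the lattices and the groups of matrices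
(`exists_linearEquiv_of_homeomorph`). Such an L permutes the axes, and the way Λ fails to split
along them distinguishes all models except Y₄ from Y₄'. If the homeomorphism is biholomorphic,
Liouville's theorem makes L complex linear on each axis; L then respects the eigenvalues of ρ₁(k)
and fixes the third axis, which separates Y₄ from Y₄'. -/

theorem ζ_eq : ζ = ⟨-1 / 2, √3 / 2⟩ := by
  have : (2 * Real.pi * Complex.I / 3 : ℂ) = ((2 * Real.pi / 3 : ℝ) : ℂ) * Complex.I := by
    push_cast; ring
  have e : (2 * Real.pi / 3 : ℝ) = Real.pi - Real.pi / 3 := by ring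
  rw [ζ, this, Complex.exp_mul_I, ← Complex.ofReal_cos, ← Complex.ofReal_sin, e, Real.cos_pi_sub,
    Real.sin_pi_sub, Real.cos_pi_div_three, Real.sin_pi_div_three]
  apply Complex.ext
  · simp; norm_num
  · simp

theorem ζ_re : ζ.re = -1 / 2 := by rw [ζ_eq]

theorem ζ_im : ζ.im = √3 / 2 := by rw [ζ_eq]

theorem ζ_sq : ζ ^ 2 = -1 - ζ := by
  have h3 : √3 * √3 = 3 := Real.mul_self_sqrt (by norm_num)
  apply Complex.ext
  · simp [pow_two, ζ_re, ζ_im]; nlinarith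
  · simp [pow_two, ζ_re, ζ_im]; ring

theorem conj_ζ : (starRingEnd ℂ) ζ = -1 - ζ := by
  apply Complex.ext
  · simp [ζ_re]; ring
  · simp [ζ_im]

theorem norm_ζ : ‖ζ‖ = 1 := by
  have : ‖ζ‖ ^ 3 = 1 := by rw [← norm_pow, ζ_pow_three, norm_one]
  exact (pow_eq_one_iff_of_nonneg (norm_nonneg _) (by norm_num)).1 this

theorem ζ_ne_one : ζ ≠ 1 := fun e => by
  have := congrArg Complex.re e
  rw [ζ_re] at this
  norm_num at this

theorem ζ_ne_zero : ζ ≠ 0 := fun e => by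
  have := norm_ζ
  simp [e] at this

theorem ζ_sq_ne_one : ζ ^ 2 ≠ 1 := fun e => by
  have := ζ_pow_three
  rw [pow_succ, e, one_mul] at this
  exact ζ_ne_one this

/-- The ring `ℤ[ζ₃]` of Eisenstein integers, as an additive group. -/
noncomputable def Eis : Submodule ℤ ℂ := Submodule.span ℤ {1, ζ}

theorem mem_Eis {z : ℂ} : z ∈ Eis ↔ ∃ a b : ℤ, z = a + b * ζ := by
  rw [Eis, Submodule.mem_span_pair]
  simp [eq_comm]

theorem Eis_mul {z w : ℂ} (hz : z ∈ Eis) (hw : w ∈ Eis) : z * w ∈ Eis := by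
  obtain ⟨a, b, rfl⟩ := mem_Eis.1 hz
  obtain ⟨c, d, rfl⟩ := mem_Eis.1 hw
  refine mem_Eis.2 ⟨a * c - b * d, a * d + b * c - b * d, ?_⟩
  push_cast
  linear_combination (b * d : ℂ) * ζ_sq

theorem int_mem_Eis (n : ℤ) : (n : ℂ) ∈ Eis := mem_Eis.2 ⟨n, 0, by simp⟩

theorem one_mem_Eis : (1 : ℂ) ∈ Eis := by simpa using int_mem_Eis 1

theorem ζ_mem_Eis : ζ ∈ Eis := mem_Eis.2 ⟨0, 1, by simp⟩

theorem ζ_pow_mem_Eis (n : ℕ) : ζ ^ n ∈ Eis := by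
  induction n with
  | zero => simpa using one_mem_Eis
  | succ n ih => rw [pow_succ]; exact Eis_mul ih ζ_mem_Eis

theorem conj_mem_Eis {z : ℂ} (hz : z ∈ Eis) : (starRingEnd ℂ) z ∈ Eis := by
  obtain ⟨a, b, rfl⟩ := mem_Eis.1 hz
  refine mem_Eis.2 ⟨a - b, -b, ?_⟩
  simp only [map_add, map_mul, conj_ζ]
  simp
  ring

theorem add_mul_ζ_inj {a b c d : ℝ} (e : (a + b * ζ : ℂ) = c + d * ζ) : a = c ∧ b = d := by
  have h3 : √3 ≠ 0 := by positivity
  have hi := congrArg Complex.im e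
  have hr := congrArg Complex.re e
  simp [ζ_re, ζ_im] at hi hr
  have hb : b = d := hi
  subst hb
  exact ⟨by linarith, rfl⟩

theorem exists_add_mul_ζ (z : ℂ) : ∃ a b : ℝ, z = a + b * ζ := by
  have h3 : √3 ≠ 0 := by positivity
  refine ⟨z.re + z.im / √3, 2 * z.im / √3, ?_⟩
  apply Complex.ext
  · simp [ζ_re, ζ_im]; field_simp; ring
  · simp [ζ_re, ζ_im]; field_simp

theorem normSq_add_mul_ζ (a b : ℝ) : Complex.normSq (a + b * ζ) = a ^ 2 - a * b + b ^ 2 := by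
  have h3 : √3 * √3 = 3 := Real.mul_self_sqrt (by norm_num)
  simp [Complex.normSq_apply, ζ_re, ζ_im]
  nlinarith

/-- An element `(p + q ζ) / 3` is an Eisenstein integer if and only if `3` divides `p` and `q`. -/
theorem third_mem_Eis {p q : ℤ} : ((p + q * ζ) / 3 : ℂ) ∈ Eis ↔ (3 ∣ p ∧ 3 ∣ q) := by
  rw [mem_Eis]
  constructor
  · rintro ⟨a, b, e⟩
    have e' : ((p : ℝ) + (q : ℝ) * ζ : ℂ) = ((3 * a : ℝ) : ℂ) + ((3 * b : ℝ) : ℂ) * ζ := by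
      push_cast
      linear_combination 3 * e
    obtain ⟨e1, e2⟩ := add_mul_ζ_inj e'
    exact ⟨⟨a, by exact_mod_cast e1⟩, ⟨b, by exact_mod_cast e2⟩⟩
  · rintro ⟨⟨a, rfl⟩, ⟨b, rfl⟩⟩
    exact ⟨a, b, by push_cast; ring⟩

theorem int_mul_t_mem_Eis {n : ℤ} : (n * t : ℂ) ∈ Eis ↔ 3 ∣ n := by
  have : (n * t : ℂ) = (n + (2 * n : ℤ) * ζ) / 3 := by rw [t]; push_cast; ring
  rw [this, third_mem_Eis]
  omega

theorem t_notMem_Eis : t ∉ Eis := by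
  have := @int_mul_t_mem_Eis 1
  simp only [Int.cast_one, one_mul] at this
  rw [this]
  decide

theorem three_mul_t_mem_Eis : 3 * t ∈ Eis := mem_Eis.2 ⟨1, 2, by rw [t]; push_cast; ring⟩

theorem conj_t : (starRingEnd ℂ) t = -t := by
  simp only [t, map_div₀, map_add, map_mul, conj_ζ, map_one, map_ofNat]
  ring

theorem one_sub_ζ_mul_t : (1 - ζ) * t = 1 + ζ := by
  rw [t]
  linear_combination (-2 / 3 : ℂ) * ζ_sq

theorem ζ_mul_t_sub : ζ * t - t ∈ Eis :=
  mem_Eis.2 ⟨-1, -1, by push_cast; linear_combination -one_sub_ζ_mul_t⟩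

/-- Since ζ fixes the class of t modulo ℤ[ζ], every lattice ℤ[ζ]³ + Ct is stable under `ρ₁`. -/
theorem ζ_pow_mul_t_sub (n : ℕ) : ζ ^ n * t - t ∈ Eis := by
  induction n with
  | zero => simp
  | succ n ih =>
    have : ζ ^ (n + 1) * t - t = ζ * (ζ ^ n * t - t) + (ζ * t - t) := by ring
    rw [this]
    exact add_mem (Eis_mul ζ_mem_Eis ih) ζ_mul_t_sub

/-- The kernel of multiplication by `1 - ζ` on `ℂ / ℤ[ζ]` is generated by `t`. -/
theorem exists_int_mul_t {z : ℂ} (hz : (1 - ζ) * z ∈ Eis) : ∃ n : ℤ, z - n * t ∈ Eis := by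
  obtain ⟨a, b, e⟩ := mem_Eis.1 hz
  -- As 1/(1 - ζ) = (2 + ζ)/3, one has z = ((2a - b) + (a + b)ζ)/3, and subtracting (2a - b)t leaves
  -- (b - a)ζ.
  refine ⟨2 * a - b, mem_Eis.2 ⟨0, b - a, ?_⟩⟩
  have h1 : (1 - ζ) ≠ 0 := sub_ne_zero.2 ζ_ne_one.symm
  apply mul_left_cancel₀ h1
  push_cast
  linear_combination e - (2 * a - b : ℂ) * one_sub_ζ_mul_t + (b - a) * ζ_sq

/-- The Euclidean property: rounding both coordinates leaves |x|, |y| ≤ 1/2, where x² - xy + y² ≤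
3/4. -/
theorem exists_Eis_near (z : ℂ) : ∃ w ∈ Eis, ‖z - w‖ < 1 := by
  obtain ⟨a, b, rfl⟩ := exists_add_mul_ζ z
  refine ⟨round a + round b * ζ, mem_Eis.2 ⟨_, _, rfl⟩, ?_⟩
  have e : (a + b * ζ - (round a + round b * ζ) : ℂ)
      = ((a - round a : ℝ) : ℂ) + ((b - round b : ℝ) : ℂ) * ζ := by push_cast; ring
  have h1 := abs_le.1 (abs_sub_round a)
  have h2 := abs_le.1 (abs_sub_round b)
  have : ‖(a + b * ζ - (round a + round b * ζ) : ℂ)‖ ^ 2 < 1 := by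
    rw [← Complex.normSq_eq_norm_sq, e, normSq_add_mul_ζ]
    generalize a - round a = x at *
    generalize b - round b = y at *
    nlinarith [mul_nonneg (sub_nonneg.2 h1.1) (sub_nonneg.2 h2.1),
      mul_nonneg (sub_nonneg.2 h1.2) (sub_nonneg.2 h2.2),
      mul_nonneg (sub_nonneg.2 h1.1) (sub_nonneg.2 h2.2),
      mul_nonneg (sub_nonneg.2 h1.2) (sub_nonneg.2 h2.1),
      mul_nonneg (sub_nonneg.2 h1.1) (sub_nonneg.2 h1.2),
      mul_nonneg (sub_nonneg.2 h2.1) (sub_nonneg.2 h2.2)]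
  nlinarith [norm_nonneg (a + b * ζ - (round a + round b * ζ) : ℂ)]

theorem one_le_norm_of_mem_Eis {z : ℂ} (hz : z ∈ Eis) (h0 : z ≠ 0) : 1 ≤ ‖z‖ := by
  obtain ⟨a, b, rfl⟩ := mem_Eis.1 hz
  have : (1 : ℝ) ≤ ‖(a + b * ζ : ℂ)‖ ^ 2 := by
    have e := normSq_add_mul_ζ a b
    push_cast at e
    rw [← Complex.normSq_eq_norm_sq, e]
    have hpos : 0 < a ^ 2 - a * b + b ^ 2 := by
      by_contra hn
      -- The left side is four times the norm form.
      have ha : (2 * a - b) ^ 2 + 3 * b ^ 2 ≤ 0 := by nlinarith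
      have hb : b = 0 := by nlinarith [sq_nonneg (2 * a - b), sq_nonneg b]
      subst hb
      have : a = 0 := by nlinarith [sq_nonneg a]
      subst this
      simp at h0
    exact_mod_cast hpos
  nlinarith [norm_nonneg (a + b * ζ : ℂ)]

theorem mem_eisensteinCube {v : C3} : v ∈ eisensteinCube ↔ ∀ i, v i ∈ Eis := by
  simp [eisensteinCube, Submodule.mem_pi, Eis]

/-! ### The representation -/

/-- The three characters of `ℤ₃²` in the representation `ρ₁`. -/
noncomputable def χ (g : Z3sq) : Fin 3 → ℂ :=
  ![ζ ^ g.toAdd.1.val, ζ ^ g.toAdd.2.val, ζ ^ (g.toAdd.1 + g.toAdd.2).val]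

theorem ρ₁_mulVec (g : Z3sq) (v : C3) (i : Fin 3) : (ρ₁ g *ᵥ v) i = χ g i * v i := by
  change (Matrix.diagonal _ *ᵥ v) i = _
  rw [Matrix.mulVec_diagonal, χ]

theorem ρ₁_h : ρ₁ h = Matrix.diagonal ![1, ζ ^ 2, ζ ^ 2] := by
  change Matrix.diagonal _ = _
  congr 1

theorem ρ₁_k : ρ₁ k = Matrix.diagonal ![ζ, ζ, ζ ^ 2] := by
  change Matrix.diagonal _ = _
  congr 1
  ext i
  fin_cases i
  · simp [k, ZMod.val_one]
  · simp [k, ZMod.val_one]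
  · rfl

/-- The matrices `ρ₁ g` as continuous linear maps. -/
noncomputable def ρL (g : Z3sq) : C3 →L[ℂ] C3 := (Matrix.mulVecLin (ρ₁ g)).toContinuousLinearMap

theorem ρL_apply (g : Z3sq) (v : C3) : ρL g v = ρ₁ g *ᵥ v := rfl

theorem ρ₁_mul_mulVec (g g' : Z3sq) (v : C3) : ρ₁ (g * g') *ᵥ v = ρ₁ g *ᵥ (ρ₁ g' *ᵥ v) := by
  rw [map_mul, Matrix.mulVec_mulVec]

theorem ρ₁_inv_mulVec (g : Z3sq) (v : C3) : ρ₁ g⁻¹ *ᵥ (ρ₁ g *ᵥ v) = v := by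
  rw [← ρ₁_mul_mulVec, inv_mul_cancel, map_one, Matrix.one_mulVec]

theorem ρ₁_mulVec_inv (g : Z3sq) (v : C3) : ρ₁ g *ᵥ (ρ₁ g⁻¹ *ᵥ v) = v := by
  rw [← ρ₁_mul_mulVec, mul_inv_cancel, map_one, Matrix.one_mulVec]

theorem Z3sq_pow_three (g : Z3sq) : g ^ 3 = 1 := by revert g; decide

@[simp] theorem ρ₁_inv_mul (g : Z3sq) : ρ₁ g⁻¹ * ρ₁ g = 1 := by
  rw [← map_mul, inv_mul_cancel, map_one]

@[simp] theorem ρ₁_mul_inv (g : Z3sq) : ρ₁ g * ρ₁ g⁻¹ = 1 := by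
  rw [← map_mul, mul_inv_cancel, map_one]

theorem ρ₁_injective : Function.Injective ρ₁ := by
  rw [injective_iff_map_eq_one]
  intro g hg
  have e : ∀ v i, (ρ₁ g *ᵥ v) i = v i := fun v i => by rw [hg, Matrix.one_mulVec]
  simp only [ρ₁_mulVec, χ] at e
  have key : ∀ a : ZMod 3, ζ ^ a.val = 1 → a = 0 := by
    intro a ha
    fin_cases a
    · rfl
    · exact absurd ha (by simpa [ZMod.val] using ζ_ne_one)
    · exact absurd ha (by simpa [ZMod.val] using ζ_sq_ne_one)
  have e0 := e 1 0
  have e1 := e 1 1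
  simp at e0 e1
  exact Prod.ext (key _ e0) (key _ e1)

/-! ### Lifts of the action to ℂ³ and the deck group -/

namespace TorusAction

attribute [instance] TorusAction.discrete TorusAction.isLattice

variable (A : TorusAction Z3sq ρ₁)

theorem toTorus_eq_iff {x y : C3} : A.toTorus x = A.toTorus y ↔ x - y ∈ A.lattice :=
  Submodule.Quotient.eq _

theorem toTorus_surjective : Function.Surjective A.toTorus := Submodule.Quotient.mk_surjective _

/-- `z ↦ ρ₁(g) z + b` is a lift of `Φ(g)` to `ℂ³`. -/
def IsLift (g : Z3sq) (b : C3) : Prop :=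
  ∀ z, A.Φ g (A.toTorus z) = A.toTorus (ρ₁ g *ᵥ z + b)

variable {A}

theorem exists_isLift (A : TorusAction Z3sq ρ₁) (g : Z3sq) : ∃ b, A.IsLift g b := A.analytic g

theorem mulVec_mem_lattice (g : Z3sq) {l : C3} (hl : l ∈ A.lattice) : ρ₁ g *ᵥ l ∈ A.lattice := by
  obtain ⟨b, hb⟩ := A.exists_isLift g
  have e : A.toTorus l = A.toTorus 0 := A.toTorus_eq_iff.2 (by simpa using hl)
  have e2 := hb l
  rw [e, hb 0, toTorus_eq_iff] at e2
  simpa using neg_mem e2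

theorem IsLift.mul {g g' : Z3sq} {b b' : C3} (hb : A.IsLift g b) (hb' : A.IsLift g' b') :
    A.IsLift (g * g') (ρ₁ g *ᵥ b' + b) := fun z => by
  rw [map_mul, Equiv.Perm.mul_apply, hb' z, hb, ρ₁_mul_mulVec, Matrix.mulVec_add, add_assoc]

theorem IsLift.inv {g : Z3sq} {b : C3} (hb : A.IsLift g b) :
    A.IsLift g⁻¹ (-(ρ₁ g⁻¹ *ᵥ b)) := fun z => by
  rw [map_inv, Equiv.Perm.inv_eq_iff_eq, hb]
  congr 1
  rw [Matrix.mulVec_add, Matrix.mulVec_neg, ρ₁_mulVec_inv, ρ₁_mulVec_inv]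
  simp

theorem isLift_one_iff {l : C3} : A.IsLift 1 l ↔ l ∈ A.lattice := by
  constructor
  · intro hl
    have := hl 0
    rw [map_one, Equiv.Perm.one_apply, eq_comm, toTorus_eq_iff] at this
    simpa using this
  · intro hl z
    rw [map_one, Equiv.Perm.one_apply, eq_comm, toTorus_eq_iff]
    simpa using hl

theorem IsLift.sub_mem {g : Z3sq} {b b' : C3} (hb : A.IsLift g b) (hb' : A.IsLift g b') :
    b - b' ∈ A.lattice := by
  have := hb 0
  rw [hb' 0, eq_comm, toTorus_eq_iff] at this
  simpa using this

theorem IsLift.add {g : Z3sq} {b l : C3} (hb : A.IsLift g b) (hl : l ∈ A.lattice) :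
    A.IsLift g (b + l) := fun z => by
  rw [hb, toTorus_eq_iff]
  simpa using hl

/-- A point of `ℂ³` lying over a fixed point of `Φ(g)` is a fixed point of a lift of `Φ(g)`. -/
theorem exists_isLift_apply_eq {g : Z3sq} {x y : C3}
    (e : A.Φ g (A.toTorus x) = A.toTorus y) : ∃ b, A.IsLift g b ∧ ρ₁ g *ᵥ x + b = y := by
  obtain ⟨b, hb⟩ := A.exists_isLift g
  rw [hb, eq_comm, toTorus_eq_iff] at e
  exact ⟨b + (y - (ρ₁ g *ᵥ x + b)), hb.add e, by abel⟩

theorem proj_eq_iff_torus {x y : C3} :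
    A.proj x = A.proj y ↔ ∃ g, A.Φ g (A.toTorus y) = A.toTorus x := by
  rw [proj, proj, Quotient.eq]
  constructor
  · rintro ⟨⟨_, g, rfl⟩, hg⟩
    exact ⟨g, hg⟩
  · rintro ⟨g, hg⟩
    exact ⟨⟨_, g, rfl⟩, hg⟩

variable (A)

/-- The group of all lifts to `ℂ³` of the transformations `Φ(g)`, so that `X = ℂ³ / Γ`. -/
def deckGroup : Subgroup (Equiv.Perm C3) where
  carrier := {γ | ∃ g b, A.IsLift g b ∧ ∀ z, γ z = ρ₁ g *ᵥ z + b}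
  one_mem' := ⟨1, 0, isLift_one_iff.2 (zero_mem _), by simp⟩
  mul_mem' := by
    rintro γ γ' ⟨g, b, hb, e⟩ ⟨g', b', hb', e'⟩
    refine ⟨_, _, hb.mul hb', fun z => ?_⟩
    rw [Equiv.Perm.mul_apply, e', e, ρ₁_mul_mulVec, Matrix.mulVec_add, add_assoc]
  inv_mem' := by
    rintro γ ⟨g, b, hb, e⟩
    refine ⟨_, _, hb.inv, fun z => ?_⟩
    rw [Equiv.Perm.inv_eq_iff_eq, e, Matrix.mulVec_add, Matrix.mulVec_neg, ρ₁_mulVec_inv,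
      ρ₁_mulVec_inv]
    simp

variable {A}

/-- The affine map `z ↦ ρ₁(g) z + b` as a permutation of `ℂ³`. -/
noncomputable def affinePerm (g : Z3sq) (b : C3) : Equiv.Perm C3 where
  toFun z := ρ₁ g *ᵥ z + b
  invFun z := ρ₁ g⁻¹ *ᵥ (z - b)
  left_inv z := by simp
  right_inv z := by simp

theorem IsLift.mem {g : Z3sq} {b : C3} (hb : A.IsLift g b) : affinePerm g b ∈ A.deckGroup :=
  ⟨g, b, hb, fun _ => rfl⟩

theorem proj_eq_iff {x y : C3} : A.proj x = A.proj y ↔ x ∈ MulAction.orbit A.deckGroup y := by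
  rw [proj_eq_iff_torus]
  constructor
  · rintro ⟨g, hg⟩
    obtain ⟨b, hb, e⟩ := exists_isLift_apply_eq hg
    exact ⟨⟨_, hb.mem⟩, e⟩
  · rintro ⟨⟨γ, g, b, hb, e⟩, rfl⟩
    exact ⟨g, (hb y).trans (congrArg _ (e y).symm)⟩

theorem proj_deck (γ : A.deckGroup) (x : C3) : A.proj (γ • x) = A.proj x :=
  proj_eq_iff.2 ⟨γ, rfl⟩

theorem isQuotientMap_proj : Topology.IsQuotientMap A.proj :=
  (isQuotientMap_quot_mk (X := A.Torus)).comp (isQuotientMap_quot_mk (X := C3))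

theorem continuous_proj : Continuous A.proj := isQuotientMap_proj.continuous

theorem deck_smul_eq (γ : A.deckGroup) :
    ∃ g b, A.IsLift g b ∧ ∀ z, γ • z = ρ₁ g *ᵥ z + b := γ.2

theorem contDiff_affine {n : WithTop ℕ∞} (g : Z3sq) (b : C3) :
    ContDiff ℂ n fun z : C3 => ρ₁ g *ᵥ z + b :=
  (ρL g).contDiff.add contDiff_const

instance : ContinuousConstSMul A.deckGroup C3 where
  continuous_const_smul γ := by
    obtain ⟨g, b, -, e⟩ := A.deck_smul_eq γ
    simp only [e]
    exact (contDiff_affine (n := 0) g b).continuous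

/-! ### Maps between quotients -/

variable {B C : TorusAction Z3sq ρ₁}

/-- A homeomorphism of `ℂ³` that respects the orbits of the deck groups descends to the
quotients. -/
theorem exists_descend (F : C3 ≃ₜ C3)
    (hF : ∀ x y, A.proj x = A.proj y ↔ B.proj (F x) = B.proj (F y)) :
    ∃ f : A.X ≃ₜ B.X, ∀ z, f (A.proj z) = B.proj (F z) := by
  have hA : ∀ x, A.proj (Function.surjInv isQuotientMap_proj.surjective x) = x :=
    Function.surjInv_eq _
  have hB : ∀ x, B.proj (Function.surjInv isQuotientMap_proj.surjective x) = x :=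
    Function.surjInv_eq _
  have e1 : ∀ z, B.proj (F (Function.surjInv isQuotientMap_proj.surjective (A.proj z))) =
      B.proj (F z) := fun z => (hF _ _).1 (hA _)
  have e2 : ∀ z, A.proj (F.symm (Function.surjInv isQuotientMap_proj.surjective (B.proj z))) =
      A.proj (F.symm z) := fun z => (hF _ _).2 (by simpa using hB _)
  refine ⟨{
    toFun := fun x => B.proj (F (Function.surjInv isQuotientMap_proj.surjective x))
    invFun := fun x => A.proj (F.symm (Function.surjInv isQuotientMap_proj.surjective x))
    left_inv := fun x => (e2 _).trans (by rw [F.symm_apply_apply, hA])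
    right_inv := fun x => (e1 _).trans (by rw [F.apply_symm_apply, hB])
    continuous_toFun := isQuotientMap_proj.continuous_iff.2 ?_
    continuous_invFun := isQuotientMap_proj.continuous_iff.2 ?_ }, e1⟩
  · exact (continuous_proj.comp F.continuous).congr fun z => (e1 z).symm
  · exact (continuous_proj.comp F.symm.continuous).congr fun z => (e2 z).symm

theorem biholomorphic_of_homeomorph (F : C3 ≃ₜ C3) (h1 : Differentiable ℂ F)
    (h2 : Differentiable ℂ F.symm)
    (hF : ∀ x y, A.proj x = A.proj y ↔ B.proj (F x) = B.proj (F y)) : Biholomorphic A B := by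
  obtain ⟨f, hf⟩ := exists_descend F hF
  have e : ∀ φ : B.X → ℂ, (φ ∘ f) ∘ A.proj = (φ ∘ B.proj) ∘ F := fun φ => by
    ext z
    simp [hf]
  refine ⟨f, fun U _ φ => ?_⟩
  rw [HolomorphicOn, HolomorphicOn, e]
  constructor
  · intro hφ
    exact hφ.comp h1.differentiableOn fun z hz => by simpa [hf] using hz
  · intro hφ
    have := hφ.comp (s := B.proj ⁻¹' U) h2.differentiableOn fun z hz => by simpa [hf] using hz
    simpa [Function.comp_assoc] using this

theorem exists_diffeomorphism_of_homeomorph (F : C3 ≃ₜ C3) (h1 : ContDiff ℝ ∞ F)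
    (h2 : ContDiff ℝ ∞ F.symm)
    (hF : ∀ x y, A.proj x = A.proj y ↔ B.proj (F x) = B.proj (F y)) :
    ∃ f : A.X ≃ₜ B.X, IsDiffeomorphism f ∧ ∀ z, f (A.proj z) = B.proj (F z) := by
  obtain ⟨f, hf⟩ := exists_descend F hF
  have e : ∀ φ : B.X → ℝ, (φ ∘ f) ∘ A.proj = (φ ∘ B.proj) ∘ F := fun φ => by
    ext z
    simp [hf]
  refine ⟨f, fun U _ φ => ?_, hf⟩
  rw [SmoothOn, SmoothOn, e]
  constructor
  · intro hφ
    exact hφ.comp h1.contDiffOn fun z hz => by simpa [hf] using hz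
  · intro hφ
    have := hφ.comp (s := B.proj ⁻¹' U) h2.contDiffOn fun z hz => by simpa [hf] using hz
    simpa [Function.comp_assoc] using this

/-- It is enough to check that a map respects the orbits on the generators `h`, `k`. -/
theorem proj_eq_iff_of_generators (F : C3 ≃ C3) (θ : Z3sq ≃* Z3sq)
    (hΛ : ∀ x y, x - y ∈ A.lattice ↔ F x - F y ∈ B.lattice)
    (hh : ∀ z, ∃ w, A.Φ (θ h) (A.toTorus z) = A.toTorus w ∧
      B.Φ h (B.toTorus (F z)) = B.toTorus (F w))
    (hk : ∀ z, ∃ w, A.Φ (θ k) (A.toTorus z) = A.toTorus w ∧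
      B.Φ k (B.toTorus (F z)) = B.toTorus (F w)) (x y : C3) :
    A.proj x = A.proj y ↔ B.proj (F x) = B.proj (F y) := by
  have hT : ∀ x y, A.toTorus x = A.toTorus y ↔ B.toTorus (F x) = B.toTorus (F y) := fun x y => by
    rw [toTorus_eq_iff, toTorus_eq_iff, hΛ]
  let P : Z3sq → Prop := fun g => ∀ z, ∃ w, A.Φ (θ g) (A.toTorus z) = A.toTorus w ∧
      B.Φ g (B.toTorus (F z)) = B.toTorus (F w)
  have hmul : ∀ g g', P g → P g' → P (g * g') := fun g g' hg hg' z => by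
    obtain ⟨w, e1, e2⟩ := hg' z
    obtain ⟨w', e3, e4⟩ := hg w
    exact ⟨w', by rw [map_mul, map_mul, Equiv.Perm.mul_apply, e1, e3],
      by rw [map_mul, Equiv.Perm.mul_apply, e2, e4]⟩
  have hone : P 1 := fun z => ⟨z, by simp, by simp⟩
  have hpow : ∀ g, P g → ∀ n : ℕ, P (g ^ n) := fun g hg n => by
    induction n with
    | zero => simpa using hone
    | succ n ih => rw [pow_succ]; exact hmul _ _ ih hg
  have hgen : ∀ g : Z3sq, ∃ m n : ℕ, g = h ^ m * k ^ n := by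
    have : ∀ g : Z3sq, ∃ m n : Fin 3, g = h ^ m.1 * k ^ n.1 := by decide
    exact fun g => let ⟨m, n, e⟩ := this g; ⟨m, n, e⟩
  have hP : ∀ g, P g := fun g => by
    obtain ⟨m, n, rfl⟩ := hgen g
    exact hmul _ _ (hpow _ hh m) (hpow _ hk n)
  rw [proj_eq_iff_torus, proj_eq_iff_torus]
  constructor
  · rintro ⟨g, hg⟩
    obtain ⟨w, e1, e2⟩ := hP (θ.symm g) y
    rw [MulEquiv.apply_symm_apply, hg, hT] at e1
    exact ⟨_, e2.trans e1.symm⟩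
  · rintro ⟨g, hg⟩
    obtain ⟨w, e1, e2⟩ := hP g y
    rw [hg, ← hT] at e2
    exact ⟨_, e1.trans e2.symm⟩

end TorusAction

/-! ### Lattices between `ℤ[ζ]³` and `tℤ[ζ]³` -/

/-- The map `n ↦ (n₁ t, n₂ t, n₃ t)`. -/
noncomputable def tvec : (Fin 3 → ℤ) →ₗ[ℤ] C3 where
  toFun n i := n i * t
  map_add' m n := by ext i; simp [add_mul]
  map_smul' c n := by ext i; simp [mul_assoc]

theorem tvec_apply (n : Fin 3 → ℤ) (i : Fin 3) : tvec n i = n i * t := rfl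

/-- The lattice `ℤ[ζ]³ + C t` for a subgroup `C` of `ℤ³`. -/
noncomputable def codeLattice (C : Submodule ℤ (Fin 3 → ℤ)) : Submodule ℤ C3 :=
  eisensteinCube ⊔ C.map tvec

theorem mem_codeLattice {C : Submodule ℤ (Fin 3 → ℤ)} {v : C3} :
    v ∈ codeLattice C ↔ ∃ n ∈ C, ∀ i, v i - n i * t ∈ Eis := by
  rw [codeLattice, Submodule.mem_sup]
  constructor
  · rintro ⟨y, hy, _, ⟨n, hn, rfl⟩, rfl⟩
    exact ⟨n, hn, fun i => by simpa [tvec_apply] using mem_eisensteinCube.1 hy i⟩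
  · rintro ⟨n, hn, hv⟩
    exact ⟨v - tvec n, mem_eisensteinCube.2 hv, _, ⟨n, hn, rfl⟩, by simp⟩

/-- The codes of the five lattices. -/
def code : Label → Submodule ℤ (Fin 3 → ℤ)
  | .Y3 => ⊥
  | .Y4 => Submodule.span ℤ {![1, 1, 0]}
  | .Y4' => Submodule.span ℤ {![1, 0, 1]}
  | .Y5 => Submodule.span ℤ {![1, 1, 1]}
  | .Y6 => Submodule.span ℤ {![1, 1, 1], ![1, -1, 0]}

theorem modelLattice_eq (i : Label) : modelLattice i = codeLattice (code i) := by
  have e1 : tvec ![1, 1, 0] = ![t, t, 0] := by ext j; fin_cases j <;> simp [tvec_apply]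
  have e2 : tvec ![1, 0, 1] = ![t, 0, t] := by ext j; fin_cases j <;> simp [tvec_apply]
  have e3 : tvec ![1, 1, 1] = ![t, t, t] := by ext j; fin_cases j <;> simp [tvec_apply]
  have e4 : tvec ![1, -1, 0] = ![t, -t, 0] := by ext j; fin_cases j <;> simp [tvec_apply]
  cases i <;>
    simp [modelLattice, codeLattice, code, Submodule.map_span, Set.image_pair, e1, e2, e3, e4]

theorem mem_code {i : Label} {n : Fin 3 → ℤ} : n ∈ code i ↔ ∃ x y : ℤ, n = match i with
    | .Y3 => 0
    | .Y4 => ![x, x, 0]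
    | .Y4' => ![x, 0, x]
    | .Y5 => ![x, x, x]
    | .Y6 => ![x + y, x - y, x] := by
  cases i <;> simp [code, Submodule.mem_span_singleton, Submodule.mem_span_pair, eq_comm,
    sub_eq_add_neg]

theorem mulVec_mem_codeLattice {C : Submodule ℤ (Fin 3 → ℤ)} (g : Z3sq) {v : C3}
    (hv : v ∈ codeLattice C) : ρ₁ g *ᵥ v ∈ codeLattice C := by
  obtain ⟨n, hn, hv⟩ := mem_codeLattice.1 hv
  refine mem_codeLattice.2 ⟨n, hn, fun i => ?_⟩
  rw [ρ₁_mulVec]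
  have key : ∀ m : ℕ, ζ ^ m * v i - n i * t ∈ Eis := fun m => by
    have : ζ ^ m * v i - n i * t = ζ ^ m * (v i - n i * t) + n i * (ζ ^ m * t - t) := by ring
    rw [this]
    exact add_mem (Eis_mul (ζ_pow_mem_Eis m) (hv i))
      (Eis_mul (int_mem_Eis _) (ζ_pow_mul_t_sub m))
  fin_cases i
  · exact key _
  · exact key _
  · exact key _

theorem three_mul_mem_Eis_of_mem_codeLattice {C : Submodule ℤ (Fin 3 → ℤ)} {v : C3}
    (hv : v ∈ codeLattice C) (i : Fin 3) : 3 * v i ∈ Eis := by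
  obtain ⟨n, -, hv⟩ := mem_codeLattice.1 hv
  have : 3 * v i = (3 : ℤ) * (v i - n i * t) + n i * (3 * t) := by push_cast; ring
  rw [this]
  exact add_mem (Eis_mul (int_mem_Eis _) (hv i)) (Eis_mul (int_mem_Eis _) three_mul_t_mem_Eis)

theorem cube_le_codeLattice (C : Submodule ℤ (Fin 3 → ℤ)) : eisensteinCube ≤ codeLattice C :=
  le_sup_left

instance discrete_codeLattice (C : Submodule ℤ (Fin 3 → ℤ)) :
    DiscreteTopology (codeLattice C) := by
  refine discreteTopology_of_isOpen_singleton_zero ?_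
  rw [Metric.isOpen_singleton_iff]
  -- The coordinates of lattice vectors lie in ℤ[ζ]/3, whose nonzero elements have absolute value at
  -- least 1/3.
  refine ⟨1 / 3, by norm_num, fun v hv => ?_⟩
  rw [dist_zero_right] at hv
  ext i
  by_contra h0
  have h1 := one_le_norm_of_mem_Eis (three_mul_mem_Eis_of_mem_codeLattice v.2 i)
    (mul_ne_zero three_ne_zero h0)
  have h2 : ‖(v : C3) i‖ ≤ ‖v‖ := norm_le_pi_norm (v : C3) i
  rw [norm_mul] at h1
  norm_num at h1
  linarith

instance isZLattice_codeLattice (C : Submodule ℤ (Fin 3 → ℤ)) : IsZLattice ℝ (codeLattice C) := by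
  constructor
  rw [eq_top_iff]
  intro v _
  have hs : ∀ (i : Fin 3) (w : ℂ), w ∈ Eis →
      (Pi.single i w : C3) ∈ Submodule.span ℝ (codeLattice C : Set C3) := fun i w hw =>
    Submodule.subset_span (cube_le_codeLattice C (mem_eisensteinCube.2 fun j => by
      by_cases e : j = i
      · subst e; simpa using hw
      · simp [e]))
  rw [← Finset.univ_sum_single v]
  refine Submodule.sum_mem _ fun i _ => ?_
  obtain ⟨a, b, e⟩ := exists_add_mul_ζ (v i)
  have : (Pi.single i (v i) : C3) = a • (Pi.single i 1 : C3) + b • (Pi.single i ζ : C3) := by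
    rw [e]
    ext j
    by_cases e : j = i
    · subst e; simp
    · simp [e]
  rw [this]
  exact add_mem (Submodule.smul_mem _ _ (hs _ _ one_mem_Eis))
    (Submodule.smul_mem _ _ (hs _ _ ζ_mem_Eis))

/-! ### Actions defined by generators -/

section Construction

variable {Λ : Submodule ℤ C3}

/-- The affine map `z ↦ ρ₁(g) z + b` on the torus `ℂ³ / Λ`. -/
noncomputable def affineTorus (hΛ : ∀ g, ∀ v ∈ Λ, ρ₁ g *ᵥ v ∈ Λ) (g : Z3sq) (b : C3) :
    Equiv.Perm (C3 ⧸ Λ) where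
  toFun x := Λ.mapQ Λ ((ρL g).restrictScalars ℤ).toLinearMap (hΛ g) x + Submodule.Quotient.mk b
  invFun x := Λ.mapQ Λ ((ρL g⁻¹).restrictScalars ℤ).toLinearMap (hΛ g⁻¹)
    (x - Submodule.Quotient.mk b)
  left_inv x := by
    obtain ⟨z, rfl⟩ := Submodule.Quotient.mk_surjective _ x
    simp [ρL_apply]
  right_inv x := by
    obtain ⟨z, rfl⟩ := Submodule.Quotient.mk_surjective _ x
    change Submodule.Quotient.mk (ρ₁ g *ᵥ (ρ₁ g⁻¹ *ᵥ (z - b)) + b) = _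
    rw [ρ₁_mulVec_inv, sub_add_cancel]

variable {hΛ : ∀ g, ∀ v ∈ Λ, ρ₁ g *ᵥ v ∈ Λ}

theorem affineTorus_mk (g : Z3sq) (b z : C3) :
    affineTorus hΛ g b (Submodule.Quotient.mk z) = Submodule.Quotient.mk (ρ₁ g *ᵥ z + b) := rfl

theorem affineTorus_mul (g g' : Z3sq) (b b' : C3) :
    affineTorus hΛ g b * affineTorus hΛ g' b' = affineTorus hΛ (g * g') (ρ₁ g *ᵥ b' + b) := by
  ext x
  obtain ⟨z, rfl⟩ := Submodule.Quotient.mk_surjective _ x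
  rw [Equiv.Perm.mul_apply, affineTorus_mk, affineTorus_mk, affineTorus_mk, ρ₁_mul_mulVec,
    Matrix.mulVec_add, add_assoc]

theorem affineTorus_congr (g : Z3sq) {b b' : C3} (e : b - b' ∈ Λ) :
    affineTorus hΛ g b = affineTorus hΛ g b' := by
  ext x
  obtain ⟨z, rfl⟩ := Submodule.Quotient.mk_surjective _ x
  rw [affineTorus_mk, affineTorus_mk, Submodule.Quotient.eq]
  simpa using e

theorem affineTorus_one {b : C3} (e : b ∈ Λ) : affineTorus hΛ 1 b = 1 := by
  rw [affineTorus_congr (b' := 0) 1 (by simpa using e)]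
  ext x
  obtain ⟨z, rfl⟩ := Submodule.Quotient.mk_surjective _ x
  simp [affineTorus_mk]

theorem affineTorus_pow (g : Z3sq) (b : C3) (n : ℕ) :
    ∃ b', affineTorus hΛ g b ^ n = affineTorus hΛ (g ^ n) b' := by
  induction n with
  | zero => exact ⟨0, by rw [pow_zero, pow_zero, affineTorus_one (zero_mem _)]⟩
  | succ n ih =>
    obtain ⟨b', e⟩ := ih
    exact ⟨_, by rw [pow_succ, e, affineTorus_mul, ← pow_succ]⟩

theorem pow_val_add {M : Type*} [Monoid M] {x : M} (hx : x ^ 3 = 1) (a b : ZMod 3) :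
    x ^ (a + b).val = x ^ a.val * x ^ b.val := by
  rw [ZMod.val_add, ← pow_add]
  conv_rhs => rw [← Nat.mod_add_div (a.val + b.val) 3, pow_add, pow_mul, hx, one_pow, mul_one]

/-- The homomorphism on `ℤ₃²` that sends `h` to `x` and `k` to `y`. -/
def homOfGenerators {M : Type*} [Monoid M] (x y : M) (hx : x ^ 3 = 1) (hy : y ^ 3 = 1)
    (hxy : Commute x y) : Z3sq →* M where
  -- Since h = (0, -1) and k = (1, 1), one has (a, b) = (a - b)h + ak.
  toFun g := x ^ (g.toAdd.1 - g.toAdd.2).val * y ^ g.toAdd.1.val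
  map_one' := by simp
  map_mul' g g' := by
    have e : (g * g').toAdd.1 - (g * g').toAdd.2 =
        (g.toAdd.1 - g.toAdd.2) + (g'.toAdd.1 - g'.toAdd.2) := by
      simp only [toAdd_mul, Prod.fst_add, Prod.snd_add]
      ring
    have e' : (g * g').toAdd.1 = g.toAdd.1 + g'.toAdd.1 := rfl
    rw [e, e', pow_val_add hx, pow_val_add hy]
    exact ((hxy.pow_pow _ _).symm.mul_mul_mul_comm _ _).symm ▸ rfl

/-- Only two relations impose conditions. In the cube of Φ(h) the sum 1 + χ + χ² triples the first
coordinate of a and kills the others, which gives `h1`; commutation with Φ(k) gives `h2`. -/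
theorem exists_action [DiscreteTopology Λ] [IsZLattice ℝ Λ]
    (hΛ : ∀ g, ∀ v ∈ Λ, ρ₁ g *ᵥ v ∈ Λ) {a : C3} (h1 : (Pi.single 0 (3 * a 0) : C3) ∈ Λ)
    (h2 : ρ₁ k *ᵥ a - a ∈ Λ) :
    ∃ A : TorusAction Z3sq ρ₁, A.lattice = Λ ∧ A.IsLift h a ∧ A.IsLift k 0 := by
  have hH : affineTorus hΛ h a ^ 3 = 1 := by
    rw [pow_succ, pow_two, affineTorus_mul, affineTorus_mul, ← pow_two, ← pow_succ,
      Z3sq_pow_three]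
    apply affineTorus_one
    convert! h1 using 1
    ext i
    rw [pow_two, ρ₁_mul_mulVec, ρ₁_h]
    fin_cases i
    · simp [Matrix.mulVec_diagonal]; ring
    · simp [Matrix.mulVec_diagonal]
      linear_combination a 1 * (1 + ζ ^ 2 - ζ) * ζ_sq
    · simp [Matrix.mulVec_diagonal]
      linear_combination a 2 * (1 + ζ ^ 2 - ζ) * ζ_sq
  have hK : affineTorus hΛ k 0 ^ 3 = 1 := by
    rw [pow_succ, pow_two, affineTorus_mul, affineTorus_mul, ← pow_two, ← pow_succ,
      Z3sq_pow_three]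
    apply affineTorus_one
    simp
  have hc : Commute (affineTorus hΛ h a) (affineTorus hΛ k 0) := by
    change _ * _ = _ * _
    rw [affineTorus_mul, affineTorus_mul, mul_comm k h]
    apply affineTorus_congr
    simpa using neg_mem h2
  let Φ := homOfGenerators _ _ hH hK hc
  have hg : ∀ g : Z3sq, h ^ (g.toAdd.1 - g.toAdd.2).val * k ^ (g.toAdd.1).val = g := by decide
  have hΦ : ∀ g, ∃ b, Φ g = affineTorus hΛ g b := fun g => by
    obtain ⟨b, e⟩ := affineTorus_pow (hΛ := hΛ) h a (g.toAdd.1 - g.toAdd.2).val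
    obtain ⟨b', e'⟩ := affineTorus_pow (hΛ := hΛ) k 0 (g.toAdd.1).val
    have e'' : Φ g = _ * _ := congrArg₂ (· * ·) e e'
    rw [affineTorus_mul, hg] at e''
    exact ⟨_, e''⟩
  refine ⟨⟨Λ, Φ, fun g => ?_⟩, rfl, fun z => ?_, fun z => ?_⟩
  · obtain ⟨b, e⟩ := hΦ g
    exact ⟨b, fun z => by rw [e, affineTorus_mk]⟩
  · change (affineTorus hΛ h a ^ _ * affineTorus hΛ k 0 ^ _) _ = _
    rfl
  · change (affineTorus hΛ h a ^ _ * affineTorus hΛ k 0 ^ _) _ = _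
    rfl

end Construction

/-! ### Group elements fixing a coordinate axis -/

theorem ζ_pow_val_eq_one {a : ZMod 3} : ζ ^ a.val = 1 ↔ a = 0 := by
  constructor
  · intro ha
    fin_cases a
    · rfl
    · exact absurd ha (by simpa [ZMod.val] using ζ_ne_one)
    · exact absurd ha (by simpa [ZMod.val] using ζ_sq_ne_one)
  · rintro rfl
    simp

theorem χ_eq_one_iff {g : Z3sq} {i : Fin 3} :
    χ g i = 1 ↔ ![g.toAdd.1, g.toAdd.2, g.toAdd.1 + g.toAdd.2] i = 0 := by
  fin_cases i <;> simp [χ, ζ_pow_val_eq_one]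

/-- Nontrivial elements of `ℤ₃²` with a fixed vector on the coordinate axes. -/
def axisElt : Fin 3 → Z3sq := ![h, h * k, h * k ^ 2]

theorem χ_axisElt (j i : Fin 3) : χ (axisElt j) i = 1 ↔ i = j := by
  rw [χ_eq_one_iff]
  revert i j
  decide

theorem axisElt_ne_one (j : Fin 3) : axisElt j ≠ 1 := by
  revert j
  decide

/-- Apart from 1, the elements k and k² have no eigenvalue 1, and the other six come in mutually
inverse pairs, one pair per axis. -/
theorem eq_axisElt (g : Z3sq) : g = 1 ∨ g = k ∨ g = k ^ 2 ∨
    ∃ j, g = axisElt j ∨ g ^ 2 = axisElt j := by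
  revert g
  decide

/-! ### Finite fixed locus in terms of translation parts -/

namespace TorusAction

variable {A : TorusAction Z3sq ρ₁}

theorem isClosed_lattice (A : TorusAction Z3sq ρ₁) : IsClosed (A.lattice : Set C3) :=
  @AddSubgroup.isClosed_of_discrete _ _ _ _ _ A.lattice.toAddSubgroup A.discrete

theorem finite_closedBall_inter_lattice (A : TorusAction Z3sq ρ₁) (r : ℝ) :
    (Metric.closedBall 0 r ∩ (A.lattice : Set C3)).Finite :=
  Metric.finite_isBounded_inter_isClosed ⟨A.discrete⟩ Metric.isBounded_closedBall A.isClosed_lattice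

theorem exists_bounded_representative (A : TorusAction Z3sq ρ₁) :
    ∃ r : ℝ, ∀ z : C3, ∃ l ∈ A.lattice, ‖z - l‖ ≤ r := by
  let b := Module.Free.chooseBasis ℤ A.lattice
  let b' := b.ofZLatticeBasis ℝ A.lattice
  refine ⟨∑ i, ‖b' i‖, fun z => ⟨ZSpan.floor b' z, ?_, ?_⟩⟩
  · have := (ZSpan.floor b' z).2
    generalize (ZSpan.floor b' z : C3) = w at this ⊢
    rwa [b.ofZLatticeBasis_span ℝ] at this
  · exact ZSpan.norm_fract_le b' z

/-- Three times a bounded representative is a lattice vector in a bounded ball. This will contain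
all fixed points of Φ(k). -/
theorem finite_three_torsion (A : TorusAction Z3sq ρ₁) :
    {x : A.Torus | ∃ z, 3 • z ∈ A.lattice ∧ A.toTorus z = x}.Finite := by
  obtain ⟨r, hr⟩ := A.exists_bounded_representative
  refine ((A.finite_closedBall_inter_lattice (3 * r)).image
    fun l => A.toTorus ((1 / 3 : ℝ) • l)).subset ?_
  rintro _ ⟨z, hz, rfl⟩
  obtain ⟨l, hl, hle⟩ := hr z
  refine ⟨3 • (z - l), ⟨?_, ?_⟩, ?_⟩
  · rw [mem_closedBall_zero_iff, ← Nat.cast_smul_eq_nsmul ℝ, norm_smul]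
    norm_num
    exact hle
  · rw [smul_sub]
    exact sub_mem hz (nsmul_mem hl 3)
  · simp only
    rw [toTorus_eq_iff, ← Nat.cast_smul_eq_nsmul ℝ, smul_smul]
    norm_num
    simpa using hl

/-- Multiplying h by powers of k does not change the translation part, because Φ(k) fixes the
origin. -/
theorem isLift_axisElt {a : C3} (ha : A.IsLift h a) (hk : A.IsLift k 0) (j : Fin 3) :
    ∃ b, A.IsLift (axisElt j) b ∧ b = a := by
  fin_cases j
  · exact ⟨_, ha, rfl⟩
  · exact ⟨_, ha.mul hk, by simp⟩
  · have := ha.mul (hk.mul hk)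
    rw [← pow_two] at this
    exact ⟨_, this, by simp⟩

/-- An element fixing the j-th axis shifts the j-th coordinate by a_j, so by `hne` it has no fixed
point; only k and k² remain, and their fixed points are 3-torsion. -/
theorem finiteFixedLocus_of_forall_ne {a : C3} (ha : A.IsLift h a) (hk : A.IsLift k 0)
    (hne : ∀ v ∈ A.lattice, ∀ j, v j ≠ a j) : A.FiniteFixedLocus := by
  refine A.finite_three_torsion.subset ?_
  rintro x ⟨g, hg, hx⟩
  obtain ⟨z, rfl⟩ := A.toTorus_surjective x
  have hsq : A.Φ (g ^ 2) (A.toTorus z) = A.toTorus z := by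
    rw [pow_two, map_mul, Equiv.Perm.mul_apply, hx, hx]
  have hax : ∀ j, A.Φ (axisElt j) (A.toTorus z) ≠ A.toTorus z := fun j hj => by
    obtain ⟨b, hb, rfl⟩ := isLift_axisElt ha hk j
    rw [hb z, toTorus_eq_iff] at hj
    refine hne _ hj j ?_
    simp only [Pi.sub_apply, Pi.add_apply, ρ₁_mulVec, (χ_axisElt j j).2 rfl]
    ring
  have hk' : A.Φ k (A.toTorus z) = A.toTorus z → 3 • z ∈ A.lattice := fun e => by
    rw [hk z, toTorus_eq_iff, add_zero] at e
    -- On each coordinate (2 + χ)(χ - 1) = χ² + χ - 2 = -3 for the eigenvalue χ of k.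
    have := neg_mem (add_mem (A.lattice.smul_mem (2 : ℤ) e) (mulVec_mem_lattice k e))
    convert! this using 1
    ext i
    have hi : χ k i ^ 2 + χ k i + 1 = 0 := by
      fin_cases i
      · simp [χ, k, ZMod.val_one, ζ_sq]
      · simp [χ, k, ZMod.val_one, ζ_sq]
      · have : χ k 2 = ζ ^ 2 := rfl
        simp only [Fin.reduceFinMk, this]
        linear_combination (1 + ζ ^ 2 - ζ) * ζ_sq
    simp [ρ₁_mulVec]
    linear_combination (z i) * hi
  rcases eq_axisElt g with e | e | e | ⟨j, e | e⟩
  · exact absurd e hg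
  · rw [e] at hx
    exact ⟨z, hk' hx, rfl⟩
  · rw [e, ← pow_mul, pow_succ, Z3sq_pow_three, one_mul] at hsq
    exact ⟨z, hk' hsq, rfl⟩
  · exact absurd (e ▸ hx) (hax j)
  · exact absurd (e ▸ hsq) (hax j)

/-- If v_j = b_j, then ρ₁(g)z + b - z = v is solved by `z₀` in the coordinates other than j and
leaves z_j free. This gives a complex line of fixed points, which is uncountable even modulo the
countable lattice. -/
theorem FiniteFixedLocus.apply_ne (hA : A.FiniteFixedLocus) {j : Fin 3} {b : C3}
    (hb : A.IsLift (axisElt j) b) {v : C3} (hv : v ∈ A.lattice) : v j ≠ b j := by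
  intro e
  let z₀ : C3 := fun i => (v i - b i) / (χ (axisElt j) i - 1)
  let F : ℂ → A.Torus := fun s => A.toTorus (z₀ + Pi.single j s)
  have hF : ∀ s, F s ∈ {x : A.Torus | ∃ g : Z3sq, g ≠ 1 ∧ A.Φ g x = x} := fun s => by
    refine ⟨_, axisElt_ne_one j, ?_⟩
    rw [hb, toTorus_eq_iff]
    convert! hv using 1
    ext i
    simp only [Pi.sub_apply, Pi.add_apply, ρ₁_mulVec]
    by_cases hij : i = j
    · subst hij
      rw [(χ_axisElt i i).2 rfl, e]
      ring
    · have : χ (axisElt j) i - 1 ≠ 0 := sub_ne_zero.2 fun e => hij ((χ_axisElt j i).1 e)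
      simp only [z₀, Pi.single_eq_of_ne hij]
      field_simp
      ring
  have hcount : (Set.univ : Set ℂ).Countable := by
    have hc : (⋃ x ∈ {x : A.Torus | ∃ g : Z3sq, g ≠ 1 ∧ A.Φ g x = x}, F ⁻¹' {x}).Countable := by
      refine Set.Countable.biUnion (Set.Finite.countable hA) fun x _ => ?_
      rcases (F ⁻¹' {x}).eq_empty_or_nonempty with h0 | ⟨s, hs⟩
      · simp [h0]
      · have hΛ : Countable A.lattice := inferInstance
        refine Set.MapsTo.countable_of_injOn (f := fun s' => (Pi.single j (s' - s) : C3))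
          (t := (A.lattice : Set C3)) ?_ ?_ (Set.countable_coe_iff.1 hΛ)
        · intro s' hs'
          have e : F s' = F s := hs'.trans hs.symm
          rw [toTorus_eq_iff] at e
          simpa [Pi.single_sub] using e
        · intro s' _ s'' _ e
          simpa using congrFun e j
    refine hc.mono fun s _ => ?_
    exact Set.mem_biUnion (hF s) rfl
  exact not_countable_complex hcount

end TorusAction

/-! ### The five models -/

set_option linter.unusedSimpArgs false in
theorem exists_model (i : Label) :
    ∃ A : TorusAction Z3sq ρ₁, IsModel i A ∧ A.FiniteFixedLocus := by
  have hζ : 2 * ζ ^ 2 = -2 - 2 * ζ := by rw [ζ_sq]; ring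
  -- A third of a unit is never congruent to a multiple of t, as 1 - ζ kills only the latter; this
  -- gives freeness along the nonsplit axes.
  have hadd : ∀ n : ℤ, 3⁻¹ - n * t ∉ Eis ∧ 2 / 3 - n * t ∉ Eis ∧
      2 * ζ ^ 2 / 3 - n * t ∉ Eis := fun n => by
    have e1 : (3⁻¹ - n * t : ℂ) = ((1 - n : ℤ) + (-2 * n : ℤ) * ζ) / 3 := by
      rw [t]; push_cast; ring
    have e2 : (2 / 3 - n * t : ℂ) = ((2 - n : ℤ) + (-2 * n : ℤ) * ζ) / 3 := by
      rw [t]; push_cast; ring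
    have e3 : (2 * ζ ^ 2 / 3 - n * t : ℂ) = ((-2 - n : ℤ) + (-2 - 2 * n : ℤ) * ζ) / 3 := by
      rw [t, hζ]; push_cast; ring
    rw [e1, e2, e3, third_mem_Eis, third_mem_Eis, third_mem_Eis]
    omega
  have hE : ∀ {z : ℂ} (a b : ℤ), z = a + b * ζ → z ∈ Eis := fun a b e => mem_Eis.2 ⟨a, b, e⟩
  have h1 : (Pi.single 0 (3 * modelTranslation i 0) : C3) ∈ codeLattice (code i) := by
    refine cube_le_codeLattice _ (mem_eisensteinCube.2 fun j => ?_)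
    by_cases hj : j = 0
    · subst hj
      cases i <;> simp [modelTranslation, three_mul_t_mem_Eis, one_mem_Eis]
    · simp [hj]
  have h2 : ρ₁ k *ᵥ modelTranslation i - modelTranslation i ∈ codeLattice (code i) := by
    have c1 : ζ * 3⁻¹ - 3⁻¹ + t ∈ Eis := hE 0 1 (by rw [t]; push_cast; ring)
    have c2 : ζ ^ 2 * (2 / 3) - 2 / 3 + t ∈ Eis := hE (-1) 0 (by rw [t, ζ_sq]; push_cast; ring)
    have c3 : ζ ^ 2 * (2 * ζ ^ 2 / 3) - 2 * ζ ^ 2 / 3 + t ∈ Eis := hE 1 2 (by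
      rw [t, hζ, ζ_sq]; push_cast; linear_combination (2 / 3 : ℂ) * ζ_sq)
    have c4 := ζ_pow_mul_t_sub 2
    have c5 := ζ_mul_t_sub
    -- Modulo ℤ[ζ], the j-th entry of ρ₁(k)a - a is 0 where a_j = t and -t elsewhere.
    refine mem_codeLattice.2 ⟨_, mem_code.2 ⟨-1, 0, rfl⟩, fun j => ?_⟩
    have k0 : χ k 0 = ζ := by simp [χ, k, ZMod.val_one]
    have k1 : χ k 1 = ζ := by simp [χ, k, ZMod.val_one]
    have k2 : χ k 2 = ζ ^ 2 := rfl
    cases i <;> fin_cases j <;> simp [modelTranslation, ρ₁_mulVec, k0, k1, k2, c1, c2, c3, c4, c5]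
  obtain ⟨A, e1, e2, e3⟩ := exists_action (fun g v => mulVec_mem_codeLattice g) h1 h2
  refine ⟨A, ⟨?_, ?_, ?_⟩, TorusAction.finiteFixedLocus_of_forall_ne e2 e3 fun v hv j hj => ?_⟩
  · rw [e1, modelLattice_eq]
  · intro z
    rw [e2 z, ρ₁_h]
  · intro z
    rw [e3 z, ρ₁_k, add_zero]
  · rw [e1] at hv
    obtain ⟨n, hn, hv⟩ := mem_codeLattice.1 hv
    have hv := hv j
    rw [hj] at hv
    obtain ⟨x, y, rfl⟩ := mem_code.1 hn
    cases i <;> fin_cases j <;>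
      simp [modelTranslation, ← Int.cast_add, ← Int.cast_sub, hadd, t_notMem_Eis] at hv

/-! ### Complements of closed countable sets -/

section Visible

open MeasureTheory

variable {E : Type*} [NormedAddCommGroup E] [NormedSpace ℝ E]

/-- Affine subspaces of dimension at most two are Haar null, and so is a countable union of them. -/
theorem exists_notMem_planes [FiniteDimensional ℝ E] (hE : 2 < Module.finrank ℝ E)
    {ι : Type*} [Countable ι] (a u v : ι → E) :
    ∃ w : E, ∀ i, w - a i ∉ Submodule.span ℝ {u i, v i} := by
  let : MeasurableSpace E := borel E
  have : BorelSpace E := ⟨rfl⟩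
  let P : ι → AffineSubspace ℝ E := fun i => AffineSubspace.mk' (a i) (Submodule.span ℝ {u i, v i})
  have hP : ∀ i, P i ≠ ⊤ := fun i e => by
    have h1 : Submodule.span ℝ {u i, v i} = ⊤ := by
      rw [← AffineSubspace.direction_mk' (a i) (Submodule.span ℝ {u i, v i})]
      change (P i).direction = ⊤
      rw [e, AffineSubspace.direction_top]
    have h2 : Module.finrank ℝ (Submodule.span ℝ ({u i, v i} : Set E)) ≤ 2 := by
      classical
      have := finrank_span_finset_le_card (R := ℝ) ({u i, v i} : Finset E)
      rw [Finset.coe_pair] at this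
      exact this.trans Finset.card_le_two
    rw [h1, finrank_top] at h2
    omega
  have h0 : (Measure.addHaar : Measure E) (⋃ i, (P i : Set E)) = 0 :=
    measure_iUnion_null_iff.2 fun i => Measure.addHaar_affineSubspace _ _ (hP i)
  have hne : (⋃ i, (P i : Set E)) ≠ Set.univ := fun e => by
    rw [e] at h0
    exact NeZero.ne _ (Measure.measure_univ_eq_zero.1 h0)
  obtain ⟨w, hw⟩ := (Set.ne_univ_iff_exists_notMem _).1 hne
  exact ⟨w, fun i hmem => hw (Set.mem_iUnion.2 ⟨i, AffineSubspace.mem_mk'.2 hmem⟩)⟩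

/-- The points that are visible from `p` in the complement of `D`. -/
def visible (D : Set E) (p : E) : Set E := {z | ∀ s ∈ Set.Icc (0 : ℝ) 1, p + s • (z - p) ∉ D}

variable {D : Set E} {p q : E}

/-- The complement is the projection of a closed set along the compact factor [0, 1]. -/
theorem isOpen_visible (hD : IsClosed D) (p : E) : IsOpen (visible D p) := by
  have : (visible D p)ᶜ = Prod.snd ''
      ((fun x : Set.Icc (0 : ℝ) 1 × E => p + (x.1 : ℝ) • (x.2 - p)) ⁻¹' D) := by
    ext z
    simp [visible, and_assoc]
  rw [← isClosed_compl_iff, this]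
  exact isClosedMap_snd_of_compactSpace _ (hD.preimage (by fun_prop))

theorem self_mem_visible (hp : p ∉ D) : p ∈ visible D p := fun s _ => by simpa using hp

theorem visible_subset : visible D p ⊆ Dᶜ := fun z hz => by
  simpa using hz 1 (by simp)

theorem starConvex_visible : StarConvex ℝ p (visible D p) := by
  intro z hz a b ha hb hab s hs
  have : p + s • (a • p + b • z - p) = p + (s * b) • (z - p) := by
    obtain rfl : a = 1 - b := by linarith
    module
  rw [this]
  exact hz _ ⟨mul_nonneg hs.1 hb, mul_le_one₀ hs.2 hb (by linarith)⟩

/-- If the view from p to a point between x and w were blocked by d, then w would lie in the plane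
through p, d and x. -/
theorem segment_subset_visible {x w : E} (hp : p ∉ D) (hx : x ∈ visible D p)
    (hw : ∀ d ∈ D, w - p ∉ Submodule.span ℝ {d - p, x - p}) :
    segment ℝ x w ⊆ visible D p := by
  rintro _ ⟨a, b, ha, hb, hab, rfl⟩ r hr hd
  obtain rfl : a = 1 - b := by linarith
  have hr0 : r ≠ 0 := by
    rintro rfl
    simp at hd
    exact hp hd
  have hb0 : b ≠ 0 := by
    rintro rfl
    simp at hd
    exact hx r hr hd
  -- The coefficients solve d = p + r((1 - b)x + bw - p) for w - p.
  refine hw _ hd (Submodule.mem_span_pair.2 ⟨1 / (r * b), -((1 - b) / b), ?_⟩)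
  match_scalars <;> (field_simp; try ring)

variable [FiniteDimensional ℝ E] (hE : 2 < Module.finrank ℝ E) (hD : D.Countable)
include hE hD

/-- Two points are joined through a generic third point w; countably many planes must be avoided for
both segments to stay visible from p and from q. -/
theorem isPathConnected_visible_inter (hp : p ∉ D) (hq : q ∉ D) :
    IsPathConnected (visible D p ∩ visible D q) := by
  have key : ∀ x y x' y' : E, ∃ w, ∀ d ∈ D, w - p ∉ Submodule.span ℝ {d - p, x - p} ∧
      w - q ∉ Submodule.span ℝ {d - q, x' - q} ∧ w - p ∉ Submodule.span ℝ {d - p, y - p} ∧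
      w - q ∉ Submodule.span ℝ {d - q, y' - q} := fun x y x' y' => by
    have : Countable D := hD
    obtain ⟨w, hw⟩ := exists_notMem_planes hE (ι := D × Fin 4) (fun i => ![p, q, p, q] i.2)
      (fun i => i.1 - ![p, q, p, q] i.2) (fun i => ![x, x', y, y'] i.2 - ![p, q, p, q] i.2)
    exact ⟨w, fun d hd => ⟨hw (⟨d, hd⟩, 0), hw (⟨d, hd⟩, 1), hw (⟨d, hd⟩, 2), hw (⟨d, hd⟩, 3)⟩⟩
  rw [isPathConnected_iff]
  constructor
  · obtain ⟨w, hw⟩ := key p p q q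
    exact ⟨w, segment_subset_visible hp (self_mem_visible hp) (fun d hd => (hw d hd).1)
      (right_mem_segment ℝ _ _), segment_subset_visible hq (self_mem_visible hq)
      (fun d hd => (hw d hd).2.1) (right_mem_segment ℝ _ _)⟩
  · rintro x ⟨hx, hx'⟩ y ⟨hy, hy'⟩
    obtain ⟨w, hw⟩ := key x y x y
    have h1 : JoinedIn (visible D p ∩ visible D q) x w := JoinedIn.of_segment_subset
      (Set.subset_inter (segment_subset_visible hp hx fun d hd => (hw d hd).1)
        (segment_subset_visible hq hx' fun d hd => (hw d hd).2.1))
    have h2 : JoinedIn (visible D p ∩ visible D q) y w := JoinedIn.of_segment_subset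
      (Set.subset_inter (segment_subset_visible hp hy fun d hd => (hw d hd).2.2.1)
        (segment_subset_visible hq hy' fun d hd => (hw d hd).2.2.2))
    exact h1.trans h2.symm

/-- The complement of `D` is the union of two sets of visible points. -/
theorem exists_visible_union (hp : p ∉ D) :
    ∃ q, q ∉ D ∧ visible D p ∪ visible D q = Dᶜ := by
  have : Countable D := hD
  -- If z is hidden from p by d and from q by d', then z is on the line pd and q on the line zd', so
  -- q is in the plane through p, d, d'. A generic q excludes this.
  obtain ⟨q, hq⟩ := exists_notMem_planes hE (ι := D × D) (fun _ => p) (fun d => d.1 - p)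
    (fun d => d.2 - p)
  have hq : ∀ d ∈ D, ∀ d' ∈ D, q - p ∉ Submodule.span ℝ {d - p, d' - p} :=
    fun d hd d' hd' => hq (⟨d, hd⟩, ⟨d', hd'⟩)
  have hqD : q ∉ D := fun hqD => hq q hqD q hqD (Submodule.subset_span (by simp))
  refine ⟨q, hqD, Set.Subset.antisymm (Set.union_subset visible_subset visible_subset) ?_⟩
  intro z hz
  by_contra hn
  rw [Set.mem_union, not_or] at hn
  simp only [visible, Set.mem_ofPred_eq, not_forall, not_not] at hn
  obtain ⟨⟨r, hr, hd⟩, ⟨s, hs, hd'⟩⟩ := hn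
  have hr0 : r ≠ 0 := by
    rintro rfl
    simp at hd
    exact hp hd
  have hs1 : 1 - s ≠ 0 := fun e => by
    obtain rfl : s = 1 := by linarith
    simp at hd'
    exact hz hd'
  refine hq _ hd _ hd' (Submodule.mem_span_pair.2 ⟨-(s / (r * (1 - s))), 1 / (1 - s), ?_⟩)
  match_scalars <;> (field_simp; try ring)

end Visible

namespace TorusAction

variable {A B : TorusAction Z3sq ρ₁}

/-! ### The regular part of the quotient -/

/-- The image in `X` of the points with a nontrivial stabilizer. -/
def sing (A : TorusAction Z3sq ρ₁) : Set A.X :=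
  Quotient.mk (MulAction.orbitRel A.Φ.range A.Torus) '' {x | ∃ g : Z3sq, g ≠ 1 ∧ A.Φ g x = x}

/-- The group is abelian, so the points of an orbit have equal stabilizers. -/
theorem proj_mem_sing_iff {z : C3} :
    A.proj z ∈ A.sing ↔ ∃ g : Z3sq, g ≠ 1 ∧ A.Φ g (A.toTorus z) = A.toTorus z := by
  constructor
  · rintro ⟨x, ⟨g, hg, hx⟩, e⟩
    obtain ⟨w, rfl⟩ := A.toTorus_surjective x
    obtain ⟨g', hg'⟩ := proj_eq_iff_torus.1 e
    refine ⟨g, hg, ?_⟩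
    rw [← hg', ← Equiv.Perm.mul_apply, ← map_mul, mul_comm, map_mul, Equiv.Perm.mul_apply] at hx
    exact (A.Φ g').injective hx
  · rintro ⟨g, hg, e⟩
    exact ⟨_, ⟨g, hg, e⟩, rfl⟩

theorem stabilizer_eq_bot {z : C3} (hz : A.proj z ∉ A.sing) :
    MulAction.stabilizer A.deckGroup z = ⊥ := by
  rw [Subgroup.eq_bot_iff_forall]
  rintro ⟨γ, hγ⟩ e
  obtain ⟨g, b, hb, hγ'⟩ := hγ
  have e : γ z = z := e
  rw [hγ'] at e
  have hg : g = 1 := by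
    by_contra hg
    exact hz (proj_mem_sing_iff.2 ⟨g, hg, by rw [hb, e]⟩)
  subst hg
  have hb0 : b = 0 := by simpa using e
  ext w : 2
  simp [hγ', hb0]

theorem deck_ext {z : C3} (hz : A.proj z ∉ A.sing) {γ γ' : A.deckGroup} (e : γ • z = γ' • z) :
    γ = γ' := by
  have : γ'⁻¹ * γ ∈ MulAction.stabilizer A.deckGroup z := by
    rw [MulAction.mem_stabilizer_iff, mul_smul, e, inv_smul_smul]
  rw [stabilizer_eq_bot hz, Subgroup.mem_bot] at this
  exact (inv_mul_eq_one.1 this).symm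

/-- There are finitely many linear parts, and for each the translation parts form a coset of a
discrete closed group. -/
theorem exists_nhds_deck (A : TorusAction Z3sq ρ₁) (z : C3) :
    ∃ U ∈ nhds z, ∀ γ : A.deckGroup, ((γ • ·) '' U ∩ U).Nonempty → γ • z = z := by
  have key : ∀ g : Z3sq, ∃ U ∈ nhds z, ∀ b, A.IsLift g b → ∀ x ∈ U, ρ₁ g *ᵥ x + b ∈ U →
      ρ₁ g *ᵥ z + b = z := fun g => by
    obtain ⟨b₀, hb₀⟩ := A.exists_isLift g
    have hcl : IsClosed ((A.lattice : Set C3) \ {z - (ρ₁ g *ᵥ z + b₀)}) := by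
      have := A.isClosed_lattice.isClosedEmbedding_subtypeVal.isClosedMap _
        (isClosed_discrete {l : A.lattice | (l : C3) ≠ z - (ρ₁ g *ᵥ z + b₀)})
      convert! this using 1
      ext l
      simp [and_comm]
    have hcont : Continuous fun x : C3 × C3 => x.2 - (ρ₁ g *ᵥ x.1 + b₀) :=
      continuous_snd.sub ((contDiff_affine (n := 0) g b₀).continuous.comp continuous_fst)
    have hmem : (z, z) ∈ (fun x : C3 × C3 => x.2 - (ρ₁ g *ᵥ x.1 + b₀)) ⁻¹'
        ((A.lattice : Set C3) \ {z - (ρ₁ g *ᵥ z + b₀)})ᶜ := by simp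
    have hn := (hcl.isOpen_compl.preimage hcont).mem_nhds hmem
    rw [nhds_prod_eq, Filter.mem_prod_iff] at hn
    obtain ⟨U, hU, V, hV, hUV⟩ := hn
    refine ⟨U ∩ V, Filter.inter_mem hU hV, fun b hb x hx hx' => ?_⟩
    have h1 : (x, ρ₁ g *ᵥ x + b) ∈ U ×ˢ V := ⟨hx.1, hx'.2⟩
    have h2 := hUV h1
    have h3 : ρ₁ g *ᵥ x + b - (ρ₁ g *ᵥ x + b₀) = b - b₀ := by abel
    simp only [Set.mem_preimage, h3, Set.mem_compl_iff, Set.mem_sdiff, not_and, not_not,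
      Set.mem_singleton_iff] at h2
    linear_combination h2 (hb.sub_mem hb₀)
  choose U hU hUb using key
  refine ⟨⋂ g, U g, (Filter.iInter_mem).2 hU, ?_⟩
  rintro γ ⟨_, ⟨x, hx, rfl⟩, hx'⟩
  obtain ⟨g, b, hb, e⟩ := A.deck_smul_eq γ
  rw [e]
  simp only [e] at hx'
  exact hUb g b hb x (Set.mem_iInter.1 hx g) (Set.mem_iInter.1 hx' g)

theorem isCoveringMapOn_proj (A : TorusAction Z3sq ρ₁) : IsCoveringMapOn A.proj A.singᶜ := by
  refine (isQuotientMap_proj.isCoveringMapOn_of_smul_disjoint (G := A.deckGroup) proj_eq_iff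
    A.exists_nhds_deck).mono fun x hx => ?_
  obtain ⟨z, rfl⟩ := isQuotientMap_proj.surjective x
  exact ⟨z, stabilizer_eq_bot hx, rfl⟩

theorem FiniteFixedLocus.isClosed_preimage_sing (hA : A.FiniteFixedLocus) :
    IsClosed (A.proj ⁻¹' A.sing) := by
  have : A.proj ⁻¹' A.sing = ⋃ x ∈ {x : A.Torus | ∃ g : Z3sq, g ≠ 1 ∧ A.Φ g x = x},
      A.toTorus ⁻¹' {x} := by
    ext z
    simp [proj_mem_sing_iff]
  rw [this]
  refine Set.Finite.isClosed_biUnion hA fun x _ => ?_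
  obtain ⟨w, rfl⟩ := A.toTorus_surjective x
  have : A.toTorus ⁻¹' {A.toTorus w} = (fun z => z - w) ⁻¹' (A.lattice : Set C3) := by
    ext z
    simp [toTorus_eq_iff]
  rw [this]
  exact A.isClosed_lattice.preimage (by fun_prop)

theorem FiniteFixedLocus.isClosed_sing (hA : A.FiniteFixedLocus) : IsClosed A.sing :=
  isQuotientMap_proj.isClosed_preimage.1 hA.isClosed_preimage_sing

theorem countable_preimage_proj (A : TorusAction Z3sq ρ₁) (x : A.X) :
    (A.proj ⁻¹' {x}).Countable := by
  obtain ⟨w, rfl⟩ := isQuotientMap_proj.surjective x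
  have hΛ : Countable A.lattice := inferInstance
  have hsub : A.proj ⁻¹' {A.proj w} ⊆ ⋃ g : Z3sq, (fun l : C3 => ρ₁ g *ᵥ w + Classical.choose
      (A.exists_isLift g) + l) '' (A.lattice : Set C3) := by
    intro z hz
    obtain ⟨g, e⟩ := proj_eq_iff_torus.1 hz
    rw [Classical.choose_spec (A.exists_isLift g), eq_comm, toTorus_eq_iff] at e
    exact Set.mem_iUnion.2 ⟨g, _, e, by simp⟩
  refine Set.Countable.mono hsub (Set.countable_iUnion fun g => ?_)
  exact (Set.countable_coe_iff.1 hΛ).image _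

theorem FiniteFixedLocus.finite_sing (hA : A.FiniteFixedLocus) : A.sing.Finite := hA.image _

end TorusAction

namespace TorusAction

variable {A B : TorusAction Z3sq ρ₁}

/-! ### Lifting maps to the quotient -/

/-- Match the two lifts at one point by a deck transformation; uniqueness of lifts to a covering
does the rest. -/
theorem exists_deck_eqOn {F₁ F₂ : C3 → C3} {C : Set C3} (hC : IsPreconnected C)
    (hne : C.Nonempty) (h₁ : ContinuousOn F₁ C) (h₂ : ContinuousOn F₂ C)
    (he : ∀ z ∈ C, B.proj (F₁ z) = B.proj (F₂ z)) (hs : ∀ z ∈ C, B.proj (F₁ z) ∉ B.sing) :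
    ∃ γ : B.deckGroup, ∀ z ∈ C, F₂ z = γ • F₁ z := by
  obtain ⟨z₀, hz₀⟩ := hne
  obtain ⟨γ, hγ⟩ := proj_eq_iff.1 (he z₀ hz₀).symm
  refine ⟨γ, fun z hz => ?_⟩
  have : PreconnectedSpace C := Subtype.preconnectedSpace hC
  let g₁ : C → B.proj ⁻¹' B.singᶜ := fun z => ⟨γ • F₁ z, by
    rw [Set.mem_preimage, proj_deck]; exact hs z z.2⟩
  let g₂ : C → B.proj ⁻¹' B.singᶜ := fun z => ⟨F₂ z, by
    rw [Set.mem_preimage, ← he z z.2]; exact hs z z.2⟩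
  have hg₁ : Continuous g₁ := ((continuousOn_iff_continuous_domRestrict.1 h₁).const_smul γ).subtype_mk _
  have hg₂ : Continuous g₂ := (continuousOn_iff_continuous_domRestrict.1 h₂).subtype_mk _
  have := B.isCoveringMapOn_proj.isCoveringMap_restrictPreimage.eq_of_comp_eq hg₁ hg₂
    (by ext z; exact (proj_deck γ _).trans (he z z.2)) ⟨z₀, hz₀⟩ (Subtype.ext hγ)
  exact (congrArg Subtype.val (congrFun this ⟨z, hz⟩)).symm

/-- The visible set is open and star-shaped, so the lifting criterion for coverings applies. -/
theorem exists_lift_visible {m : C3 → B.X} (hm : Continuous m) {p : C3}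
    (hD : IsClosed (m ⁻¹' B.sing)) (hp : p ∉ m ⁻¹' B.sing) :
    ∃ F : C3 → C3, ContinuousOn F (visible (m ⁻¹' B.sing) p) ∧
      ∀ z ∈ visible (m ⁻¹' B.sing) p, B.proj (F z) = m z := by
  set V := visible (m ⁻¹' B.sing) p with hV
  have hopen : IsOpen V := isOpen_visible hD p
  have hpV : p ∈ V := self_mem_visible hp
  have : ContractibleSpace V := starConvex_visible.contractibleSpace ⟨p, hpV⟩
  have : LocallyPathConnectedSpace V := hopen.locallyPathConnectedSpace
  obtain ⟨e₀, he₀⟩ := (isQuotientMap_proj (A := B)).surjective (m p)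
  obtain ⟨F, ⟨-, hF⟩, -⟩ := B.isCoveringMapOn_proj.existsUnique_continuousMap_lifts (A := V)
    ⟨fun z => m z, hm.comp continuous_subtype_val⟩ (a₀ := ⟨p, hpV⟩) he₀
    fun z => visible_subset (D := m ⁻¹' B.sing) z.2
  classical
  refine ⟨fun z => if hz : z ∈ V then F ⟨z, hz⟩ else 0, ?_, fun z hz => ?_⟩
  · rw [continuousOn_iff_continuous_domRestrict]
    refine F.continuous.congr fun z => ?_
    simp
  · simp only [hz, dif_pos]
    exact congrFun hF ⟨z, hz⟩

theorem two_lt_finrank : 2 < Module.finrank ℝ C3 := by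
  simp [Module.finrank_pi_fintype]

/-- A continuous map from `ℂ³` to the quotient lifts to `ℂ³` over the regular part. -/
theorem exists_lift {m : C3 → B.X} (hm : Continuous m)
    (hD : IsClosed (m ⁻¹' B.sing)) (hc : (m ⁻¹' B.sing).Countable) :
    ∃ F : C3 → C3, ContinuousOn F (m ⁻¹' B.sing)ᶜ ∧
      ∀ z ∈ (m ⁻¹' B.sing)ᶜ, B.proj (F z) = m z := by
  obtain ⟨p, hp⟩ : ∃ p, p ∉ m ⁻¹' B.sing := by
    by_contra! hn
    have := hc.to_subtype
    obtain ⟨w, hw⟩ := exists_notMem_planes two_lt_finrank (fun d : m ⁻¹' B.sing => (d : C3))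
      (fun d => d) (fun d => d)
    exact hw ⟨w, hn w⟩ (by simp)
  obtain ⟨q, hq, hu⟩ := exists_visible_union two_lt_finrank hc hp
  obtain ⟨F₁, h₁, e₁⟩ := exists_lift_visible hm hD hp
  obtain ⟨F₂, h₂, e₂⟩ := exists_lift_visible hm hD hq
  have hconn := isPathConnected_visible_inter two_lt_finrank hc hp hq
  -- Connectedness of the overlap makes one γ suffice; replacing `F₁` by its γ-translate lets the
  -- lifts glue.
  obtain ⟨γ, hγ⟩ := exists_deck_eqOn (B := B) hconn.isConnected.isPreconnected
    hconn.nonempty (h₁.mono Set.inter_subset_left) (h₂.mono Set.inter_subset_right)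
    (fun z hz => (e₁ z hz.1).trans (e₂ z hz.2).symm)
    (fun z hz => by rw [e₁ z hz.1]; exact visible_subset (D := m ⁻¹' B.sing) hz.1)
  classical
  let F : C3 → C3 := fun z => if z ∈ visible (m ⁻¹' B.sing) p then γ • F₁ z else F₂ z
  have hF₁ : ∀ z ∈ visible (m ⁻¹' B.sing) p, F z = γ • F₁ z := fun z hz => if_pos hz
  have hF₂ : ∀ z ∈ visible (m ⁻¹' B.sing) q, F z = F₂ z := fun z hz => by
    by_cases hz' : z ∈ visible (m ⁻¹' B.sing) p
    · rw [hF₁ z hz', hγ z ⟨hz', hz⟩]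
    · exact if_neg hz'
  refine ⟨F, ?_, ?_⟩
  · rw [← hu]
    exact ((h₁.const_smul γ).congr hF₁).union_of_isOpen (h₂.congr hF₂) (isOpen_visible hD p)
      (isOpen_visible hD q)
  · rw [← hu]
    rintro z (hz | hz)
    · rw [hF₁ z hz, proj_deck, e₁ z hz]
    · rw [hF₂ z hz, e₂ z hz]

/-- `F` is a lift of `f` over the regular part of the target, equivariant with respect to the
homomorphism `φ` of deck groups. -/
structure IsEquivariantLift (f : A.X ≃ₜ B.X) (F : C3 → C3) (φ : A.deckGroup →* B.deckGroup) :
    Prop where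
  continuousOn : ContinuousOn F {z | f (A.proj z) ∉ B.sing}
  proj_apply : ∀ z, f (A.proj z) ∉ B.sing → B.proj (F z) = f (A.proj z)
  apply_smul : ∀ (γ : A.deckGroup) z, f (A.proj z) ∉ B.sing → F (γ • z) = φ γ • F z

theorem countable_preimage_sing (hB : B.FiniteFixedLocus) (f : A.X ≃ₜ B.X) :
    {z | f (A.proj z) ∈ B.sing}.Countable := by
  have : {z | f (A.proj z) ∈ B.sing} = ⋃ x ∈ f ⁻¹' B.sing, A.proj ⁻¹' {x} := by
    ext z
    simp
  rw [this]
  exact (hB.finite_sing.preimage f.injective.injOn).countable.biUnion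
    fun x _ => A.countable_preimage_proj x

theorem isConnected_compl_countable {S : Set C3} (hS : S.Countable) : IsConnected Sᶜ :=
  hS.isConnected_compl_of_one_lt_rank (by
    rw [← Module.finrank_eq_rank]
    exact_mod_cast lt_trans one_lt_two two_lt_finrank)

/-- For each γ the maps F and F ∘ γ lift the same map, hence differ by some φ(γ). Freeness at a
regular point makes φ multiplicative. -/
theorem exists_isEquivariantLift (hB : B.FiniteFixedLocus) (f : A.X ≃ₜ B.X) :
    ∃ F φ, IsEquivariantLift f F φ := by
  have hcount := countable_preimage_sing hB f
  obtain ⟨F, h1, h2⟩ := exists_lift (B := B) (m := fun z => f (A.proj z))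
    (f.continuous.comp continuous_proj)
    (hB.isClosed_sing.preimage (f.continuous.comp continuous_proj)) hcount
  have hconn := isConnected_compl_countable hcount
  obtain ⟨z₀, hz₀⟩ := hconn.nonempty
  have hinv : ∀ (γ : A.deckGroup) z, f (A.proj z) ∉ B.sing → f (A.proj (γ • z)) ∉ B.sing :=
    fun γ z hz => by rwa [proj_deck]
  have key : ∀ γ : A.deckGroup, ∃ γ' : B.deckGroup, ∀ z, f (A.proj z) ∉ B.sing →
      F (γ • z) = γ' • F z := fun γ =>
    exists_deck_eqOn hconn.isPreconnected ⟨z₀, hz₀⟩ h1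
      (h1.comp (continuous_const_smul γ).continuousOn (hinv γ))
      (fun z hz => by rw [h2 z hz, h2 _ (hinv γ z hz), proj_deck])
      (fun z hz => by rw [h2 z hz]; exact hz)
  choose φ hφ using key
  have hreg : B.proj (F z₀) ∉ B.sing := by rw [h2 z₀ hz₀]; exact hz₀
  refine ⟨F, ⟨⟨φ, ?_⟩, ?_⟩, h1, h2, hφ⟩
  · refine deck_ext hreg ?_
    rw [← hφ 1 z₀ hz₀, one_smul, one_smul]
  · intro γ γ'
    refine deck_ext hreg ?_
    change φ (γ * γ') • F z₀ = (φ γ * φ γ') • F z₀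
    rw [← hφ _ z₀ hz₀, mul_smul, mul_smul, hφ γ _ (hinv γ' z₀ hz₀), hφ γ' z₀ hz₀]

/-- F' ∘ F lifts the identity, so it is a deck transformation γ₀. Removing both countable sets of
bad points makes it unnecessary to know that f matches the singular points. -/
theorem IsEquivariantLift.symm_comp (hA : A.FiniteFixedLocus) (hB : B.FiniteFixedLocus)
    {f : A.X ≃ₜ B.X} {F F' : C3 → C3} {φ : A.deckGroup →* B.deckGroup}
    {φ' : B.deckGroup →* A.deckGroup} (hF : IsEquivariantLift f F φ)
    (hF' : IsEquivariantLift f.symm F' φ') : ∃ γ₀, ∀ γ, φ' (φ γ) = γ₀ * γ * γ₀⁻¹ := by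
  have hc : ({z | f (A.proj z) ∈ B.sing} ∪ A.proj ⁻¹' A.sing).Countable :=
    (countable_preimage_sing hB f).union (countable_preimage_sing hA (Homeomorph.refl A.X))
  have hconn := isConnected_compl_countable hc
  obtain ⟨z₀, hz₀⟩ := hconn.nonempty
  have hz : ∀ z ∈ ({z | f (A.proj z) ∈ B.sing} ∪ A.proj ⁻¹' A.sing)ᶜ,
      f (A.proj z) ∉ B.sing ∧ A.proj z ∉ A.sing := fun z hz => by
    simpa [not_or] using hz
  have hFz : ∀ z ∈ ({z | f (A.proj z) ∈ B.sing} ∪ A.proj ⁻¹' A.sing)ᶜ,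
      f.symm (B.proj (F z)) ∉ A.sing := fun z hz' => by
    rw [hF.proj_apply z (hz z hz').1, f.symm_apply_apply]
    exact (hz z hz').2
  obtain ⟨γ₀, hγ₀⟩ := exists_deck_eqOn (B := A) (F₁ := id) (F₂ := F' ∘ F) hconn.isPreconnected
    hconn.nonempty continuousOn_id
    (hF'.continuousOn.comp (hF.continuousOn.mono fun z hz' => (hz z hz').1) hFz)
    (fun z hz' => by
      rw [Function.comp_apply, hF'.proj_apply _ (hFz z hz'), hF.proj_apply z (hz z hz').1,
        f.symm_apply_apply, id])
    (fun z hz' => (hz z hz').2)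
  refine ⟨γ₀, fun γ => ?_⟩
  have hγz : γ • z₀ ∈ ({z | f (A.proj z) ∈ B.sing} ∪ A.proj ⁻¹' A.sing)ᶜ := by
    have := hz z₀ hz₀
    simp only [Set.mem_compl_iff, Set.mem_union, Set.mem_preimage, Set.mem_ofPred_eq, proj_deck]
    tauto
  have e1 := hγ₀ _ hγz
  have e2 := hγ₀ _ hz₀
  simp only [Function.comp_apply, id] at e1 e2
  rw [hF.apply_smul γ z₀ (hz z₀ hz₀).1, hF'.apply_smul _ _ (hFz z₀ hz₀), e2, ← mul_smul,
    ← mul_smul] at e1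
  rw [eq_mul_inv_iff_mul_eq]
  exact deck_ext (hz z₀ hz₀).2 e1

/-- Both composites with the homomorphism of the inverse map are inner automorphisms. -/
theorem IsEquivariantLift.bijective (hA : A.FiniteFixedLocus) (hB : B.FiniteFixedLocus)
    {f : A.X ≃ₜ B.X} {F : C3 → C3} {φ : A.deckGroup →* B.deckGroup}
    (hF : IsEquivariantLift f F φ) : Function.Bijective φ := by
  obtain ⟨F', φ', hF'⟩ := exists_isEquivariantLift hA f.symm
  obtain ⟨γ₀, h₀⟩ := hF.symm_comp hA hB hF'
  obtain ⟨γ₁, h₁⟩ := hF'.symm_comp hB hA (f := f.symm) (by simpa using hF)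
  constructor
  · intro γ γ' e
    have := h₀ γ
    rw [e, h₀ γ'] at this
    simpa using this.symm
  · intro γ
    refine ⟨φ' (γ₁⁻¹ * γ * γ₁), ?_⟩
    rw [h₁]
    group

end TorusAction

namespace TorusAction

variable {A B : TorusAction Z3sq ρ₁}

/-! ### The real linear map induced by a homeomorphism of quotients -/

theorem span_lattice (A : TorusAction Z3sq ρ₁) : Submodule.span ℝ (A.lattice : Set C3) = ⊤ :=
  A.isLattice.span_top

/-- Translation by a lattice vector, as a deck transformation. -/
noncomputable def transl (l : A.lattice) : A.deckGroup :=
  ⟨affinePerm 1 l, (isLift_one_iff.2 l.2).mem⟩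

theorem transl_smul (l : A.lattice) (z : C3) : transl l • z = z + l := by
  change ρ₁ 1 *ᵥ z + (l : C3) = _
  rw [map_one, Matrix.one_mulVec]

theorem deck_ext_smul {γ γ' : A.deckGroup} (e : ∀ z : C3, γ • z = γ' • z) : γ = γ' :=
  Subtype.ext (Equiv.ext e)

theorem transl_add (l l' : A.lattice) : transl (l + l') = transl l * transl l' :=
  deck_ext_smul fun z => by
    rw [mul_smul, transl_smul, transl_smul, transl_smul, Submodule.coe_add]
    abel

theorem transl_injective : Function.Injective (transl (A := A)) := fun l l' e => by
  have := congrArg (fun γ : A.deckGroup => γ • (0 : C3)) e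
  simpa [transl_smul] using this

theorem exists_eq_transl_of_forall {γ : A.deckGroup} {l : C3} (e : ∀ z : C3, γ • z = z + l) :
    ∃ l', γ = transl l' := by
  obtain ⟨g, b, hb, hγ⟩ := A.deck_smul_eq γ
  have hl : b = l := by
    have h1 := hγ 0
    rw [e] at h1
    simpa using h1.symm
  subst hl
  have hg : g = 1 := ρ₁_injective (by
    rw [map_one]
    refine Matrix.ext_of_mulVec_single fun i => ?_
    have h1 := hγ (Pi.single i 1)
    rw [e] at h1
    rw [Matrix.one_mulVec]
    exact (add_right_cancel h1).symm)
  subst hg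
  exact ⟨⟨b, isLift_one_iff.1 hb⟩, deck_ext_smul fun z => by rw [e, transl_smul]⟩

theorem exists_pow_three_eq_transl (γ : A.deckGroup) : ∃ l, γ ^ 3 = transl l := by
  obtain ⟨g, b, hb, hγ⟩ := A.deck_smul_eq γ
  refine exists_eq_transl_of_forall (l := ρ₁ g *ᵥ (ρ₁ g *ᵥ b + b) + b) fun z => ?_
  have hg : ρ₁ g *ᵥ (ρ₁ g *ᵥ (ρ₁ g *ᵥ z)) = z := by
    rw [← ρ₁_mul_mulVec, ← ρ₁_mul_mulVec, ← pow_two, ← pow_succ, Z3sq_pow_three, map_one,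
      Matrix.one_mulVec]
  rw [pow_succ, pow_two, mul_smul, mul_smul]
  simp only [hγ, Matrix.mulVec_add, hg, add_assoc]

theorem eq_of_eqOn_lattice {L L' : C3 →ₗ[ℝ] C3} (e : ∀ l ∈ A.lattice, L l = L' l) : L = L' :=
  LinearMap.ext_on A.span_lattice e

/-- Commuting with translations by 3Λ forces the linear part to fix Λ, which spans. Cubes are used
because cubes of arbitrary deck transformations are known to be translations. -/
theorem exists_eq_transl_of_commute {γ : A.deckGroup}
    (e : ∀ l : A.lattice, Commute γ (transl l ^ 3)) : ∃ l, γ = transl l := by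
  obtain ⟨g, b, hb, hγ⟩ := A.deck_smul_eq γ
  have h1 : ∀ l ∈ A.lattice, ρ₁ g *ᵥ l = l := fun l hl => by
    have h2 := congrArg (fun γ : A.deckGroup => γ • (0 : C3)) (e ⟨l, hl⟩).eq
    simp only [pow_succ, pow_zero, one_mul, mul_smul, transl_smul, hγ, zero_add,
      Matrix.mulVec_zero, Matrix.mulVec_add] at h2
    have h3 : (3 : ℂ) • (ρ₁ g *ᵥ l) = (3 : ℂ) • l := by
      ext i
      have := congrFun h2 i
      simp only [Pi.add_apply] at this
      simp only [Pi.smul_apply, smul_eq_mul]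
      linear_combination this
    exact smul_right_injective _ three_ne_zero h3
  have h2 : ((ρL g).restrictScalars ℝ).toLinearMap = LinearMap.id :=
    eq_of_eqOn_lattice (A := A) h1
  exact exists_eq_transl_of_forall (l := b) fun z => by
    rw [hγ]
    exact congrArg (· + b) (LinearMap.congr_fun h2 z)

/-- The cube of a translation of B is the image of a cube in the deck group of A, which is a
translation and so commutes with `transl l`. -/
theorem exists_map_transl (φ : A.deckGroup ≃* B.deckGroup) (l : A.lattice) :
    ∃ l', φ (transl l) = transl l' := by
  refine exists_eq_transl_of_commute fun μ => ?_
  obtain ⟨c, hc⟩ := exists_pow_three_eq_transl (φ.symm (transl μ))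
  have : transl μ ^ 3 = φ (transl c) := by rw [← hc, map_pow, φ.apply_symm_apply]
  rw [this]
  change _ * _ = _ * _
  rw [← map_mul, ← map_mul, ← transl_add, ← transl_add, add_comm]

/-- L is the real extension of the isomorphism of lattices given by φ. Conjugation acts on
translations through the linear part, hence L intertwines the linear parts of γ and φ(γ). -/
theorem exists_linearEquiv (φ : A.deckGroup ≃* B.deckGroup) :
    ∃ L : C3 ≃ₗ[ℝ] C3, (∀ l : A.lattice, ∃ l' : B.lattice, φ (transl l) = transl l' ∧ L l = l') ∧
      (∀ v, v ∈ A.lattice ↔ L v ∈ B.lattice) ∧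
      ∀ g, ∃ g', ∀ v, L (ρ₁ g *ᵥ v) = ρ₁ g' *ᵥ L v := by
  choose ℓ hℓ using exists_map_transl φ
  choose ℓ' hℓ' using exists_map_transl φ.symm
  let e : A.lattice ≃+ B.lattice :=
    { toFun := ℓ
      invFun := ℓ'
      left_inv := fun l => transl_injective (by rw [← hℓ', ← hℓ, φ.symm_apply_apply])
      right_inv := fun l => transl_injective (by rw [← hℓ, ← hℓ', φ.apply_symm_apply])
      map_add' := fun l l' => transl_injective (by
        rw [← hℓ, transl_add, map_mul, hℓ, hℓ, ← transl_add]) }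
  let b := Module.Free.chooseBasis ℤ A.lattice
  let b' := b.map e.toIntLinearEquiv
  let L : C3 ≃ₗ[ℝ] C3 :=
    (b.ofZLatticeBasis ℝ A.lattice).equiv (b'.ofZLatticeBasis ℝ B.lattice) (Equiv.refl _)
  have hL : ∀ l : A.lattice, L l = e l := fun l => by
    have : (L.toLinearMap.restrictScalars ℤ).comp A.lattice.subtype =
        B.lattice.subtype.comp e.toIntLinearEquiv.toLinearMap := by
      refine b.ext fun i => ?_
      change L (b i) = (e (b i) : C3)
      have h1 : ((b i : A.lattice) : C3) = b.ofZLatticeBasis ℝ A.lattice i := by simp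
      rw [h1, Module.Basis.equiv_apply]
      simp [b']
    exact LinearMap.congr_fun this l
  refine ⟨L, fun l => ⟨ℓ l, hℓ l, hL l⟩, fun v => ⟨fun hv => ?_, fun hv => ?_⟩, fun g => ?_⟩
  · have := hL ⟨v, hv⟩
    simp only at this
    rw [this]
    exact (e _).2
  · have h1 := hL (e.symm ⟨L v, hv⟩)
    rw [e.apply_symm_apply] at h1
    rw [← L.injective h1]
    exact (e.symm _).2
  · obtain ⟨b₀, hb₀⟩ := A.exists_isLift g
    obtain ⟨g', b₁, hb₁, hγ'⟩ := B.deck_smul_eq (φ ⟨affinePerm g b₀, hb₀.mem⟩)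
    refine ⟨g', fun v => ?_⟩
    have key : L.toLinearMap.comp ((ρL g).restrictScalars ℝ).toLinearMap =
        ((ρL g').restrictScalars ℝ).toLinearMap.comp L.toLinearMap := by
      refine eq_of_eqOn_lattice (A := A) fun l hl => ?_
      change L (ρ₁ g *ᵥ l) = ρ₁ g' *ᵥ L l
      have hcomm : (⟨affinePerm g b₀, hb₀.mem⟩ : A.deckGroup) * transl ⟨l, hl⟩ =
          transl ⟨ρ₁ g *ᵥ l, mulVec_mem_lattice g hl⟩ * ⟨affinePerm g b₀, hb₀.mem⟩ :=
        deck_ext_smul fun z => by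
          rw [mul_smul, mul_smul, transl_smul, transl_smul]
          change ρ₁ g *ᵥ (z + l) + b₀ = ρ₁ g *ᵥ z + b₀ + ρ₁ g *ᵥ l
          rw [Matrix.mulVec_add]
          abel
      have h1 := congrArg (fun γ => φ γ • (0 : C3)) hcomm
      simp only [map_mul, mul_smul, hℓ, transl_smul, hγ', Matrix.mulVec_zero, zero_add] at h1
      have h2 := hL ⟨l, hl⟩
      have h3 := hL ⟨ρ₁ g *ᵥ l, mulVec_mem_lattice g hl⟩
      change _ = (ℓ _ : C3) at h2 h3
      simp only at h2 h3
      rw [h2, h3]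
      rw [add_comm b₁] at h1
      exact (add_right_cancel h1).symm
    exact LinearMap.congr_fun key v

/-- A homeomorphism of quotients induces a real linear isomorphism of `ℂ³` that identifies the
lattices and the groups of matrices. -/
theorem exists_linearEquiv_of_homeomorph (hA : A.FiniteFixedLocus) (hB : B.FiniteFixedLocus)
    (f : A.X ≃ₜ B.X) :
    ∃ (L : C3 ≃ₗ[ℝ] C3) (F : C3 → C3), ContinuousOn F {z | f (A.proj z) ∉ B.sing} ∧
      (∀ z, f (A.proj z) ∉ B.sing → B.proj (F z) = f (A.proj z)) ∧
      (∀ z, f (A.proj z) ∉ B.sing → ∀ l ∈ A.lattice, F (z + l) = F z + L l) ∧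
      (∀ v, v ∈ A.lattice ↔ L v ∈ B.lattice) ∧
      ∀ g, ∃ g', ∀ v, L (ρ₁ g *ᵥ v) = ρ₁ g' *ᵥ L v := by
  obtain ⟨F, φ, hF⟩ := exists_isEquivariantLift hB f
  obtain ⟨L, h1, h2, h3⟩ := exists_linearEquiv (MulEquiv.ofBijective φ (hF.bijective hA hB))
  refine ⟨L, F, hF.continuousOn, hF.proj_apply, fun z hz l hl => ?_, h2, h3⟩
  obtain ⟨l', e1, e2⟩ := h1 ⟨l, hl⟩
  have e3 := hF.apply_smul (transl ⟨l, hl⟩) z hz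
  rw [transl_smul] at e3
  rw [e3, e2, ← transl_smul, ← e1]
  rfl

end TorusAction

namespace TorusAction

variable {A B : TorusAction Z3sq ρ₁}

/-! ### Biholomorphic maps lift to holomorphic maps -/

theorem differentiable_deck_smul (γ : A.deckGroup) : Differentiable ℂ fun z : C3 => γ • z := by
  obtain ⟨g, b, -, e⟩ := A.deck_smul_eq γ
  simp only [e]
  exact (contDiff_affine (n := 1) g b).differentiable one_ne_zero

/-- Near F(z) the projection of B is injective, so the coordinates of ℂ³ descend to holomorphic
functions on an open set of the quotient. Their pullbacks under f are the coordinates of F. -/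
theorem differentiableAt_lift {f : A.X ≃ₜ B.X} (hf : IsBiholomorphism f)
    (hB : B.FiniteFixedLocus) {F : C3 → C3} (hF : ContinuousOn F {z | f (A.proj z) ∉ B.sing})
    (hp : ∀ z, f (A.proj z) ∉ B.sing → B.proj (F z) = f (A.proj z)) {z : C3}
    (hz : f (A.proj z) ∉ B.sing) : DifferentiableAt ℂ F z := by
  have hopen : IsOpen {z | f (A.proj z) ∉ B.sing} :=
    (hB.isClosed_sing.preimage (f.continuous.comp A.continuous_proj)).isOpen_compl
  obtain ⟨U₀, hU₀, hdeck⟩ := B.exists_nhds_deck (F z)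
  set U := interior U₀ with hU
  have hUo : IsOpen U := isOpen_interior
  have hzU : F z ∈ U := mem_interior_iff_mem_nhds.2 hU₀
  have hdeck : ∀ γ : B.deckGroup, ∀ u ∈ U, γ • u ∈ U → γ = 1 := fun γ u hu hγu => by
    have := hdeck γ ⟨_, ⟨u, interior_subset hu, rfl⟩, interior_subset hγu⟩
    exact deck_ext (z := F z) (by rw [hp z hz]; exact hz) (by rw [this, one_smul])
  have hinj : ∀ u ∈ U, ∀ u' ∈ U, B.proj u = B.proj u' → u = u' := fun u hu u' hu' e => by
    obtain ⟨γ, rfl⟩ := proj_eq_iff.1 e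
    have := hdeck γ u' hu' hu
    simp [this]
  have hpre : B.proj ⁻¹' (B.proj '' U) = ⋃ γ : B.deckGroup, (γ • ·) ⁻¹' U := by
    ext y
    simp only [Set.mem_preimage, Set.mem_image, Set.mem_iUnion]
    constructor
    · rintro ⟨u, hu, e⟩
      obtain ⟨γ, rfl⟩ := proj_eq_iff.1 e
      exact ⟨γ, hu⟩
    · rintro ⟨γ, hγ⟩
      exact ⟨_, hγ, proj_deck γ y⟩
  have hUX : IsOpen (B.proj '' U) := by
    rw [← isQuotientMap_proj.isOpen_preimage, hpre]
    exact isOpen_iUnion fun γ => hUo.preimage (continuous_const_smul γ)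
  rw [differentiableAt_pi]
  intro j
  let s : B.X → C3 := fun x => Function.invFunOn B.proj U x
  have hs : ∀ u ∈ U, s (B.proj u) = u := fun u hu =>
    hinj _ (Function.invFunOn_mem ⟨u, hu, rfl⟩) _ hu (Function.invFunOn_eq ⟨u, hu, rfl⟩)
  let φ : B.X → ℂ := fun x => s x j
  have hφ : B.HolomorphicOn φ (B.proj '' U) := by
    rw [HolomorphicOn, hpre]
    intro y hy
    obtain ⟨γ, hγ⟩ := Set.mem_iUnion.1 hy
    have hd : DifferentiableAt ℂ (fun w : C3 => (γ • w) j) y :=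
      differentiableAt_pi.1 (differentiable_deck_smul γ y) j
    refine (hd.congr_of_eventuallyEq ?_).differentiableWithinAt
    filter_upwards [(hUo.preimage (continuous_const_smul γ)).mem_nhds hγ] with w hw
    change s (B.proj w) j = _
    rw [← proj_deck γ w, hs _ hw]
  have h2 := (hf _ hUX φ).1 hφ
  rw [HolomorphicOn] at h2
  have hmem : f (A.proj z) ∈ B.proj '' U := ⟨F z, hzU, hp z hz⟩
  have h3 := h2.differentiableAt (x := z)
    ((hUX.preimage (f.continuous.comp A.continuous_proj)).mem_nhds hmem)
  refine h3.congr_of_eventuallyEq ?_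
  filter_upwards [hopen.mem_nhds hz,
    (hF.continuousAt (hopen.mem_nhds hz)).preimage_mem_nhds (hUo.mem_nhds hzU)] with w hw hwU
  change F w j = s (f (A.proj w)) j
  rw [← hp w hw, hs _ hwU]

theorem exists_forall_norm_le_of_periodic {E : Type*} [NormedAddCommGroup E] {K : ℂ → E}
    (hK : Continuous K) (hp : ∀ w, ∀ l ∈ Eis, K (w + l) = K w) : ∃ C, ∀ w, ‖K w‖ ≤ C := by
  obtain ⟨C, hC⟩ := (isCompact_closedBall (0 : ℂ) 1).exists_bound_of_continuousOn hK.continuousOn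
  refine ⟨C, fun w => ?_⟩
  obtain ⟨l, hl, hw⟩ := exists_Eis_near w
  have := hp (w - l) l hl
  rw [sub_add_cancel] at this
  rw [this]
  exact hC _ (mem_closedBall_zero_iff.2 hw.le)

/-- The derivative is entire and doubly periodic, hence constant by Liouville, so G is affine. -/
theorem eq_smul_of_quasiperiodic {G : ℂ → C3} (hG : Differentiable ℂ G) {L : ℂ →ₗ[ℝ] C3}
    (hp : ∀ w, ∀ l ∈ Eis, G (w + l) = G w + L l) : ∃ c, ∀ w, L w = w • c := by
  have hd : Differentiable ℂ (deriv G) := by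
    have := hG.contDiff (n := 2)
    exact (this.differentiable_deriv_two)
  have hper : ∀ w, ∀ l ∈ Eis, deriv G (w + l) = deriv G w := fun w l hl => by
    rw [← deriv_comp_add_const]
    have : (fun x => G (x + l)) = fun x => G x + L l := funext fun x => hp x l hl
    rw [this, deriv_add_const]
  obtain ⟨C, hC⟩ := exists_forall_norm_le_of_periodic hd.continuous hper
  have hconst : ∀ w, deriv G w = deriv G 0 := fun w =>
    hd.apply_eq_apply_of_bounded (isBounded_iff_forall_norm_le.2 ⟨C, by
      rintro _ ⟨w, rfl⟩
      exact hC w⟩) w 0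
  have haff : ∀ w, G w - w • deriv G 0 = G 0 - (0 : ℂ) • deriv G 0 := fun w => by
    refine is_const_of_deriv_eq_zero (f := fun w => G w - w • deriv G 0)
      (hG.sub (differentiable_id.smul_const _)) (fun x => ?_) w 0
    have h1 : HasDerivAt (fun w => G w - w • deriv G 0) (deriv G x - (1 : ℂ) • deriv G 0) x :=
      (hG x).hasDerivAt.sub ((hasDerivAt_id x).smul_const _)
    rw [h1.deriv, hconst x, one_smul, sub_self]
  have hl : ∀ l ∈ Eis, L l = l • deriv G 0 := fun l hl => by
    have h1 := hp 0 l hl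
    have h2 := haff l
    rw [zero_add] at h1
    rw [h1, zero_smul, sub_zero, sub_eq_iff_eq_add] at h2
    exact add_left_cancel h2
  refine ⟨deriv G 0, fun w => ?_⟩
  obtain ⟨a, b, rfl⟩ := exists_add_mul_ζ w
  have : (a + b * ζ : ℂ) = a • (1 : ℂ) + b • ζ := by simp
  rw [this, map_add, map_smul, map_smul, hl 1 one_mem_Eis, hl ζ ζ_mem_Eis, add_smul, smul_assoc,
    smul_assoc]

/-- The linear map induced by a biholomorphic map is complex linear. -/
theorem exists_linearEquiv_of_biholomorphic (hA : A.FiniteFixedLocus) (hB : B.FiniteFixedLocus)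
    (hcube : eisensteinCube ≤ A.lattice) {f : A.X ≃ₜ B.X} (hf : IsBiholomorphism f) :
    ∃ (L : C3 ≃ₗ[ℝ] C3), (∀ v, v ∈ A.lattice ↔ L v ∈ B.lattice) ∧
      (∀ g, ∃ g', ∀ v, L (ρ₁ g *ᵥ v) = ρ₁ g' *ᵥ L v) ∧
      ∀ (i : Fin 3) (c w : ℂ), L (Pi.single i (c * w)) = c • L (Pi.single i w) := by
  obtain ⟨L, F, h1, h2, h3, h4, h5⟩ := exists_linearEquiv_of_homeomorph hA hB f
  refine ⟨L, h4, h5, fun i => ?_⟩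
  have := (countable_preimage_sing hB f).to_subtype
  -- The complex line through z₀ parallel to the i-th axis misses the countable set where F is not
  -- controlled, so F is entire along it.
  obtain ⟨z₀, hz₀⟩ := exists_notMem_planes two_lt_finrank
    (fun d : {z | f (A.proj z) ∈ B.sing} => (d : C3)) (fun _ => Pi.single i 1)
    (fun _ => Pi.single i Complex.I)
  let s : ℂ →ₗ[ℂ] C3 := LinearMap.single ℂ (fun _ => ℂ) i
  have hline : ∀ w : ℂ, f (A.proj (z₀ + s w)) ∉ B.sing := fun w hw => by
    refine hz₀ ⟨_, hw⟩ ?_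
    have : z₀ - (z₀ + s w) = (-w.re) • (Pi.single i 1 : C3) +
        (-w.im) • (Pi.single i Complex.I : C3) := by
      ext j
      by_cases hj : j = i
      · subst hj
        simp [s]
        linear_combination -(Complex.re_add_im w).symm
      · simp [s, hj]
    simp only at this ⊢
    rw [this]
    exact Submodule.mem_span_pair.2 ⟨_, _, rfl⟩
  have hG : Differentiable ℂ fun w => F (z₀ + s w) := fun w =>
    (differentiableAt_lift hf hB h1 h2 (hline w)).comp w
      ((differentiableAt_const _).add (s.toContinuousLinearMap.differentiableAt))
  obtain ⟨c, hc⟩ := eq_smul_of_quasiperiodic hG (L := L.toLinearMap.comp (s.restrictScalars ℝ))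
    fun w l hl => by
      rw [map_add, ← add_assoc, h3 _ (hline w)]
      · rfl
      · refine hcube (mem_eisensteinCube.2 fun j => ?_)
        by_cases hj : j = i
        · subst hj; simpa [s] using hl
        · simp [s, hj]
  intro d w
  have e1 : L (Pi.single i (d * w)) = (d * w) • c := hc (d * w)
  have e2 : L (Pi.single i w) = w • c := hc w
  rw [e1, e2, mul_smul]

end TorusAction

/-! ### Invariants that distinguish the five lattices -/

theorem exists_χ_ne_one {g : Z3sq} (hg : g ≠ 1) : ∃ j, ∀ i, i ≠ j → χ g i ≠ 1 := by
  have : ∀ g : Z3sq, g ≠ 1 → ∃ j : Fin 3, ∀ i, i ≠ j →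
      ![g.toAdd.1, g.toAdd.2, g.toAdd.1 + g.toAdd.2] i ≠ 0 := by decide
  obtain ⟨j, hj⟩ := this g hg
  exact ⟨j, fun i hi e => hj i hi (χ_eq_one_iff.1 e)⟩

theorem ρ₁_mulVec_single (g : Z3sq) (j : Fin 3) (z : ℂ) :
    ρ₁ g *ᵥ (Pi.single j z : C3) = Pi.single j (χ g j * z) := by
  ext i
  rw [ρ₁_mulVec]
  by_cases hij : i = j
  · subst hij; simp
  · simp [hij]

/-- A real linear automorphism of `ℂ³` normalizing `ρ₁(ℤ₃²)` permutes the coordinate axes. -/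
theorem exists_perm_axes (L : C3 ≃ₗ[ℝ] C3)
    (hL : ∀ g, ∃ g', ∀ v, L (ρ₁ g *ᵥ v) = ρ₁ g' *ᵥ L v) :
    ∃ σ : Equiv.Perm (Fin 3), ∀ j z, L (Pi.single j z) = Pi.single (σ j) (L (Pi.single j z) (σ j)) := by
  have key : ∀ j, ∃ s, ∀ z, L (Pi.single j z) = Pi.single s (L (Pi.single j z) s) := fun j => by
    -- The image of the j-th axis is fixed by the nontrivial g', and nontrivial elements fix vectors
    -- of at most one axis.
    obtain ⟨g', hg'⟩ := hL (axisElt j)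
    have hne : g' ≠ 1 := by
      rintro rfl
      refine axisElt_ne_one j (ρ₁_injective ?_)
      rw [map_one]
      refine Matrix.ext_of_mulVec_single fun i => L.injective ?_
      rw [hg', map_one, Matrix.one_mulVec, Matrix.one_mulVec]
    obtain ⟨s, hs⟩ := exists_χ_ne_one hne
    refine ⟨s, fun z => ?_⟩
    have h1 := hg' (Pi.single j z)
    rw [ρ₁_mulVec_single, (χ_axisElt j j).2 rfl, one_mul] at h1
    ext i
    by_cases hi : i = s
    · subst hi; simp
    · have h2 := congrFun h1 i
      rw [ρ₁_mulVec] at h2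
      have h3 : (χ g' i - 1) * L (Pi.single j z) i = 0 := by linear_combination -h2
      rw [Pi.single_eq_of_ne hi]
      exact (mul_eq_zero.1 h3).resolve_left (sub_ne_zero.2 (hs i hi))
  choose σ hσ using key
  -- L maps an axis onto an axis by dimension, so two axes cannot share their image.
  have hinj : Function.Injective σ := fun j j' e => by
    by_contra hne
    let c : ℂ →ₗ[ℝ] ℂ := (LinearMap.proj (σ j)).comp
      (L.toLinearMap.comp (LinearMap.single ℝ (fun _ : Fin 3 => ℂ) j))
    have hc : ∀ z, c z = L (Pi.single j z) (σ j) := fun z => rfl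
    have hcinj : Function.Injective c := fun z w ezw => by
      rw [hc, hc] at ezw
      have h1 := hσ j z
      rw [ezw, ← hσ j w] at h1
      simpa using L.injective h1
    obtain ⟨z, hz⟩ := (LinearMap.injective_iff_surjective.1 hcinj) (L (Pi.single j' 1) (σ j))
    have h1 := hσ j z
    rw [← hc, hz, e, ← hσ j' 1] at h1
    have h2 := congrFun (L.injective h1) j'
    rw [Pi.single_eq_of_ne (Ne.symm hne)] at h2
    simp at h2
  refine ⟨Equiv.ofBijective σ (Finite.injective_iff_bijective.1 hinj), hσ⟩

/-- `Λ` contains a vector with vanishing `j`-th coordinate whose components are not in `Λ`. -/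
def HasSplitVector (Λ : Submodule ℤ C3) (j : Fin 3) : Prop :=
  ∃ v ∈ Λ, v j = 0 ∧ ∃ i, (Pi.single i (v i) : C3) ∉ Λ

/-- `Λ` is not the direct sum of its intersections with the coordinate axes. -/
def IsNonsplit (Λ : Submodule ℤ C3) : Prop := ∃ v ∈ Λ, ∃ i, (Pi.single i (v i) : C3) ∉ Λ

section

variable {Λ Λ' : Submodule ℤ C3} {L : C3 ≃ₗ[ℝ] C3} {σ : Equiv.Perm (Fin 3)}

theorem map_apply_perm
    (hσ : ∀ j z, L (Pi.single j z) = Pi.single (σ j) (L (Pi.single j z) (σ j))) (v : C3)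
    (j : Fin 3) : L (Pi.single j (v j)) = Pi.single (σ j) (L v (σ j)) := by
  rw [hσ j (v j)]
  congr 1
  conv_rhs => rw [← Finset.univ_sum_single v, map_sum, Finset.sum_apply]
  symm
  apply Finset.sum_eq_single j
  · intro i _ hi
    rw [hσ i (v i), Pi.single_eq_of_ne]
    exact fun e => hi (σ.injective e).symm
  · exact fun hj => absurd (Finset.mem_univ j) hj

theorem HasSplitVector.map (hL : ∀ v, v ∈ Λ ↔ L v ∈ Λ')
    (hσ : ∀ j z, L (Pi.single j z) = Pi.single (σ j) (L (Pi.single j z) (σ j))) {j : Fin 3} :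
    HasSplitVector Λ j ↔ HasSplitVector Λ' (σ j) := by
  constructor
  · rintro ⟨v, hv, hvj, i, hi⟩
    refine ⟨L v, (hL v).1 hv, ?_, σ i, ?_⟩
    · have := map_apply_perm hσ v j
      rw [hvj, Pi.single_zero, map_zero] at this
      simpa using (congrFun this (σ j)).symm
    · rwa [← map_apply_perm hσ, ← hL]
  · rintro ⟨w, hw, hwj, i, hi⟩
    obtain ⟨v, rfl⟩ := L.surjective w
    obtain ⟨i, rfl⟩ := σ.surjective i
    refine ⟨v, (hL v).2 hw, ?_, i, ?_⟩
    · have := map_apply_perm hσ v j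
      rw [hwj, Pi.single_zero, LinearEquiv.map_eq_zero_iff] at this
      simpa using this
    · rwa [hL, map_apply_perm hσ]

theorem IsNonsplit.map (hL : ∀ v, v ∈ Λ ↔ L v ∈ Λ')
    (hσ : ∀ j z, L (Pi.single j z) = Pi.single (σ j) (L (Pi.single j z) (σ j))) :
    IsNonsplit Λ ↔ IsNonsplit Λ' := by
  constructor
  · rintro ⟨v, hv, i, hi⟩
    exact ⟨L v, (hL v).1 hv, σ i, by rwa [← map_apply_perm hσ, ← hL]⟩
  · rintro ⟨w, hw, i, hi⟩
    obtain ⟨v, rfl⟩ := L.surjective w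
    obtain ⟨i, rfl⟩ := σ.surjective i
    exact ⟨v, (hL v).2 hw, i, by rwa [hL, map_apply_perm hσ]⟩

end

/-- The value of `HasSplitVector` on the five lattices. -/
def splitTable : Label → Fin 3 → Bool
  | .Y3, _ => false
  | .Y4, j => j = 2
  | .Y4', j => j = 1
  | .Y5, _ => false
  | .Y6, _ => true

theorem mem_modelLattice {i : Label} {v : C3} :
    v ∈ modelLattice i ↔ ∃ n ∈ code i, ∀ j, v j - n j * t ∈ Eis := by
  rw [modelLattice_eq, mem_codeLattice]

/-- A vector on a coordinate axis is in a model lattice if and only if its coordinate is an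
Eisenstein integer. -/
theorem single_mem_modelLattice {i : Label} {j : Fin 3} {z : ℂ} :
    (Pi.single j z : C3) ∈ modelLattice i ↔ z ∈ Eis := by
  constructor
  · intro hz
    obtain ⟨n, hn, hv⟩ := mem_modelLattice.1 hz
    have h0 : ∀ l, l ≠ j → 3 ∣ n l := fun l hl => by
      have := hv l
      rw [Pi.single_eq_of_ne hl, zero_sub, neg_mem_iff, int_mul_t_mem_Eis] at this
      exact this
    have hj : 3 ∣ n j := by
      obtain ⟨x, y, rfl⟩ := mem_code.1 hn
      have h0 := fun l => h0 l
      have c0 := h0 0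
      have c1 := h0 1
      have c2 := h0 2
      cases i <;> fin_cases j <;> simp at c0 c1 c2 ⊢ <;> omega
    have := add_mem (hv j) (int_mul_t_mem_Eis.2 hj)
    simpa using this
  · intro hz
    rw [modelLattice_eq]
    refine cube_le_codeLattice _ (mem_eisensteinCube.2 fun l => ?_)
    by_cases hl : l = j
    · subst hl; simpa using hz
    · simp [hl]

theorem tvec_mem_modelLattice {i : Label} {n : Fin 3 → ℤ} (hn : n ∈ code i) :
    tvec n ∈ modelLattice i := mem_modelLattice.2 ⟨n, hn, fun j => by simp [tvec_apply]⟩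

theorem hasSplitVector_modelLattice (i : Label) (j : Fin 3) :
    HasSplitVector (modelLattice i) j ↔ splitTable i j = true := by
  have hE : ∀ {n : ℤ}, (n : ℂ) * t ∈ Eis ↔ 3 ∣ n := int_mul_t_mem_Eis
  constructor
  · rintro ⟨v, hv, hvj, l, hl⟩
    rw [single_mem_modelLattice] at hl
    obtain ⟨n, hn, hvn⟩ := mem_modelLattice.1 hv
    have hnj : 3 ∣ n j := by
      have := hvn j
      rwa [hvj, zero_sub, neg_mem_iff, hE] at this
    have hnl : ¬ 3 ∣ n l := fun hd => hl (by simpa using add_mem (hvn l) (hE.2 hd))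
    obtain ⟨x, y, rfl⟩ := mem_code.1 hn
    cases i <;> fin_cases j <;> fin_cases l <;> simp [splitTable] at hnj hnl ⊢ <;> omega
  · intro hs
    have key : ∃ n ∈ code i, n j = 0 ∧ ∃ l, ¬ 3 ∣ n l := by
      simp only [mem_code]
      cases i <;> fin_cases j <;> first | (exfalso; revert hs; decide) | skip
      · exact ⟨_, ⟨1, 0, rfl⟩, rfl, 0, by decide⟩
      · exact ⟨_, ⟨1, 0, rfl⟩, rfl, 0, by decide⟩
      · exact ⟨_, ⟨1, -1, rfl⟩, rfl, 2, by decide⟩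
      · exact ⟨_, ⟨1, 1, rfl⟩, rfl, 2, by decide⟩
      · exact ⟨_, ⟨0, 1, rfl⟩, rfl, 0, by decide⟩
    obtain ⟨n, hn, hnj, l, hl⟩ := key
    refine ⟨tvec n, tvec_mem_modelLattice hn, by simp [tvec_apply, hnj], l, ?_⟩
    rwa [single_mem_modelLattice, tvec_apply, hE]

theorem isNonsplit_modelLattice (i : Label) : IsNonsplit (modelLattice i) ↔ i ≠ .Y3 := by
  constructor
  · rintro ⟨v, hv, l, hl⟩ rfl
    rw [single_mem_modelLattice] at hl
    obtain ⟨n, hn, hvn⟩ := mem_modelLattice.1 hv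
    obtain ⟨x, y, rfl⟩ := mem_code.1 hn
    exact hl (by simpa using hvn l)
  · intro hi
    have key : ∃ n ∈ code i, n 0 = 1 := by
      simp only [mem_code]
      cases i
      · exact absurd rfl hi
      all_goals exact ⟨_, ⟨1, 0, rfl⟩, rfl⟩
    obtain ⟨n, hn, hn0⟩ := key
    refine ⟨tvec n, tvec_mem_modelLattice hn, 0, ?_⟩
    rw [single_mem_modelLattice, tvec_apply, hn0, int_mul_t_mem_Eis]
    decide

/-- The rows of the table have 0, 1, 1, 0 and 3 true entries; `h2` separates Y₃ from Y₅. -/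
theorem eq_or_of_splitTable {i j : Label} {σ : Equiv.Perm (Fin 3)}
    (h1 : ∀ l, splitTable i l = splitTable j (σ l)) (h2 : i = .Y3 ↔ j = .Y3) :
    i = j ∨ (i = .Y4 ∧ j = .Y4') ∨ (i = .Y4' ∧ j = .Y4) := by
  have h1 : ∀ l, splitTable i l = splitTable j (σ l) := h1
  revert σ
  cases i <;> cases j <;> simp at h2 ⊢ <;> decide

/-! ### Comparing the models -/

section Models

variable {A B : TorusAction Z3sq ρ₁} {i j : Label}

/-- Homeomorphic model quotients are equal, or they are `Y₄` and `Y₄'`. -/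
theorem eq_or_of_homeomorph (hi : IsModel i A) (hj : IsModel j B) (hA : A.FiniteFixedLocus)
    (hB : B.FiniteFixedLocus) (f : A.X ≃ₜ B.X) :
    i = j ∨ (i = .Y4 ∧ j = .Y4') ∨ (i = .Y4' ∧ j = .Y4) := by
  obtain ⟨L, -, -, -, -, hΛ, hρ⟩ := TorusAction.exists_linearEquiv_of_homeomorph hA hB f
  rw [hi.1, hj.1] at hΛ
  obtain ⟨σ, hσ⟩ := exists_perm_axes L hρ
  refine eq_or_of_splitTable (σ := σ) (fun l => ?_) ?_
  · have := HasSplitVector.map hΛ hσ (j := l)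
    rw [hasSplitVector_modelLattice, hasSplitVector_modelLattice] at this
    exact Bool.eq_iff_iff.2 this
  · have := IsNonsplit.map hΛ hσ
    rw [isNonsplit_modelLattice, isNonsplit_modelLattice] at this
    exact not_iff_not.1 this

/-- By complex linearity the eigenvalues of k, namely ζ, ζ, ζ², are permuted by σ into those of some
g'. The relation χ₃ = χ₁χ₂ forces ζ² to stay in third place, as otherwise ζ = ζ·ζ² = 1. -/
theorem eq_of_biholomorphic (hi : IsModel i A) (hj : IsModel j B) (hA : A.FiniteFixedLocus)
    (hB : B.FiniteFixedLocus) (hbi : TorusAction.Biholomorphic A B) : i = j := by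
  obtain ⟨f, hf⟩ := hbi
  obtain ⟨L, hΛ, hρ, hlin⟩ := TorusAction.exists_linearEquiv_of_biholomorphic hA hB
    (by rw [hi.1, modelLattice_eq]; exact cube_le_codeLattice _) hf
  rw [hi.1, hj.1] at hΛ
  obtain ⟨σ, hσ⟩ := exists_perm_axes L hρ
  have htab : ∀ l, splitTable i l = splitTable j (σ l) := fun l => by
    have := HasSplitVector.map hΛ hσ (j := l)
    rw [hasSplitVector_modelLattice, hasSplitVector_modelLattice] at this
    exact Bool.eq_iff_iff.2 this
  obtain ⟨g', hg'⟩ := hρ k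
  have hχ : ∀ l, χ g' (σ l) = χ k l := fun l => by
    have h1 := hg' (Pi.single l 1)
    rw [ρ₁_mulVec_single, hlin] at h1
    have h2 := congrFun h1 (σ l)
    rw [ρ₁_mulVec, Pi.smul_apply, smul_eq_mul] at h2
    have h3 : L (Pi.single l 1) (σ l) ≠ 0 := fun h0 => by
      have h4 := hσ l 1
      rw [h0, Pi.single_zero, LinearEquiv.map_eq_zero_iff] at h4
      simpa using congrFun h4 l
    exact (mul_right_cancel₀ h3 h2).symm
  have hσ2 : σ 2 = 2 := by
    have hprod : χ g' 2 = χ g' 0 * χ g' 1 := ζ_pow_val_add _ _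
    have hk : χ k 0 = ζ ∧ χ k 1 = ζ ∧ χ k 2 = ζ ^ 2 := ⟨pow_one ζ, pow_one ζ, rfl⟩
    have hcases : ∀ s : Equiv.Perm (Fin 3), s 2 = 2 ∨
        (s 2 = 0 ∧ ((s 0 = 1 ∧ s 1 = 2) ∨ (s 0 = 2 ∧ s 1 = 1))) ∨
        (s 2 = 1 ∧ ((s 0 = 0 ∧ s 1 = 2) ∨ (s 0 = 2 ∧ s 1 = 0))) := by decide
    have h0 := hχ 0
    have h1 := hχ 1
    have h2 := hχ 2
    rw [hk.1] at h0
    rw [hk.2.1] at h1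
    rw [hk.2.2] at h2
    rcases hcases σ with e | ⟨e2, ⟨e0, e1⟩ | ⟨e0, e1⟩⟩ | ⟨e2, ⟨e0, e1⟩ | ⟨e0, e1⟩⟩
    · exact e
    all_goals
      rw [e0] at h0
      rw [e1] at h1
      rw [e2] at h2
      rw [h0, h1, h2] at hprod
      exact absurd (by linear_combination hprod + ζ_pow_three) ζ_ne_one
  rcases eq_or_of_homeomorph hi hj hA hB f with e | ⟨rfl, rfl⟩ | ⟨rfl, rfl⟩
  · exact e
  · have := htab 2
    rw [hσ2] at this
    simp [splitTable] at this
  · have := htab 2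
    rw [hσ2] at this
    simp [splitTable] at this

end Models

/-! ### Fourier series of smooth functions that are periodic with respect to a lattice -/

section Fourier

set_option linter.unusedSectionVars false

open MeasureTheory UnitAddTorus

/-- The Haar probability measure of `(ℝ / ℤ)^ι`. -/
noncomputable def torusHaar (ι : Type*) [Fintype ι] : Measure (UnitAddTorus ι) :=
  Measure.pi fun _ => AddCircle.haarAddCircle

instance (ι : Type*) [Fintype ι] : IsProbabilityMeasure (torusHaar ι) :=
  inferInstanceAs (IsProbabilityMeasure (Measure.pi fun _ => AddCircle.haarAddCircle))

instance (ι : Type*) [Fintype ι] : (torusHaar ι).IsAddHaarMeasure :=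
  inferInstanceAs (Measure.IsAddHaarMeasure (Measure.pi fun _ => AddCircle.haarAddCircle))

theorem mFourierCoeff_eq {ι : Type*} [Fintype ι] (f : UnitAddTorus ι → ℂ) (n : ι → ℤ) :
    mFourierCoeff f n = ∫ s, mFourier (-n) s * f s ∂torusHaar ι := rfl

variable {E : Type*} [NormedAddCommGroup E] [NormedSpace ℝ E] [FiniteDimensional ℝ E]
  {Λ : Submodule ℤ E} [DiscreteTopology Λ] [IsZLattice ℝ Λ] {ι : Type*} [Fintype ι]
  (b : Module.Basis ι ℤ Λ)

/-- `g` is invariant under translations by `Λ`. -/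
def IsPeriodic {F : Type*} (Λ : Submodule ℤ E) (g : E → F) : Prop := ∀ l ∈ Λ, ∀ z, g (z + l) = g z

/-- The real coordinates with respect to a basis of the lattice. -/
noncomputable def latticeCoord : E ≃L[ℝ] (ι → ℝ) := (b.ofZLatticeBasis ℝ Λ).equivFunL

/-- The projection of the vector space to the torus, in the coordinates of a lattice basis. -/
noncomputable def toUnitTorus (z : E) : UnitAddTorus ι := fun i => (latticeCoord b z i : UnitAddCircle)

/-- The section of `toUnitTorus` with values in the half open unit cube. -/
noncomputable def ofUnitTorus (s : UnitAddTorus ι) : E :=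
  (latticeCoord b).symm fun i => (AddCircle.equivIco 1 0 (s i) : ℝ)

theorem toUnitTorus_ofUnitTorus (s : UnitAddTorus ι) : toUnitTorus b (ofUnitTorus b s) = s := by
  ext i
  simp only [toUnitTorus, ofUnitTorus, ContinuousLinearEquiv.apply_symm_apply]
  exact (AddCircle.equivIco 1 0).symm_apply_apply (s i)

theorem toUnitTorus_add (z w : E) : toUnitTorus b (z + w) = toUnitTorus b z + toUnitTorus b w := by
  ext i
  simp [toUnitTorus]

theorem mem_of_toUnitTorus_eq {z w : E} (e : toUnitTorus b z = toUnitTorus b w) : z - w ∈ Λ := by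
  rw [← b.ofZLatticeBasis_span ℝ Λ, Module.Basis.mem_span_iff_repr_mem]
  intro i
  have h1 := congrFun e i
  simp only [toUnitTorus] at h1
  rw [eq_comm, QuotientAddGroup.eq] at h1
  obtain ⟨n, hn⟩ := AddSubgroup.mem_zmultiples_iff.1 h1
  refine ⟨n, ?_⟩
  simp [latticeCoord] at hn ⊢
  linarith

theorem isOpenQuotientMap_toUnitTorus : IsOpenQuotientMap (toUnitTorus b) :=
  (IsOpenQuotientMap.piMap fun _ : ι => QuotientAddGroup.isOpenQuotientMap_mk).comp
    (latticeCoord b).toHomeomorph.isOpenQuotientMap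

variable {b}

theorem IsPeriodic.apply_ofUnitTorus {F : Type*} {g : E → F} (hg : IsPeriodic Λ g) (z : E) :
    g (ofUnitTorus b (toUnitTorus b z)) = g z := by
  have h1 : ofUnitTorus b (toUnitTorus b z) - z ∈ Λ :=
    mem_of_toUnitTorus_eq b (toUnitTorus_ofUnitTorus b _)
  simpa using hg _ h1 z

theorem IsPeriodic.continuous_comp {F : Type*} [TopologicalSpace F] {g : E → F}
    (hg : IsPeriodic Λ g) (hc : Continuous g) : Continuous (g ∘ ofUnitTorus b) := by
  rw [(isOpenQuotientMap_toUnitTorus b).isQuotientMap.continuous_iff]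
  convert hc using 1
  ext z
  exact hg.apply_ofUnitTorus z

theorem IsPeriodic.fderiv {F : Type*} [NormedAddCommGroup F] [NormedSpace ℝ F] {g : E → F}
    (hg : IsPeriodic Λ g) : IsPeriodic Λ (fderiv ℝ g) := fun l hl z => by
  rw [← fderiv_comp_add_right]
  congr 1
  ext w
  exact hg l hl w

theorem IsPeriodic.fderiv_apply {F : Type*} [NormedAddCommGroup F] [NormedSpace ℝ F] {g : E → F}
    (hg : IsPeriodic Λ g) (v : E) : IsPeriodic Λ (fun z => _root_.fderiv ℝ g z v) := fun l hl z =>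
  congrArg (· v) (hg.fderiv l hl z)

theorem IsPeriodic.mul {f g : E → ℂ} (hf : IsPeriodic Λ f) (hg : IsPeriodic Λ g) :
    IsPeriodic Λ (fun z => f z * g z) := fun l hl z => congrArg₂ (· * ·) (hf l hl z) (hg l hl z)

theorem IsPeriodic.exists_bound {F : Type*} [NormedAddCommGroup F] {g : E → F}
    (hg : IsPeriodic Λ g) (hc : Continuous g) : ∃ C, 0 ≤ C ∧ ∀ z, ‖g z‖ ≤ C := by
  let b := (Module.Free.chooseBasis ℤ Λ)
  let G : C(UnitAddTorus _, F) := ⟨g ∘ ofUnitTorus b, hg.continuous_comp hc⟩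
  refine ⟨‖G‖, norm_nonneg _, fun z => ?_⟩
  rw [← hg.apply_ofUnitTorus (b := b) z]
  exact G.norm_coe_le_norm _

variable (b)

/-- The mean value of a periodic function. -/
noncomputable def torusMean (g : E → ℂ) : ℂ := ∫ s, g (ofUnitTorus b s) ∂torusHaar ι

variable {b}

theorem IsPeriodic.integrable {g : E → ℂ} (hg : IsPeriodic Λ g) (hc : Continuous g) :
    Integrable (fun s => g (ofUnitTorus b s)) (torusHaar ι) :=
  (hg.continuous_comp hc).integrable_of_hasCompactSupport (HasCompactSupport.of_compactSpace _)

theorem torusMean_const (c : ℂ) : torusMean b (fun _ => c) = c := by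
  simp [torusMean]

theorem torusMean_add {f g : E → ℂ} (hf : IsPeriodic Λ f) (hf' : Continuous f)
    (hg : IsPeriodic Λ g) (hg' : Continuous g) :
    torusMean b (fun z => f z + g z) = torusMean b f + torusMean b g :=
  integral_add (hf.integrable hf') (hg.integrable hg')

theorem torusMean_const_mul (c : ℂ) (f : E → ℂ) :
    torusMean b (fun z => c * f z) = c * torusMean b f := integral_const_mul _ _

theorem torusMean_translate {g : E → ℂ} (hg : IsPeriodic Λ g) (v : E) :
    torusMean b (fun z => g (z + v)) = torusMean b g := by
  have h1 : ∀ s, g (ofUnitTorus b s + v) = g (ofUnitTorus b (s + toUnitTorus b v)) := fun s => by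
    rw [← hg.apply_ofUnitTorus (b := b), toUnitTorus_add, toUnitTorus_ofUnitTorus]
  simp only [torusMean, h1]
  exact integral_add_right_eq_self (fun s => g (ofUnitTorus b s)) (toUnitTorus b v)

theorem norm_torusMean_le {g : E → ℂ} {C : ℝ} (hC : ∀ z, ‖g z‖ ≤ C) : ‖torusMean b g‖ ≤ C := by
  simpa [torusMean] using norm_integral_le_of_norm_le_const (μ := torusHaar ι)
    (Filter.Eventually.of_forall fun s => hC (ofUnitTorus b s))

/-- A derivative of a periodic function has mean value zero. -/
theorem torusMean_fderiv {g : E → ℂ} (hg : IsPeriodic Λ g) (hg1 : ContDiff ℝ 1 g) (v : E) :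
    torusMean b (fun z => fderiv ℝ g z v) = 0 := by
  have hdp := hg.fderiv_apply v
  have hdc : Continuous (fun z => fderiv ℝ g z v) :=
    (hg1.continuous_fderiv one_ne_zero).clm_apply continuous_const
  obtain ⟨C, -, hC⟩ := hdp.exists_bound hdc
  have htp : ∀ x : ℝ, IsPeriodic Λ (fun z => g (z + x • v)) := fun x l hl z => by
    simpa only [add_right_comm] using hg l hl (z + x • v)
  have htc : ∀ x : ℝ, Continuous (fun z => g (z + x • v)) := fun x =>
    hg1.continuous.comp (by fun_prop)
  -- Differentiate under the integral the mean of g(z + xv), which does not depend on x.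
  have key := (hasDerivAt_integral_of_dominated_loc_of_deriv_le (μ := torusHaar ι) (x₀ := (0 : ℝ))
    (F := fun x s => g (ofUnitTorus b s + x • v))
    (F' := fun x s => fderiv ℝ g (ofUnitTorus b s + x • v) v) (bound := fun _ => C)
    Filter.univ_mem
    (Filter.Eventually.of_forall fun x => ((htp x).integrable (htc x)).aestronglyMeasurable)
    ((htp 0).integrable (htc 0))
    (by simpa using (hdp.integrable hdc).aestronglyMeasurable)
    (Filter.Eventually.of_forall fun s x _ => hC _) (integrable_const C)
    (Filter.Eventually.of_forall fun s x _ => by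
      have h1 : HasDerivAt (fun x : ℝ => ofUnitTorus b s + x • v) v x := by
        simpa using ((hasDerivAt_id x).smul_const v).const_add (ofUnitTorus b s)
      exact ((hg1.differentiable one_ne_zero _).hasFDerivAt).comp_hasDerivAt x h1)).2
  have h2 : (fun x : ℝ => ∫ s, g (ofUnitTorus b s + x • v) ∂torusHaar ι) =
      fun _ => torusMean b g := by
    ext x
    exact torusMean_translate hg (x • v)
  rw [h2] at key
  simpa [torusMean] using key.unique (hasDerivAt_const _ _)

variable (b)

/-- The linear form with coefficients `n` in the coordinates of the lattice basis. -/
noncomputable def freq (n : ι → ℤ) : E →L[ℝ] ℝ :=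
  ∑ i, (n i : ℝ) • (ContinuousLinearMap.proj i).comp (latticeCoord b).toContinuousLinearMap

/-- The character `z ↦ exp(2πi⟨n, z⟩)`. -/
noncomputable def torusChar (n : ι → ℤ) (z : E) : ℂ :=
  Complex.exp (2 * Real.pi * Complex.I * freq b n z)

variable {b}

theorem freq_apply (n : ι → ℤ) (z : E) : freq b n z = ∑ i, n i * latticeCoord b z i := by
  simp [freq]

theorem freq_neg (n : ι → ℤ) (z : E) : freq b (-n) z = -freq b n z := by
  simp [freq_apply]

theorem freq_basis (n : ι → ℤ) (i : ι) : freq b n (b i : E) = n i := by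
  classical
  rw [freq_apply, ← b.ofZLatticeBasis_apply ℝ Λ]
  simp [latticeCoord, Finsupp.single_apply]

theorem torusChar_eq_mFourier (n : ι → ℤ) (z : E) :
    torusChar b n z = mFourier n (toUnitTorus b z) := by
  simp only [torusChar, mFourier, toUnitTorus, ContinuousMap.coe_mk, fourier_coe_apply, freq_apply]
  rw [← Complex.exp_sum]
  congr 1
  push_cast
  rw [Finset.mul_sum]
  exact Finset.sum_congr rfl fun i _ => by ring

theorem norm_torusChar (n : ι → ℤ) (z : E) : ‖torusChar b n z‖ = 1 := by
  rw [torusChar, Complex.norm_exp]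
  simp

theorem torusChar_zero (z : E) : torusChar b 0 z = 1 := by
  simp [torusChar, freq_apply]

theorem toUnitTorus_mem {l : E} (hl : l ∈ Λ) : toUnitTorus b l = 0 := by
  ext i
  have : latticeCoord b l i = (b.repr ⟨l, hl⟩ i : ℝ) :=
    b.ofZLatticeBasis_repr_apply ℝ Λ ⟨l, hl⟩ i
  simp only [toUnitTorus, this, Pi.zero_apply]
  exact (AddCircle.coe_eq_zero_iff _).2 ⟨b.repr ⟨l, hl⟩ i, by simp⟩

theorem isPeriodic_torusChar (n : ι → ℤ) : IsPeriodic Λ (torusChar b n) := fun l hl z => by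
  rw [torusChar_eq_mFourier, torusChar_eq_mFourier, toUnitTorus_add, toUnitTorus_mem hl, add_zero]

theorem contDiff_torusChar (n : ι → ℤ) {m : WithTop ℕ∞} : ContDiff ℝ m (torusChar b n) := by
  unfold torusChar
  exact (contDiff_const.mul (Complex.ofRealCLM.contDiff.comp (freq b n).contDiff)).cexp

theorem hasFDerivAt_torusChar (n : ι → ℤ) (z : E) :
    HasFDerivAt (torusChar b n) (torusChar b n z •
      ((2 * Real.pi * Complex.I : ℂ) • Complex.ofRealCLM.comp (freq b n))) z := by
  unfold torusChar
  exact ((Complex.ofRealCLM.hasFDerivAt.comp z (freq b n).hasFDerivAt).const_mul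
    (2 * Real.pi * Complex.I : ℂ)).cexp

theorem fderiv_torusChar (n : ι → ℤ) (z v : E) :
    fderiv ℝ (torusChar b n) z v = 2 * Real.pi * Complex.I * freq b n v * torusChar b n z := by
  rw [(hasFDerivAt_torusChar n z).fderiv]
  simp
  ring

variable (b)

/-- The Fourier coefficients of a periodic function. -/
noncomputable def torusCoeff (g : E → ℂ) (n : ι → ℤ) : ℂ :=
  torusMean b fun z => torusChar b (-n) z * g z

variable {b}

theorem torusCoeff_eq (g : E → ℂ) (n : ι → ℤ) :
    torusCoeff b g n = mFourierCoeff (g ∘ ofUnitTorus b) n := by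
  simp only [torusCoeff, torusMean, mFourierCoeff_eq, torusChar_eq_mFourier,
    toUnitTorus_ofUnitTorus, Function.comp]

theorem torusCoeff_zero (g : E → ℂ) : torusCoeff b g 0 = torusMean b g := by
  simp [torusCoeff, torusChar_zero]

theorem torusCoeff_add {f g : E → ℂ} (hf : IsPeriodic Λ f) (hf' : Continuous f)
    (hg : IsPeriodic Λ g) (hg' : Continuous g) (n : ι → ℤ) :
    torusCoeff b (fun z => f z + g z) n = torusCoeff b f n + torusCoeff b g n := by
  have hχ := (contDiff_torusChar (b := b) (-n) (m := 0)).continuous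
  simp only [torusCoeff, mul_add]
  exact torusMean_add ((isPeriodic_torusChar _).mul hf) (hχ.mul hf')
    ((isPeriodic_torusChar _).mul hg) (hχ.mul hg')

theorem torusCoeff_const_mul (c : ℂ) (f : E → ℂ) (n : ι → ℤ) :
    torusCoeff b (fun z => c * f z) n = c * torusCoeff b f n := by
  simp only [torusCoeff, mul_left_comm _ c, torusMean_const_mul]

theorem norm_torusCoeff_le {g : E → ℂ} {C : ℝ} (hC : ∀ z, ‖g z‖ ≤ C) (n : ι → ℤ) :
    ‖torusCoeff b g n‖ ≤ C :=
  norm_torusMean_le fun z => by rw [norm_mul, norm_torusChar, one_mul]; exact hC z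

/-- Integration by parts: the derivative of the product of g with a character has mean zero. -/
theorem torusCoeff_fderiv {g : E → ℂ} (hg : IsPeriodic Λ g) (hg1 : ContDiff ℝ 1 g) (v : E)
    (n : ι → ℤ) : torusCoeff b (fun z => fderiv ℝ g z v) n =
      2 * Real.pi * Complex.I * freq b n v * torusCoeff b g n := by
  have hdp := hg.fderiv_apply v
  have hdc : Continuous (fun z => fderiv ℝ g z v) :=
    (hg1.continuous_fderiv one_ne_zero).clm_apply continuous_const
  have hp := (isPeriodic_torusChar (b := b) (-n)).mul hg
  have hχ := (contDiff_torusChar (b := b) (-n) (m := 1))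
  have h1 := torusMean_fderiv (b := b) hp (hχ.mul hg1) v
  have h2 : ∀ z, fderiv ℝ (fun z => torusChar b (-n) z * g z) z v =
      torusChar b (-n) z * fderiv ℝ g z v +
        -(2 * Real.pi * Complex.I * freq b n v) * (torusChar b (-n) z * g z) := fun z => by
    rw [fderiv_fun_mul (hχ.differentiable one_ne_zero z) (hg1.differentiable one_ne_zero z)]
    simp only [add_apply, smul_apply, smul_eq_mul, fderiv_torusChar, freq_neg]
    push_cast
    ring
  simp only [h2] at h1
  have h3 := torusMean_add (b := b) ((isPeriodic_torusChar (b := b) (-n)).mul hdp)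
    (hχ.continuous.mul hdc)
    (g := fun z => -(2 * Real.pi * Complex.I * freq b n v) * (torusChar b (-n) z * g z))
    (fun l hl z => congrArg (-(2 * Real.pi * Complex.I * freq b n v) * ·) (hp l hl z))
    (continuous_const.mul (hχ.continuous.mul hg1.continuous))
  rw [torusMean_const_mul, h1] at h3
  simp only [torusCoeff]
  linear_combination -h3

end Fourier

/-! ### Rapidly decaying coefficients and smooth Fourier series -/

section FourierSeries

set_option linter.unusedSectionVars false

variable {E : Type*} [NormedAddCommGroup E] [NormedSpace ℝ E] [FiniteDimensional ℝ E]
  {Λ : Submodule ℤ E} [DiscreteTopology Λ] [IsZLattice ℝ Λ] {ι : Type*} [Fintype ι]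
  {b : Module.Basis ι ℤ Λ}

/-- A family of complex numbers indexed by `ℤ^ι` that decays faster than any polynomial. -/
def RapidDecay (a : (ι → ℤ) → ℂ) : Prop := ∀ N : ℕ, ∃ C, ∀ n, ‖n‖ ^ N * ‖a n‖ ≤ C

theorem RapidDecay.mono {a a' : (ι → ℤ) → ℂ} (ha : RapidDecay a) {K : ℝ} (hK : 0 ≤ K)
    (h : ∀ n, ‖a' n‖ ≤ K * ‖n‖ * ‖a n‖) : RapidDecay a' := fun N => by
  obtain ⟨C, hC⟩ := ha (N + 1)
  refine ⟨K * C, fun n => ?_⟩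
  calc ‖n‖ ^ N * ‖a' n‖ ≤ ‖n‖ ^ N * (K * ‖n‖ * ‖a n‖) := by gcongr; exact h n
    _ = K * (‖n‖ ^ (N + 1) * ‖a n‖) := by ring
    _ ≤ K * C := by gcongr; exact hC n

theorem norm_pow_le_one_add_sum (n : ι → ℤ) (N : ℕ) : ‖n‖ ^ N ≤ 1 + ∑ i, ‖n i‖ ^ N := by
  rcases isEmpty_or_nonempty ι with hι | hι
  · have : n = 0 := Subsingleton.elim _ _
    subst this
    rw [norm_zero]
    simpa using pow_le_one₀ (n := N) (le_refl (0 : ℝ)) zero_le_one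
  · obtain ⟨i, hi⟩ := Finite.exists_max fun i => ‖n i‖
    calc ‖n‖ ^ N ≤ ‖n i‖ ^ N := by
          gcongr
          exact (pi_norm_le_iff_of_nonneg (norm_nonneg _)).2 hi
      _ ≤ ∑ i, ‖n i‖ ^ N :=
          Finset.single_le_sum (f := fun i => ‖n i‖ ^ N) (fun j _ => by positivity) (Finset.mem_univ i)
      _ ≤ _ := by linarith

/-- Differentiating along the i-th basis vector multiplies the n-th coefficient by 2πi n_i, and
every iterated derivative is bounded. -/
theorem rapidDecay_torusCoeff {g : E → ℂ} (hg : IsPeriodic Λ g) (hs : ContDiff ℝ ∞ g) :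
    RapidDecay (torusCoeff b g) := by
  have key : ∀ (N : ℕ) (i : ι) (g : E → ℂ), IsPeriodic Λ g → ContDiff ℝ ∞ g →
      ∃ C, ∀ n, ‖n i‖ ^ N * ‖torusCoeff b g n‖ ≤ C := by
    intro N i
    induction N with
    | zero =>
      intro g hg hs
      obtain ⟨C, -, hC⟩ := hg.exists_bound hs.continuous
      exact ⟨C, fun n => by simpa using norm_torusCoeff_le hC n⟩
    | succ N ih =>
      intro g hg hs
      obtain ⟨C, hC⟩ := ih (fun z => fderiv ℝ g z (b i)) (hg.fderiv_apply _)
        ((hs.fderiv_right (m := ∞) (by simp)).clm_apply contDiff_const)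
      refine ⟨C, fun n => le_trans ?_ (hC n)⟩
      rw [torusCoeff_fderiv hg (hs.of_le (by exact_mod_cast le_top)), freq_basis, norm_mul,
        pow_succ, mul_assoc]
      gcongr
      simp only [norm_mul, Complex.norm_I, Complex.norm_real, Real.norm_of_nonneg Real.pi_pos.le,
        RCLike.norm_ofNat, mul_one, Int.norm_cast_real]
      nlinarith [Real.pi_gt_three, norm_nonneg (n i)]
  intro N
  choose C hC using fun i => key N i g hg hs
  obtain ⟨C0, -, hC0⟩ := hg.exists_bound hs.continuous
  refine ⟨C0 + ∑ i, C i, fun n => ?_⟩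
  calc ‖n‖ ^ N * ‖torusCoeff b g n‖ ≤ (1 + ∑ i, ‖n i‖ ^ N) * ‖torusCoeff b g n‖ := by
        gcongr; exact norm_pow_le_one_add_sum n N
    _ = ‖torusCoeff b g n‖ + ∑ i, ‖n i‖ ^ N * ‖torusCoeff b g n‖ := by
        rw [add_mul, one_mul, Finset.sum_mul]
    _ ≤ _ := add_le_add (norm_torusCoeff_le hC0 n) (Finset.sum_le_sum fun i _ => hC i n)

theorem summable_norm_inv_pow (b : Module.Basis ι ℤ Λ) : ∃ N : ℕ, Summable fun n : ι → ℤ => (‖n‖ ^ N)⁻¹ := by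
  let N := Module.finrank ℤ Λ + 1
  have h1 := ZLattice.summable_norm_pow_inv (L := Λ) N (Nat.lt_succ_self _)
  refine ⟨N, ?_⟩
  let K : ℝ := ∑ i, ‖b i‖
  have h2 : ∀ n : ι → ℤ, ‖b.equivFun.symm n‖ ≤ K * ‖n‖ := fun n => by
    rw [Module.Basis.equivFun_symm_apply, Finset.sum_mul]
    refine (norm_sum_le _ _).trans (Finset.sum_le_sum fun i _ => ?_)
    have : ‖n i • b i‖ = ‖n i‖ * ‖b i‖ := by
      change ‖((n i • b i : Λ) : E)‖ = _ * ‖(b i : E)‖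
      rw [Submodule.coe_smul, ← Int.cast_smul_eq_zsmul ℝ, norm_smul, Int.norm_cast_real]
    rw [this, mul_comm]
    gcongr
    exact norm_le_pi_norm n i
  have h3 := (b.equivFun.symm.toEquiv.summable_iff.2 h1).mul_left (K ^ N)
  refine Summable.of_nonneg_of_le (fun n => by positivity) (fun n => ?_) h3
  by_cases hn : n = 0
  · subst hn
    simp [N]
  · have hx : 0 < ‖b.equivFun.symm n‖ := norm_pos_iff.2 fun h0 =>
      hn (b.equivFun.symm.map_eq_zero_iff.1 h0)
    have hn' : 0 < ‖n‖ := norm_pos_iff.2 hn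
    simp only [Function.comp, LinearEquiv.coe_toEquiv]
    rw [inv_pow, ← div_eq_mul_inv, le_div_iff₀ (by positivity), mul_comm, ← div_eq_mul_inv,
      div_le_iff₀ (by positivity), ← mul_pow]
    gcongr
    exact h2 n

theorem RapidDecay.summable (b : Module.Basis ι ℤ Λ) {a : (ι → ℤ) → ℂ} (ha : RapidDecay a) :
    Summable fun n => ‖a n‖ := by
  obtain ⟨N, hN⟩ := summable_norm_inv_pow b
  obtain ⟨C, hC⟩ := ha N
  refine Summable.of_norm_bounded_eventually (hN.mul_left C) ?_
  filter_upwards [(Set.finite_singleton (0 : ι → ℤ)).compl_mem_cofinite] with n hn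
  have hn' : 0 < ‖n‖ := norm_pos_iff.2 hn
  rw [norm_norm, ← div_eq_mul_inv, le_div_iff₀ (by positivity), mul_comm]
  exact hC n

variable (b) in
/-- The Fourier series with coefficients `a`. -/
noncomputable def torusSeries (a : (ι → ℤ) → ℂ) (z : E) : ℂ := ∑' n, a n * torusChar b n z

theorem summable_torusSeries {a : (ι → ℤ) → ℂ} (ha : RapidDecay a) (z : E) :
    Summable fun n => a n * torusChar b n z :=
  Summable.of_norm (by simpa [norm_torusChar] using ha.summable b)

theorem isPeriodic_torusSeries (a : (ι → ℤ) → ℂ) : IsPeriodic Λ (torusSeries b a) := fun l hl z =>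
  tsum_congr fun n => by rw [isPeriodic_torusChar n l hl z]

variable (b) in
theorem exists_norm_freq_le : ∃ K, 0 ≤ K ∧ ∀ n, ‖freq b n‖ ≤ K * ‖n‖ := by
  refine ⟨∑ i, ‖(ContinuousLinearMap.proj (R := ℝ) (φ := fun _ : ι => ℝ) i).comp
    (latticeCoord b).toContinuousLinearMap‖, by positivity, fun n => ?_⟩
  rw [freq, Finset.sum_mul]
  refine (norm_sum_le _ _).trans (Finset.sum_le_sum fun i _ => ?_)
  rw [norm_smul, mul_comm, Int.norm_cast_real]
  gcongr
  exact norm_le_pi_norm n i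

theorem RapidDecay.freq_mul {a : (ι → ℤ) → ℂ} (ha : RapidDecay a) (v : E) :
    RapidDecay fun n => 2 * Real.pi * Complex.I * freq b n v * a n := by
  obtain ⟨K, hK, hK'⟩ := exists_norm_freq_le b
  refine ha.mono (K := 2 * Real.pi * (K * ‖v‖)) (by positivity) fun n => ?_
  simp only [norm_mul, Complex.norm_I, Complex.norm_real, RCLike.norm_ofNat, mul_one,
    Real.norm_eq_abs, abs_of_pos Real.pi_pos]
  have h1 : |freq b n v| ≤ K * ‖n‖ * ‖v‖ := ((freq b n).le_opNorm v).trans (by gcongr; exact hK' n)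
  calc 2 * Real.pi * |freq b n v| * ‖a n‖ ≤ 2 * Real.pi * (K * ‖n‖ * ‖v‖) * ‖a n‖ := by gcongr
    _ = _ := by ring

/-- Termwise differentiation. The summability is recorded because evaluating the sum at a vector
termwise needs it. -/
theorem hasFDerivAt_torusSeries {a : (ι → ℤ) → ℂ} (ha : RapidDecay a) (z : E) :
    HasFDerivAt (torusSeries b a) (∑' n, a n • torusChar b n z •
      ((2 * Real.pi * Complex.I : ℂ) • Complex.ofRealCLM.comp (freq b n))) z ∧
    Summable fun n => a n • torusChar b n z •
      ((2 * Real.pi * Complex.I : ℂ) • Complex.ofRealCLM.comp (freq b n)) := by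
  obtain ⟨K, hK, hK'⟩ := exists_norm_freq_le b
  have hd : RapidDecay fun n => ((2 * Real.pi * K * ‖n‖ * ‖a n‖ : ℝ) : ℂ) :=
    ha.mono (K := 2 * Real.pi * K) (by positivity) fun n => by
      rw [Complex.norm_real, Real.norm_of_nonneg (by positivity)]
  have hu : Summable fun n => 2 * Real.pi * K * ‖n‖ * ‖a n‖ := by
    refine (hd.summable b).congr fun n => ?_
    rw [Complex.norm_real, Real.norm_of_nonneg (by positivity)]
  have hb : ∀ n z, ‖a n • torusChar b n z •
      ((2 * Real.pi * Complex.I : ℂ) • Complex.ofRealCLM.comp (freq b n))‖ ≤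
      2 * Real.pi * K * ‖n‖ * ‖a n‖ := fun n z => by
    simp only [norm_smul, norm_torusChar, norm_mul, Complex.norm_I, Complex.norm_real,
      RCLike.norm_ofNat, mul_one, one_mul, Real.norm_eq_abs, abs_of_pos Real.pi_pos]
    have h1 : ‖Complex.ofRealCLM.comp (freq b n)‖ ≤ K * ‖n‖ := by
      refine (ContinuousLinearMap.opNorm_comp_le _ _).trans ?_
      rw [Complex.ofRealCLM_norm, one_mul]
      exact hK' n
    calc ‖a n‖ * (2 * Real.pi * ‖Complex.ofRealCLM.comp (freq b n)‖)
        ≤ ‖a n‖ * (2 * Real.pi * (K * ‖n‖)) := by gcongr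
      _ = _ := by ring
  exact ⟨hasFDerivAt_tsum hu (fun n x => (hasFDerivAt_torusChar n x).const_mul (a n)) hb
    (summable_torusSeries ha 0) z, Summable.of_norm_bounded hu fun n => hb n z⟩

theorem fderiv_torusSeries {a : (ι → ℤ) → ℂ} (ha : RapidDecay a) (z v : E) :
    fderiv ℝ (torusSeries b a) z v =
      torusSeries b (fun n => 2 * Real.pi * Complex.I * freq b n v * a n) z := by
  obtain ⟨h1, h2⟩ := hasFDerivAt_torusSeries (b := b) ha z
  rw [h1.fderiv]
  have h3 := (ContinuousLinearMap.apply ℝ ℂ v).map_tsum h2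
  simp only [ContinuousLinearMap.apply_apply] at h3
  rw [h3]
  refine tsum_congr fun n => ?_
  simp
  ring

theorem contDiff_torusSeries {a : (ι → ℤ) → ℂ} (ha : RapidDecay a) :
    ContDiff ℝ ∞ (torusSeries b a) := by
  rw [contDiff_infty]
  intro m
  induction m generalizing a with
  | zero =>
    exact contDiff_zero.2 (Differentiable.continuous (𝕜 := ℝ)
      fun z => (hasFDerivAt_torusSeries ha z).1.differentiableAt)
  | succ m ih =>
    push_cast
    rw [contDiff_succ_iff_fderiv_apply]
    refine ⟨fun z => (hasFDerivAt_torusSeries ha z).1.differentiableAt, by simp, fun v => ?_⟩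
    simp only [fderiv_torusSeries ha]
    exact ih (ha.freq_mul v)

theorem torusSeries_torusCoeff {g : E → ℂ} (hg : IsPeriodic Λ g) (hs : ContDiff ℝ ∞ g) (z : E) :
    torusSeries b (torusCoeff b g) z = g z := by
  let G : C(UnitAddTorus ι, ℂ) := ⟨g ∘ ofUnitTorus b, hg.continuous_comp hs.continuous⟩
  have h1 : ∀ n, UnitAddTorus.mFourierCoeff G n = torusCoeff b g n := fun n =>
    (torusCoeff_eq g n).symm
  have h2 : Summable (UnitAddTorus.mFourierCoeff G) := by
    refine Summable.of_norm ?_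
    simp only [h1]
    exact (rapidDecay_torusCoeff hg hs).summable b
  have h3 := UnitAddTorus.hasSum_mFourier_series_apply_of_summable h2 (toUnitTorus b z)
  simp only [h1, ← torusChar_eq_mFourier, smul_eq_mul] at h3
  rw [torusSeries, h3.tsum_eq]
  exact hg.apply_ofUnitTorus z

end FourierSeries

/-! ### Rigidity -/

section Dolbeault

/-- The operator `∂̄` on scalar functions. -/
noncomputable def dbarScalar (f : C3 → ℂ) (z v : C3) : ℂ :=
  1 / 2 * (fderiv ℝ f z v + Complex.I * fderiv ℝ f z (Complex.I • v))

theorem dbar_apply {u : C3 → C3} {z : C3} (hu : DifferentiableAt ℝ u z) (v : C3) (i : Fin 3) :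
    dbar u z v i = dbarScalar (fun y => u y i) z v := by
  have h1 : ∀ w, fderiv ℝ u z w i = fderiv ℝ (fun y => u y i) z w := fun w => by
    rw [fderiv_apply hu]
    rfl
  simp only [dbar, dbarScalar, Pi.smul_apply, Pi.add_apply, smul_eq_mul, h1]

variable {Λ : Submodule ℤ C3} [DiscreteTopology Λ] [IsZLattice ℝ Λ] {ι : Type*} [Fintype ι]
  {b : Module.Basis ι ℤ Λ}

variable (b) in
/-- The symbol of `∂̄` in the direction `v`. -/
noncomputable def dbarSymbol (n : ι → ℤ) (v : C3) : ℂ :=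
  Real.pi * Complex.I * (freq b n v + Complex.I * freq b n (Complex.I • v))

theorem torusCoeff_dbarScalar {f : C3 → ℂ} (hf : IsPeriodic Λ f) (hf1 : ContDiff ℝ 1 f) (v : C3)
    (n : ι → ℤ) :
    torusCoeff b (fun z => dbarScalar f z v) n = dbarSymbol b n v * torusCoeff b f n := by
  have hc : ∀ v, Continuous fun z => fderiv ℝ f z v := fun v =>
    (hf1.continuous_fderiv one_ne_zero).clm_apply continuous_const
  have h1 := torusCoeff_add (b := b) (hf.fderiv_apply v) (hc v)
    (g := fun z => Complex.I * fderiv ℝ f z (Complex.I • v))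
    (fun l hl z => congrArg (Complex.I * ·) (hf.fderiv_apply _ l hl z))
    (continuous_const.mul (hc _)) n
  simp only [dbarScalar]
  rw [torusCoeff_const_mul, h1, torusCoeff_const_mul, torusCoeff_fderiv hf hf1,
    torusCoeff_fderiv hf hf1, dbarSymbol]
  ring

theorem torusMean_dbarScalar {f : C3 → ℂ} (hf : IsPeriodic Λ f) (hf1 : ContDiff ℝ 1 f) (v : C3) :
    torusMean b (fun z => dbarScalar f z v) = 0 := by
  rw [← torusCoeff_zero, torusCoeff_dbarScalar hf hf1]
  simp [dbarSymbol, freq_apply]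

theorem dbarScalar_torusSeries {a : (ι → ℤ) → ℂ} (ha : RapidDecay a) (z v : C3) :
    dbarScalar (torusSeries b a) z v = torusSeries b (fun n => dbarSymbol b n v * a n) z := by
  rw [dbarScalar, fderiv_torusSeries ha, fderiv_torusSeries ha, torusSeries, torusSeries,
    torusSeries, ← tsum_mul_left, ← (summable_torusSeries (ha.freq_mul v) z).tsum_add
      ((summable_torusSeries (ha.freq_mul _) z).mul_left _), ← tsum_mul_left]
  refine tsum_congr fun n => ?_
  rw [dbarSymbol]
  ring

/-- The frequencies are real, so the imaginary part of the symbol is π n_j. Hence solving for ∂̄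
involves no small divisors. -/
theorem one_le_norm_dbarSymbol {n : ι → ℤ} {j : ι} (hj : n j ≠ 0) :
    1 ≤ ‖dbarSymbol b n (b j : C3)‖ := by
  have h1 : (dbarSymbol b n (b j : C3)).im = Real.pi * n j := by
    rw [dbarSymbol, freq_basis]
    simp
  have h2 : (1 : ℝ) ≤ |(n j : ℝ)| := by exact_mod_cast Int.one_le_abs hj
  calc (1 : ℝ) ≤ Real.pi * |(n j : ℝ)| := by nlinarith [Real.pi_gt_three]
    _ = |(dbarSymbol b n (b j : C3)).im| := by rw [h1, abs_mul, abs_of_pos Real.pi_pos]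
    _ ≤ _ := Complex.abs_im_le_norm _

/-- A closed `(0,1)`-form on a torus is the sum of its mean value and an exact form. -/
theorem exists_dbarScalar_eq_sub_mean {β : C3 → C3 → ℂ}
    (hs : ∀ v, ContDiff ℝ ∞ fun z => β z v) (hp : ∀ v, IsPeriodic Λ fun z => β z v)
    (hcl : ∀ z v w, dbarScalar (fun y => β y w) z v = dbarScalar (fun y => β y v) z w) :
    ∃ u : C3 → ℂ, ContDiff ℝ ∞ u ∧ IsPeriodic Λ u ∧
      ∀ z v, β z v = torusMean b (fun y => β y v) + dbarScalar u z v := by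
  classical
  let c : C3 → (ι → ℤ) → ℂ := fun v => torusCoeff b fun z => β z v
  have hs1 : ∀ v, ContDiff ℝ 1 fun z => β z v := fun v => (hs v).of_le (by exact_mod_cast le_top)
  have hc : ∀ v, RapidDecay (c v) := fun v => rapidDecay_torusCoeff (hp v) (hs v)
  have hcomm : ∀ n v w, dbarSymbol b n v * c w n = dbarSymbol b n w * c v n := fun n v w => by
    rw [← torusCoeff_dbarScalar (hp w) (hs1 w), ← torusCoeff_dbarScalar (hp v) (hs1 v)]
    simp only [hcl _ v w]
  -- For n ≠ 0, divide by the symbol in a basis direction with n_j ≠ 0; closedness (`hcomm`) makes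
  -- the result right in all directions. The frequency 0 is left to the mean value.
  have hex : ∀ n : ι → ℤ, ∃ a : ℂ, (n = 0 → a = 0) ∧ ‖a‖ ≤ ∑ j, ‖c (b j) n‖ ∧
      ∀ v, dbarSymbol b n v * a = if n = 0 then 0 else c v n := fun n => by
    by_cases hn : n = 0
    · exact ⟨0, fun _ => rfl, by rw [norm_zero]; positivity, fun v => by simp [hn]⟩
    · obtain ⟨j, hj⟩ := Function.ne_iff.1 hn
      have hl := one_le_norm_dbarSymbol (b := b) hj
      have hl0 : dbarSymbol b n (b j : C3) ≠ 0 := norm_pos_iff.1 (by linarith)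
      refine ⟨c (b j) n / dbarSymbol b n (b j : C3), fun h => absurd h hn, ?_, fun v => ?_⟩
      · rw [norm_div]
        exact (div_le_self (norm_nonneg _) hl).trans
          (Finset.single_le_sum (f := fun j => ‖c (b j) n‖) (fun _ _ => norm_nonneg _)
            (Finset.mem_univ j))
      · rw [if_neg hn, ← mul_div_assoc, hcomm, mul_div_cancel_left₀ _ hl0]
  choose a ha0 ha hav using hex
  have hdecay : RapidDecay a := fun N => by
    choose C hC using fun j => hc (b j) N
    refine ⟨∑ j, C j, fun n => ?_⟩
    calc ‖n‖ ^ N * ‖a n‖ ≤ ‖n‖ ^ N * ∑ j, ‖c (b j) n‖ := by gcongr; exact ha n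
      _ = ∑ j, ‖n‖ ^ N * ‖c (b j) n‖ := Finset.mul_sum _ _ _
      _ ≤ _ := Finset.sum_le_sum fun j _ => hC j n
  refine ⟨torusSeries b a, contDiff_torusSeries hdecay, isPeriodic_torusSeries a, fun z v => ?_⟩
  rw [dbarScalar_torusSeries hdecay, ← torusSeries_torusCoeff (b := b) (hp v) (hs v) z]
  have h1 := (summable_torusSeries (b := b) (hc v) z).tsum_eq_add_tsum_ite 0
  rw [torusChar_zero, mul_one] at h1
  rw [← torusCoeff_zero (b := b)]
  simp only [torusSeries]
  refine h1.trans (congrArg _ (tsum_congr fun n => ?_))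
  rw [hav]
  by_cases hn : n = 0 <;> simp [hn, c]

end Dolbeault

/-! ### Invariant constant forms vanish -/

theorem norm_χ (g : Z3sq) (i : Fin 3) : ‖χ g i‖ = 1 := by
  fin_cases i <;> simp [χ, norm_ζ]

/-- The characters by which the group acts on constant forms dz̄_j ⊗ ∂_i are the inverses of these
products. -/
theorem exists_χ_mul_χ_ne_one (i j : Fin 3) : ∃ g, χ g i * χ g j ≠ 1 := by
  have h1 : ∀ i j : Fin 3, ∃ g : Z3sq,
      ![g.toAdd.1, g.toAdd.2, g.toAdd.1 + g.toAdd.2] i +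
        ![g.toAdd.1, g.toAdd.2, g.toAdd.1 + g.toAdd.2] j ≠ 0 := by decide
  obtain ⟨g, hg⟩ := h1 i j
  refine ⟨g, fun e => hg ?_⟩
  have h2 : ∀ i, χ g i = ζ ^ (![g.toAdd.1, g.toAdd.2, g.toAdd.1 + g.toAdd.2] i).val := by
    intro i
    fin_cases i <;> rfl
  rw [h2, h2, ← ζ_pow_val_add, ζ_pow_val_eq_one] at e
  exact e

theorem IsForm01.apply_smul {Λ : Submodule ℤ C3} {α : C3 → C3 →L[ℝ] C3} (hα : IsForm01 Λ α)
    (z : C3) (c : ℂ) (v : C3) : α z (c • v) = (starRingEnd ℂ) c • α z v := by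
  have h1 : c • v = c.re • v + c.im • (Complex.I • v) := by
    ext i
    simp only [Pi.smul_apply, Pi.add_apply, smul_eq_mul, Complex.real_smul]
    conv_lhs => rw [← Complex.re_add_im c]
    ring
  have h2 : (starRingEnd ℂ) c = c.re - c.im * Complex.I := by
    apply Complex.ext <;> simp
  rw [h1, map_add, map_smul, map_smul, hα.antilinear, h2]
  ext i
  simp only [Pi.smul_apply, Pi.add_apply, Pi.neg_apply, smul_eq_mul, Complex.real_smul]
  ring

theorem dbarScalar_comp_affine {u : C3 → ℂ} (hu : Differentiable ℝ u) (g : Z3sq) (c z v : C3) :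
    dbarScalar (fun y => u (ρ₁ g *ᵥ y + c)) z v =
      dbarScalar u (ρ₁ g *ᵥ z + c) (ρ₁ g *ᵥ v) := by
  have h1 : HasFDerivAt (fun y : C3 => ρ₁ g *ᵥ y + c) ((ρL g).restrictScalars ℝ) z := by
    have := (((ρL g).restrictScalars ℝ).hasFDerivAt (x := z)).add_const c
    simpa only [ContinuousLinearMap.coe_restrictScalars', ρL_apply] using this
  have h2 : ∀ w, fderiv ℝ (fun y => u (ρ₁ g *ᵥ y + c)) z w =
      fderiv ℝ u (ρ₁ g *ᵥ z + c) (ρ₁ g *ᵥ w) := fun w => by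
    have h3 := ((hu (ρ₁ g *ᵥ z + c)).hasFDerivAt.comp z h1).fderiv
    change fderiv ℝ (u ∘ fun y => ρ₁ g *ᵥ y + c) z w = _
    rw [h3]
    simp [ρL_apply]
  simp only [dbarScalar, h2, Matrix.mulVec_smul]

namespace TorusAction

/-- Every action with analytic representation `ρ₁` is rigid. -/
theorem isRigid (A : TorusAction Z3sq ρ₁) : A.IsRigid := by
  intro α hα hcl hinv
  let b := Module.Free.chooseBasis ℤ A.lattice
  have hs : ∀ v i, ContDiff ℝ ∞ fun z => α z v i := fun v i =>
    contDiff_pi.1 (hα.smooth.clm_apply contDiff_const) i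
  have hd : ∀ v, Differentiable ℝ fun z => α z v := fun v =>
    (hα.smooth.clm_apply contDiff_const).differentiable (by simp)
  have hp : ∀ v i, IsPeriodic A.lattice fun z => α z v i := fun v i l hl z => by
    simp only [hα.periodic l hl z]
  have h1 : ∀ i, ∃ u : C3 → ℂ, ContDiff ℝ ∞ u ∧ IsPeriodic A.lattice u ∧
      ∀ z v, α z v i = torusMean b (fun y => α y v i) + dbarScalar u z v := fun i =>
    exists_dbarScalar_eq_sub_mean (b := b) (β := fun z v => α z v i) (fun v => hs v i)
      (fun v => hp v i) fun z v w => by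
        rw [← dbar_apply (hd w z), ← dbar_apply (hd v z), hcl]
  choose u hus hup hu using h1
  have hu1 : ∀ i, ContDiff ℝ 1 (u i) := fun i => (hus i).of_le (by exact_mod_cast le_top)
  let M : C3 → Fin 3 → ℂ := fun v i => torusMean b (fun y => α y v i)
  have hMadd : ∀ v w i, M (v + w) i = M v i + M w i := fun v w i => by
    simp only [M, map_add, Pi.add_apply]
    exact torusMean_add (hp v i) (hs v i).continuous (hp w i) (hs w i).continuous
  have hMsmul : ∀ (c : ℂ) v i, M (c • v) i = (starRingEnd ℂ) c * M v i := fun c v i => by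
    simp only [M, hα.apply_smul, Pi.smul_apply, smul_eq_mul, torusMean_const_mul]
  -- Take means in the exactness of Φ(g)^*α - α: all ∂̄-terms have mean zero and only the constant
  -- parts remain.
  have hMinv : ∀ g v i, χ g⁻¹ i * M (ρ₁ g *ᵥ v) i = M v i := fun g v i => by
    obtain ⟨c, hc⟩ := A.analytic g
    obtain ⟨w, hws, hwp, hw⟩ := hinv g c hc
    have hw1 : ContDiff ℝ 1 fun z => w z i :=
      (contDiff_pi.1 hws i).of_le (by exact_mod_cast le_top)
    have hwp' : IsPeriodic A.lattice fun z => w z i := fun l hl z => by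
      simp only [hwp l hl z]
    have haff : IsPeriodic A.lattice fun z => u i (ρ₁ g *ᵥ z + c) := fun l hl z => by
      simp only [Matrix.mulVec_add, add_right_comm _ _ c]
      exact hup i _ (A.mulVec_mem_lattice g hl) _
    have haff1 : ContDiff ℝ 1 fun z => u i (ρ₁ g *ᵥ z + c) := 
      (hu1 i).comp ((contDiff_affine g c).restrict_scalars ℝ)
    have h2 : ∀ z, dbarScalar (fun y => w y i) z v =
        (χ g⁻¹ i * M (ρ₁ g *ᵥ v) i - M v i) +
        (χ g⁻¹ i * dbarScalar (fun y => u i (ρ₁ g *ᵥ y + c)) z v +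
          (-1) * dbarScalar (u i) z v) := fun z => by
      have h3 := congrFun (hw z v) i
      rw [dbar_apply (hws.differentiable (by simp) z)] at h3
      dsimp only at h3
      rw [← h3, Pi.sub_apply, ρ₁_mulVec, hu i, hu i, dbarScalar_comp_affine
        ((hu1 i).differentiable one_ne_zero)]
      ring
    have hdc : ∀ {f : C3 → ℂ}, ContDiff ℝ 1 f → Continuous fun z => dbarScalar f z v := by
      intro f hf
      have hf' := hf.continuous_fderiv one_ne_zero
      exact continuous_const.mul ((hf'.clm_apply continuous_const).add
        (continuous_const.mul (hf'.clm_apply continuous_const)))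
    have hdp : ∀ {f : C3 → ℂ}, IsPeriodic A.lattice f →
        IsPeriodic A.lattice fun z => dbarScalar f z v := by
      intro f hf l hl z
      simp only [dbarScalar, hf.fderiv l hl z]
    have hcm : ∀ {f : C3 → ℂ} (a : ℂ), IsPeriodic A.lattice f →
        IsPeriodic A.lattice fun z => a * f z := by
      intro f a hf l hl z
      simp only [hf l hl z]
    have h4 := torusMean_dbarScalar (b := b) hwp' hw1 v
    have h5 := torusMean_add (b := b) (hcm (χ g⁻¹ i) (hdp haff))
      (continuous_const.mul (hdc haff1)) (hcm (-1) (hdp (hup i)))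
      (continuous_const.mul (hdc (hu1 i)))
    have h6 := torusMean_add (b := b) (f := fun _ => χ g⁻¹ i * M (ρ₁ g *ᵥ v) i - M v i)
      (fun _ _ _ => rfl) continuous_const
      (g := fun z => χ g⁻¹ i * dbarScalar (fun y => u i (ρ₁ g *ᵥ y + c)) z v +
          (-1) * dbarScalar (u i) z v)
      (fun l hl z => congrArg₂ (· + ·) (hcm (χ g⁻¹ i) (hdp haff) l hl z)
        (hcm (-1) (hdp (hup i)) l hl z))
      ((continuous_const.mul (hdc haff1)).add (continuous_const.mul (hdc (hu1 i))))
    simp only [h2] at h4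
    rw [h6, h5, torusMean_const, torusMean_const_mul, torusMean_const_mul,
      torusMean_dbarScalar haff haff1, torusMean_dbarScalar (hup i) (hu1 i)] at h4
    linear_combination h4
  have hMsingle : ∀ j z i, M (Pi.single j z) i = 0 := fun j z i => by
    obtain ⟨g, hg⟩ := exists_χ_mul_χ_ne_one i j
    have h2 := hMinv g (Pi.single j z) i
    have h3 : ρ₁ g *ᵥ (Pi.single j z : C3) = χ g j • (Pi.single j z : C3) := by
      rw [ρ₁_mulVec_single, ← smul_eq_mul, Pi.single_smul]
    have h4 : χ g i * χ g⁻¹ i = 1 := by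
      have := congrFun (ρ₁_mulVec_inv g (fun _ => 1)) i
      simpa [ρ₁_mulVec] using this
    have h5 : χ g j * (starRingEnd ℂ) (χ g j) = 1 := by
      rw [Complex.mul_conj, Complex.normSq_eq_norm_sq, norm_χ]
      simp
    rw [h3, hMsmul] at h2
    have h6 : (χ g i * χ g j - 1) * M (Pi.single j z) i = 0 := by
      linear_combination -(χ g i * χ g j) * h2 +
        χ g j * (starRingEnd ℂ) (χ g j) * M (Pi.single j z) i * h4 + M (Pi.single j z) i * h5
    exact (mul_eq_zero.1 h6).resolve_left (sub_ne_zero.2 hg)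
  have hM : ∀ v i, M v i = 0 := fun v i => by
    have h2 : v = Pi.single 0 (v 0) + (Pi.single 1 (v 1) + Pi.single 2 (v 2)) := by
      ext i
      fin_cases i <;> simp
    rw [h2, hMadd, hMadd, hMsingle, hMsingle, hMsingle]
    simp
  refine ⟨fun z i => u i z, contDiff_pi.2 hus, fun l hl z => funext fun i => hup i l hl z,
    fun z v => funext fun i => ?_⟩
  rw [dbar_apply ((contDiff_pi.2 hus).differentiable (by simp) z)]
  refine (hu i z v).trans ?_
  change M v i + _ = _
  rw [hM, zero_add]

end TorusAction

/-! ### Units of the Eisenstein integers -/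

/-- Units of `ℤ[ζ]`. -/
structure IsEisUnit (u : ℂ) : Prop where
  mem : u ∈ Eis
  inv_mem : u⁻¹ ∈ Eis
  ne_zero : u ≠ 0

namespace IsEisUnit

variable {u w : ℂ}

theorem mul (hu : IsEisUnit u) (hw : IsEisUnit w) : IsEisUnit (u * w) :=
  ⟨Eis_mul hu.mem hw.mem, by rw [mul_inv]; exact Eis_mul hu.inv_mem hw.inv_mem,
    mul_ne_zero hu.ne_zero hw.ne_zero⟩

theorem inv (hu : IsEisUnit u) : IsEisUnit u⁻¹ :=
  ⟨hu.inv_mem, by rw [inv_inv]; exact hu.mem, inv_ne_zero hu.ne_zero⟩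

theorem neg (hu : IsEisUnit u) : IsEisUnit (-u) :=
  ⟨neg_mem hu.mem, by rw [inv_neg]; exact neg_mem hu.inv_mem, neg_ne_zero.2 hu.ne_zero⟩

theorem one : IsEisUnit 1 := ⟨one_mem_Eis, by rw [inv_one]; exact one_mem_Eis, one_ne_zero⟩

theorem ζ_pow (m : ℕ) : IsEisUnit (ζ ^ m) := by
  refine ⟨ζ_pow_mem_Eis m, ?_, pow_ne_zero _ ζ_ne_zero⟩
  have : (ζ ^ m)⁻¹ = ζ ^ (2 * m) := by
    refine inv_eq_of_mul_eq_one_right ?_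
    rw [← pow_add, show m + 2 * m = 3 * m by ring, pow_mul, ζ_pow_three, one_pow]
  rw [this]
  exact ζ_pow_mem_Eis _

theorem mul_mem_iff (hu : IsEisUnit u) {z : ℂ} : u * z ∈ Eis ↔ z ∈ Eis := by
  refine ⟨fun hz => ?_, Eis_mul hu.mem⟩
  have := Eis_mul hu.inv_mem hz
  rwa [inv_mul_cancel_left₀ hu.ne_zero] at this

end IsEisUnit

theorem one_sub_ζ_mul_mem_iff {p q : ℤ} : (1 - ζ) * ((p + q * ζ) / 3) ∈ Eis ↔ 3 ∣ p + q := by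
  have : (1 - ζ) * ((p + q * ζ) / 3) = (((p + q : ℤ) : ℂ) + ((2 * q - p : ℤ) : ℂ) * ζ) / 3 := by
    push_cast
    linear_combination (-q / 3 : ℂ) * ζ_sq
  rw [this, third_mem_Eis]
  omega

/-- Points of order three are congruent to `u / 3` for a unit `u`, or they are fixed by `ζ`. -/
theorem exists_isEisUnit_sub_third_mem {x : ℂ} (hx : 3 * x ∈ Eis) (hx' : (1 - ζ) * x ∉ Eis) :
    ∃ u, IsEisUnit u ∧ x - u / 3 ∈ Eis := by
  obtain ⟨p, q, e⟩ := mem_Eis.1 hx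
  obtain rfl : x = (p + q * ζ) / 3 := by linear_combination e / 3
  rw [one_sub_ζ_mul_mem_iff] at hx'
  have hsub : ∀ {r s : ℤ}, 3 ∣ p - r → 3 ∣ q - s →
      (p + q * ζ) / 3 - (r + s * ζ : ℂ) / 3 ∈ Eis := fun {r s} hr hs => by
    have := third_mem_Eis.2 ⟨hr, hs⟩
    push_cast at this
    convert this using 1
    ring
  -- Six classes modulo 3 have p + q not divisible by 3, and they are represented by the six units
  -- ±1, ±ζ, ±ζ².
  have h1 : ∃ r s : ℤ, 3 ∣ p - r ∧ 3 ∣ q - s ∧ ((r = 1 ∧ s = 0) ∨ (r = 0 ∧ s = 1) ∨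
      (r = -1 ∧ s = -1) ∨ (r = -1 ∧ s = 0) ∨ (r = 0 ∧ s = -1) ∨ (r = 1 ∧ s = 1)) := by
    have hp : p % 3 = 0 ∨ p % 3 = 1 ∨ p % 3 = 2 := by omega
    have hq : q % 3 = 0 ∨ q % 3 = 1 ∨ q % 3 = 2 := by omega
    rcases hp with hp | hp | hp <;> rcases hq with hq | hq | hq
    · omega
    · exact ⟨0, 1, by omega, by omega, by simp⟩
    · exact ⟨0, -1, by omega, by omega, by simp⟩
    · exact ⟨1, 0, by omega, by omega, by simp⟩
    · exact ⟨1, 1, by omega, by omega, by simp⟩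
    · omega
    · exact ⟨-1, 0, by omega, by omega, by simp⟩
    · omega
    · exact ⟨-1, -1, by omega, by omega, by simp⟩
  obtain ⟨r, s, hr, hs, hrs⟩ := h1
  refine ⟨r + s * ζ, ?_, hsub hr hs⟩
  have h2 : ζ ^ 2 = -1 - ζ := ζ_sq
  rcases hrs with ⟨rfl, rfl⟩ | ⟨rfl, rfl⟩ | ⟨rfl, rfl⟩ | ⟨rfl, rfl⟩ | ⟨rfl, rfl⟩ | ⟨rfl, rfl⟩
  · simpa using IsEisUnit.one
  · simpa using IsEisUnit.ζ_pow 1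
  · have := IsEisUnit.ζ_pow 2
    rw [h2] at this
    convert this using 1
    push_cast
    ring
  · simpa using IsEisUnit.one.neg
  · simpa using (IsEisUnit.ζ_pow 1).neg
  · have := (IsEisUnit.ζ_pow 2).neg
    rw [h2] at this
    convert this using 1
    push_cast
    ring

/-- The kernel of 1 - ζ has the three elements 0, t, -t. -/
theorem exists_isEisUnit_sub_t_mem {x : ℂ} (hx : x ∉ Eis) (hx' : (1 - ζ) * x ∈ Eis) :
    ∃ u, IsEisUnit u ∧ x - u * t ∈ Eis := by
  obtain ⟨n, hn⟩ := exists_int_mul_t hx'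
  have h3 : ¬ 3 ∣ n := fun hd => hx (by simpa using add_mem hn (int_mul_t_mem_Eis.2 hd))
  rcases (by omega : 3 ∣ n - 1 ∨ 3 ∣ n + 1) with hd | hd
  · refine ⟨1, IsEisUnit.one, ?_⟩
    have := add_mem hn (int_mul_t_mem_Eis.2 hd)
    push_cast at this
    convert this using 1
    ring
  · refine ⟨-1, IsEisUnit.one.neg, ?_⟩
    have := add_mem hn (int_mul_t_mem_Eis.2 hd)
    push_cast at this
    convert this using 1
    ring

/-- If `x` is a point of order three with `(1 - ζ) x ≠ 0`, then `x` generates all points of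
order three. -/
theorem exists_mul_sub_mem {x y : ℂ} (hx : 3 * x ∈ Eis) (hx' : (1 - ζ) * x ∉ Eis)
    (hy : 3 * y ∈ Eis) : ∃ w ∈ Eis, w * x - y ∈ Eis := by
  obtain ⟨u, hu, hxu⟩ := exists_isEisUnit_sub_third_mem hx hx'
  refine ⟨3 * y * u⁻¹, Eis_mul hy hu.inv_mem, ?_⟩
  have h1 := Eis_mul (Eis_mul hy hu.inv_mem) hxu
  convert h1 using 1
  have := hu.ne_zero
  field_simp

theorem exists_χ_eq_ζ (j : Fin 3) : ∃ g, χ g j = ζ := by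
  have : ∀ j : Fin 3, ∃ g : Z3sq, ![g.toAdd.1, g.toAdd.2, g.toAdd.1 + g.toAdd.2] j = 1 := by decide
  obtain ⟨g, hg⟩ := this j
  refine ⟨g, ?_⟩
  have h2 : χ g j = ζ ^ (![g.toAdd.1, g.toAdd.2, g.toAdd.1 + g.toAdd.2] j).val := by
    fin_cases j <;> rfl
  rw [h2, hg]
  exact pow_one ζ

/-- If `Λ` is invariant under `ρ₁`, then the projections of `Λ` to the axes are `ℤ[ζ]`-modules. -/
theorem exists_apply_eq_mul {Λ : Submodule ℤ C3} (hΛ : ∀ g, ∀ v ∈ Λ, ρ₁ g *ᵥ v ∈ Λ) {v : C3}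
    (hv : v ∈ Λ) {e : ℂ} (he : e ∈ Eis) (j : Fin 3) : ∃ w ∈ Λ, w j = e * v j := by
  obtain ⟨m, n, rfl⟩ := mem_Eis.1 he
  obtain ⟨g, hg⟩ := exists_χ_eq_ζ j
  refine ⟨m • v + n • (ρ₁ g *ᵥ v), add_mem (Λ.smul_mem _ hv) (Λ.smul_mem _ (hΛ g v hv)), ?_⟩
  rw [Pi.add_apply, Pi.smul_apply, Pi.smul_apply, ρ₁_mulVec, hg, zsmul_eq_mul, zsmul_eq_mul]
  ring

theorem single_mul_mem {Λ : Submodule ℤ C3} (hΛ : ∀ g, ∀ v ∈ Λ, ρ₁ g *ᵥ v ∈ Λ) {j : Fin 3} {z : ℂ}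
    (hz : (Pi.single j z : C3) ∈ Λ) {e : ℂ} (he : e ∈ Eis) : (Pi.single j (e * z) : C3) ∈ Λ := by
  obtain ⟨m, n, rfl⟩ := mem_Eis.1 he
  obtain ⟨g, hg⟩ := exists_χ_eq_ζ j
  have h1 := add_mem (Λ.smul_mem m hz) (Λ.smul_mem n (hΛ g _ hz))
  rw [ρ₁_mulVec_single, hg, ← Pi.single_smul, ← Pi.single_smul, ← Pi.single_add] at h1
  rw [zsmul_eq_mul, zsmul_eq_mul, ← mul_assoc, ← add_mul] at h1
  exact h1

/-- Summing over a cyclic group of order three gives three times the projection to its fixed space.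
-/
theorem add_axisElt_mulVec (j : Fin 3) (v : C3) :
    v + (ρ₁ (axisElt j) *ᵥ v + ρ₁ (axisElt j) *ᵥ (ρ₁ (axisElt j) *ᵥ v)) =
      Pi.single j (3 * v j) := by
  ext i
  simp only [Pi.add_apply, ρ₁_mulVec]
  by_cases hij : i = j
  · subst hij
    rw [(χ_axisElt i i).2 rfl, Pi.single_eq_same]
    ring
  · rw [Pi.single_eq_of_ne hij]
    have h2 : χ (axisElt j) i - 1 ≠ 0 := sub_ne_zero.2 fun e => hij ((χ_axisElt j i).1 e)
    have h3 : χ (axisElt j) i ^ 3 = 1 := by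
      have h4 := ρ₁_mul_mulVec (axisElt j) (axisElt j * axisElt j) (fun _ => 1)
      rw [← pow_three, Z3sq_pow_three, ρ₁_mul_mulVec] at h4
      have h5 := congrFun h4 i
      simp only [ρ₁_mulVec, map_one, Matrix.one_mulVec] at h5
      linear_combination -h5
    apply mul_left_cancel₀ h2
    linear_combination (v i) * h3

theorem single_three_mul_mem {Λ : Submodule ℤ C3} (hΛ : ∀ g, ∀ v ∈ Λ, ρ₁ g *ᵥ v ∈ Λ) {v : C3}
    (hv : v ∈ Λ) (j : Fin 3) : (Pi.single j (3 * v j) : C3) ∈ Λ := by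
  rw [← add_axisElt_mulVec]
  exact add_mem hv (add_mem (hΛ (axisElt j) _ hv) (hΛ (axisElt j) _ (hΛ (axisElt j) _ hv)))

namespace TorusAction

/-- The intersection of the lattice with a coordinate axis is similar to `ℤ[ζ]`. -/
theorem exists_axis_generator (A : TorusAction Z3sq ρ₁) (j : Fin 3) :
    ∃ c : ℂ, c ≠ 0 ∧ ∀ z, (Pi.single j z : C3) ∈ A.lattice ↔ z / c ∈ Eis := by
  have hΛ : ∀ g, ∀ v ∈ A.lattice, ρ₁ g *ᵥ v ∈ A.lattice := fun g v hv => mulVec_mem_lattice g hv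
  obtain ⟨w, hw0, hw⟩ : ∃ w : ℂ, w ≠ 0 ∧ (Pi.single j w : C3) ∈ A.lattice := by
    obtain ⟨r, hr⟩ := A.exists_bounded_representative
    -- A lattice vector within r of a point at distance |r| + 1 on the axis has nonzero j-th
    -- coordinate.
    obtain ⟨l, hl, hle⟩ := hr (Pi.single j ((|r| + 1 : ℝ) : ℂ))
    refine ⟨3 * l j, mul_ne_zero three_ne_zero fun h0 => ?_, single_three_mul_mem hΛ hl j⟩
    have h1 := (norm_le_pi_norm _ j).trans hle
    rw [Pi.sub_apply, h0, Pi.single_eq_same, sub_zero, Complex.norm_real, Real.norm_eq_abs,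
      abs_of_pos (by positivity)] at h1
    linarith [le_abs_self r]
  let T : Set ℂ := {z | z ≠ 0 ∧ (Pi.single j z : C3) ∈ A.lattice ∧ ‖z‖ ≤ ‖w‖}
  have hT : T.Finite := by
    refine Set.Finite.subset (Set.Finite.preimage ((Pi.single_injective j).injOn)
      (A.finite_closedBall_inter_lattice ‖w‖)) ?_
    rintro z ⟨-, h1, h2⟩
    refine ⟨?_, h1⟩
    rw [mem_closedBall_zero_iff, pi_norm_le_iff_of_nonneg (norm_nonneg _)]
    intro i
    by_cases hij : i = j
    · subst hij; simpa using h2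
    · rw [Pi.single_eq_of_ne hij, norm_zero]; exact norm_nonneg _
  -- A shortest nonzero vector generates, by division with remainder in ℤ[ζ].
  obtain ⟨c, ⟨hc0, hc, hcw⟩, hmin⟩ := Set.exists_min_image T (fun z => ‖z‖) hT ⟨w, hw0, hw, le_rfl⟩
  have hmul : ∀ e ∈ Eis, (Pi.single j (e * c) : C3) ∈ A.lattice := fun e he =>
    single_mul_mem hΛ hc he
  refine ⟨c, hc0, fun z => ⟨fun hz => ?_, fun hz => ?_⟩⟩
  · obtain ⟨e, he, hlt⟩ := exists_Eis_near (z / c)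
    have h1 : z - e * c = (z / c - e) * c := by field_simp
    by_cases h0 : z - e * c = 0
    · rw [h1] at h0
      rw [sub_eq_zero.1 ((mul_eq_zero.1 h0).resolve_right hc0)]
      exact he
    · have h2 : ‖z - e * c‖ < ‖c‖ := by
        rw [h1, norm_mul]
        exact mul_lt_of_lt_one_left (norm_pos_iff.2 hc0) hlt
      have h3 : (Pi.single j (z - e * c) : C3) ∈ A.lattice := by
        rw [Pi.single_sub]
        exact sub_mem hz (hmul e he)
      exact absurd (hmin _ ⟨h0, h3, h2.le.trans hcw⟩) (not_le.2 h2)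
  · have := hmul _ hz
    rwa [div_mul_cancel₀ _ hc0] at this

end TorusAction

/-! ### The lattices and translations of actions with finite fixed locus -/

/-- The conditions on the lattice `Λ` and the translation `a` of `Φ(h)`, for an action with finite
fixed locus for which `Φ(k)` has translation part `0`. -/
structure IsAdmissible (Λ : Submodule ℤ C3) (a : C3) : Prop where
  axis : ∀ j, ∃ c : ℂ, c ≠ 0 ∧ ∀ z, (Pi.single j z : C3) ∈ Λ ↔ z / c ∈ Eis
  mulVec : ∀ g, ∀ v ∈ Λ, ρ₁ g *ᵥ v ∈ Λ
  comm : ρ₁ k *ᵥ a - a ∈ Λ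
  three : ∀ j, (Pi.single j (3 * a j) : C3) ∈ Λ
  free : ∀ v ∈ Λ, ∀ j, v j ≠ a j

namespace TorusAction

/-- No eigenvalue of k is 1, so a lift of Φ(k) has a fixed point p. With p as origin, k has
translation part 0, and h, hk, hk² all have translation part a. -/
theorem FiniteFixedLocus.exists_isAdmissible {A : TorusAction Z3sq ρ₁} (hA : A.FiniteFixedLocus) :
    ∃ p a, IsAdmissible A.lattice a ∧ (∀ j, A.IsLift (axisElt j) (a + p - ρ₁ (axisElt j) *ᵥ p)) ∧
      A.IsLift k (p - ρ₁ k *ᵥ p) := by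
  obtain ⟨bk, hbk⟩ := A.exists_isLift k
  obtain ⟨bh, hbh⟩ := A.exists_isLift h
  have hk1 : ∀ i, χ k i ≠ 1 := fun i => by
    rw [Ne, χ_eq_one_iff]
    revert i
    decide
  let p : C3 := fun i => bk i / (1 - χ k i)
  have hp : bk = p - ρ₁ k *ᵥ p := by
    ext i
    have := sub_ne_zero.2 (hk1 i).symm
    simp only [Pi.sub_apply, ρ₁_mulVec, p]
    field_simp
  rw [hp] at hbk
  let a : C3 := ρ₁ h *ᵥ p + bh - p
  have ha : bh = a + p - ρ₁ h *ᵥ p := by simp only [a]; abel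
  rw [ha] at hbh
  have hax : ∀ j, A.IsLift (axisElt j) (a + p - ρ₁ (axisElt j) *ᵥ p) := by
    have h1 := hbh.mul hbk
    have h2 := hbh.mul (hbk.mul hbk)
    have e1 : ρ₁ h *ᵥ (p - ρ₁ k *ᵥ p) + (a + p - ρ₁ h *ᵥ p) = a + p - ρ₁ (h * k) *ᵥ p := by
      rw [Matrix.mulVec_sub, ρ₁_mul_mulVec]; abel
    have e2 : ρ₁ h *ᵥ (ρ₁ k *ᵥ (p - ρ₁ k *ᵥ p) + (p - ρ₁ k *ᵥ p)) + (a + p - ρ₁ h *ᵥ p) =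
        a + p - ρ₁ (h * (k * k)) *ᵥ p := by
      simp only [Matrix.mulVec_sub, Matrix.mulVec_add, ρ₁_mul_mulVec]; abel
    rw [e1] at h1
    rw [e2] at h2
    intro j
    fin_cases j
    · exact hbh
    · exact h1
    · exact h2
  refine ⟨p, a, ⟨A.exists_axis_generator, fun g v hv => mulVec_mem_lattice g hv, ?_, fun j => ?_,
    fun v hv j e => ?_⟩, hax, hbk⟩
  · have h1 := hbk.mul hbh
    rw [mul_comm k h] at h1
    have h2 := h1.sub_mem (hbh.mul hbk)
    convert h2 using 1
    simp only [Matrix.mulVec_sub, Matrix.mulVec_add, ← ρ₁_mul_mulVec, mul_comm k h]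
    abel
  · have h1 := (hax j).mul ((hax j).mul (hax j))
    rw [← pow_three, Z3sq_pow_three, isLift_one_iff, Matrix.mulVec_add, add_comm _ (a + p - _),
      add_comm (ρ₁ _ *ᵥ (ρ₁ _ *ᵥ _)), add_axisElt_mulVec] at h1
    simpa [ρ₁_mulVec, (χ_axisElt j j).2 rfl] using h1
  · refine hA.apply_ne (hax j) hv ?_
    rw [e]
    simp [ρ₁_mulVec, (χ_axisElt j j).2 rfl]

end TorusAction

/-- Some vector of `Λ` has a `j`-th component that is not in `Λ`. -/
def HasNonsplitAxis (Λ : Submodule ℤ C3) (j : Fin 3) : Prop :=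
  ∃ v ∈ Λ, (Pi.single j (v j) : C3) ∉ Λ

theorem χ_k (j : Fin 3) : χ k j = ![ζ, ζ, ζ ^ 2] j := by
  fin_cases j
  · exact pow_one ζ
  · exact pow_one ζ
  · rfl

/-! ### Projections of an admissible lattice to the axes -/

namespace IsAdmissible

variable {Λ : Submodule ℤ C3} {a : C3} (hΛ : IsAdmissible Λ a) {j : Fin 3} {c : ℂ}

include hΛ

/-- The projection of Λ to the axis is a ℤ[ζ]-module containing cℤ[ζ], and it does not contain a_j.
-/
theorem mul_sub_notMem (hc : ∀ z, (Pi.single j z : C3) ∈ Λ ↔ z / c ∈ Eis) {v : C3}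
    (hv : v ∈ Λ) {e : ℂ} (he : e ∈ Eis) : e * (v j / c) - a j / c ∉ Eis := fun h => by
  obtain ⟨w, hw, hwj⟩ := exists_apply_eq_mul hΛ.mulVec hv he j
  have h1 : (Pi.single j (w j - a j) : C3) ∈ Λ := by
    rw [hc, hwj]
    convert h using 1
    ring
  refine hΛ.free _ (sub_mem hw h1) j ?_
  simp

theorem three_mul_mem (hc : ∀ z, (Pi.single j z : C3) ∈ Λ ↔ z / c ∈ Eis) {v : C3} (hv : v ∈ Λ) :
    3 * (v j / c) ∈ Eis := by
  rw [← mul_div_assoc, ← hc]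
  exact single_three_mul_mem hΛ.mulVec hv j

/-- Otherwise v_j / c would generate all 3-torsion modulo ℤ[ζ], including a_j / c. -/
theorem one_sub_ζ_mul_mem (hc : ∀ z, (Pi.single j z : C3) ∈ Λ ↔ z / c ∈ Eis) {v : C3}
    (hv : v ∈ Λ) : (1 - ζ) * (v j / c) ∈ Eis := by
  by_contra h
  have h3 : 3 * (a j / c) ∈ Eis := by
    rw [← mul_div_assoc, ← hc]
    exact hΛ.three j
  obtain ⟨e, he, h1⟩ := exists_mul_sub_mem (hΛ.three_mul_mem hc hv) h h3
  exact hΛ.mul_sub_notMem hc hv he h1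

/-- On a nonsplit axis the projection contains every class killed by 1 - ζ, so a_j / c is not one of
them. Conversely, if 1 - ζ does not kill a_j / c, then ρ₁(k)a - a is a vector of Λ that does not
split. -/
theorem hasNonsplitAxis_iff (hc : ∀ z, (Pi.single j z : C3) ∈ Λ ↔ z / c ∈ Eis) :
    HasNonsplitAxis Λ j ↔ (1 - ζ) * (a j / c) ∉ Eis := by
  constructor
  · rintro ⟨v, hv, hvj⟩ h
    rw [hc] at hvj
    obtain ⟨u, hu, h1⟩ := exists_isEisUnit_sub_t_mem hvj (hΛ.one_sub_ζ_mul_mem hc hv)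
    have hα : a j / c ∉ Eis := fun h => by
      rw [← hc] at h
      exact hΛ.free _ h j (by simp)
    obtain ⟨u', hu', h2⟩ := exists_isEisUnit_sub_t_mem hα h
    refine hΛ.mul_sub_notMem hc hv (Eis_mul hu'.mem hu.inv_mem) ?_
    have h3 := sub_mem (Eis_mul (Eis_mul hu'.mem hu.inv_mem) h1) h2
    convert h3 using 1
    have := hu.ne_zero
    field_simp
    ring
  · intro h
    refine ⟨_, hΛ.comm, fun h1 => h ?_⟩
    rw [hc, Pi.sub_apply, ρ₁_mulVec, χ_k] at h1
    have h2 : ∃ u, IsEisUnit u ∧ (![ζ, ζ, ζ ^ 2] j * a j - a j) / c = u * ((1 - ζ) * (a j / c)) := by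
      fin_cases j
      · exact ⟨-1, IsEisUnit.one.neg, by simp; ring⟩
      · exact ⟨-1, IsEisUnit.one.neg, by simp; ring⟩
      · refine ⟨ζ ^ 2, IsEisUnit.ζ_pow 2, ?_⟩
        simp
        linear_combination (a 2 / c) * ζ_pow_three
    obtain ⟨u, hu, e⟩ := h2
    rwa [e, hu.mul_mem_iff] at h1

/-- The coordinates can be scaled so that the translation part takes prescribed values. -/
theorem exists_scaling {β : C3} (hβ : ∀ j, ∃ w, IsEisUnit w ∧ β j - w / 3 ∈ Eis) (j : Fin 3) :
    ∃ c : ℂ, c ≠ 0 ∧ (∀ z, (Pi.single j z : C3) ∈ Λ ↔ z / c ∈ Eis) ∧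
      (HasNonsplitAxis Λ j → a j / c - β j ∈ Eis) ∧
      (¬ HasNonsplitAxis Λ j → a j / c - t ∈ Eis) := by
  obtain ⟨c, hc0, hc⟩ := hΛ.axis j
  have hscale : ∀ u, IsEisUnit u → u * c ≠ 0 ∧
      ∀ z, (Pi.single j z : C3) ∈ Λ ↔ z / (u * c) ∈ Eis := fun u hu => by
    refine ⟨mul_ne_zero hu.ne_zero hc0, fun z => ?_⟩
    rw [hc, ← hu.inv.mul_mem_iff]
    congr! 1
    have := hu.ne_zero
    field_simp
  have h3 : 3 * (a j / c) ∈ Eis := by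
    rw [← mul_div_assoc, ← hc]
    exact hΛ.three j
  by_cases hS : HasNonsplitAxis Λ j
  · obtain ⟨u, hu, h1⟩ := exists_isEisUnit_sub_third_mem h3 ((hΛ.hasNonsplitAxis_iff hc).1 hS)
    obtain ⟨w, hw, h2⟩ := hβ j
    obtain ⟨h4, h5⟩ := hscale _ (hu.mul hw.inv)
    refine ⟨_, h4, h5, fun _ => ?_, fun h => absurd hS h⟩
    have h6 := sub_mem (Eis_mul (hw.mul hu.inv).mem h1) h2
    convert h6 using 1
    have := hu.ne_zero
    have := hw.ne_zero
    field_simp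
    ring
  · have hα : a j / c ∉ Eis := fun h => by
      rw [← hc] at h
      exact hΛ.free _ h j (by simp)
    have h1 : (1 - ζ) * (a j / c) ∈ Eis := by
      by_contra h
      exact hS ((hΛ.hasNonsplitAxis_iff hc).2 h)
    obtain ⟨u, hu, h2⟩ := exists_isEisUnit_sub_t_mem hα h1
    obtain ⟨h4, h5⟩ := hscale _ hu
    refine ⟨_, h4, h5, fun h => absurd h hS, fun _ => ?_⟩
    have h6 := Eis_mul hu.inv.mem h2
    convert h6 using 1
    have := hu.ne_zero
    field_simp

end IsAdmissible

/-! ### Ternary codes of length three -/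

/-- `N` is the preimage of the code `C` under reduction modulo three. -/
def IsCode (N C : Submodule ℤ (Fin 3 → ℤ)) : Prop := ∀ n, n ∈ N ↔ ∃ m ∈ C, ∀ j, 3 ∣ n j - m j

theorem forall_vec3 {α : Type*} {p : (Fin 3 → α) → Prop} (h : ∀ x y z, p ![x, y, z]) (n : Fin 3 → α) :
    p n := by
  have : n = ![n 0, n 1, n 2] := by ext j; fin_cases j <;> rfl
  rw [this]
  exact h _ _ _

section Codes

variable {N : Submodule ℤ (Fin 3 → ℤ)} (h3 : ∀ n : Fin 3 → ℤ, (∀ j, 3 ∣ n j) → n ∈ N)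

include h3

theorem isCode_iff {C : Submodule ℤ (Fin 3 → ℤ)} :
    IsCode N C ↔ C ≤ N ∧ ∀ n ∈ N, ∃ m ∈ C, ∀ j, 3 ∣ n j - m j := by
  constructor
  · intro h
    exact ⟨fun m hm => (h m).2 ⟨m, hm, fun j => by simp⟩, fun n hn => (h n).1 hn⟩
  · rintro ⟨h1, h2⟩ n
    refine ⟨h2 n, ?_⟩
    rintro ⟨m, hm, h⟩
    have := N.add_mem (h3 (n - m) h) (h1 hm)
    simpa using this

/-- Classification of the ternary codes of length three without words of weight one that
contain the indicator function of their support. -/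
theorem exists_isCode (hs : ∀ n ∈ N, ∀ j, (∀ i, i ≠ j → 3 ∣ n i) → 3 ∣ n j) {P : Fin 3 → Prop}
    [DecidablePred P] (hP : ∀ n ∈ N, ∀ j, ¬ P j → 3 ∣ n j)
    (h1 : (fun j => if P j then 1 else 0) ∈ N) :
    (¬ P 0 ∧ ¬ P 1 ∧ ¬ P 2 ∧ IsCode N (code .Y3)) ∨ (P 0 ∧ P 1 ∧ ¬ P 2 ∧ IsCode N (code .Y4)) ∨
    (P 0 ∧ ¬ P 1 ∧ P 2 ∧ IsCode N (code .Y4')) ∨ (¬ P 0 ∧ P 1 ∧ P 2) ∨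
    (P 0 ∧ P 1 ∧ P 2 ∧ (IsCode N (code .Y5) ∨ IsCode N (code .Y6))) := by
  have hs' : ∀ x y z, ![x, y, z] ∈ N → (3 ∣ y → 3 ∣ z → 3 ∣ x) ∧ (3 ∣ x → 3 ∣ z → 3 ∣ y) ∧
      (3 ∣ x → 3 ∣ y → 3 ∣ z) := fun x y z hn => by
    refine ⟨fun h h' => hs _ hn 0 fun i hi => ?_, fun h h' => hs _ hn 1 fun i hi => ?_,
      fun h h' => hs _ hn 2 fun i hi => ?_⟩ <;> fin_cases i <;> first | exact absurd rfl hi | assumption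
  have hsub : ∀ c x y z x' y' z', ![x, y, z] ∈ N → ![x', y', z'] ∈ N →
      ![x - c * x', y - c * y', z - c * z'] ∈ N := fun c x y z x' y' z' hn hn' => by
    have := sub_mem hn (N.smul_mem c hn')
    simpa using this
  have hmod : ∀ x y z x' y' z', ![x, y, z] ∈ N → 3 ∣ x - x' → 3 ∣ y - y' → 3 ∣ z - z' →
      ![x', y', z'] ∈ N := fun x y z x' y' z' hn hx hy hz => by
    have := sub_mem hn (h3 ![x - x', y - y', z - z'] fun j => by fin_cases j <;> assumption)
    simpa using this
  have hdvd : ∀ x y z x' y' z' : ℤ, 3 ∣ x - x' → 3 ∣ y - y' → 3 ∣ z - z' →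
      ∀ j, 3 ∣ ![x, y, z] j - ![x', y', z'] j := fun x y z x' y' z' hx hy hz j => by
    fin_cases j <;> assumption
  have hf : (fun j => if P j then 1 else 0) =
      ![if P 0 then (1 : ℤ) else 0, if P 1 then 1 else 0, if P 2 then 1 else 0] := by
    ext j
    fin_cases j <;> rfl
  rw [hf] at h1
  have hw := hs' _ _ _ h1
  by_cases h0 : P 0 <;> by_cases h1' : P 1 <;> by_cases h2 : P 2 <;>
    simp only [h0, h1', h2, if_true, if_false, not_true, not_false_iff, true_and, false_and,
      or_false, false_or, and_true, and_false] at h1 hw ⊢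
  -- For full support, a word that is not constant modulo 3 yields, after subtracting a multiple of
  -- (1, 1, 1), a word with last entry 0. Absence of weight one words makes it ±(1, -1, 0).
  · by_cases hconst : ∀ x y z, ![x, y, z] ∈ N → 3 ∣ x - z
    · left
      rw [isCode_iff h3]
      refine ⟨by rw [code, Submodule.span_le]; simpa using h1, forall_vec3 fun x y z hn => ?_⟩
      refine ⟨_, mem_code.2 ⟨z, 0, rfl⟩, hdvd _ _ _ _ _ _ ?_ ?_ ?_⟩
      · exact hconst _ _ _ hn
      · have h4 := hconst _ _ _ hn
        have h5 := (hs' _ _ _ (hsub z _ _ _ _ _ _ hn h1)).2.1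
        omega
      · omega
    · right
      push Not at hconst
      obtain ⟨x, y, z, hn, hn2⟩ := hconst
      have hd : ![1, -1, 0] ∈ N := by
        have hm := hsub z _ _ _ _ _ _ hn h1
        have h5 := hs' _ _ _ hm
        have h6 := hs' _ _ _ (hsub (x - z) _ _ _ _ _ _ hm h1)
        rcases (by omega : 3 ∣ x - z - 1 ∨ 3 ∣ x - z + 1) with h8 | h8
        · exact hmod _ _ _ _ _ _ hm (by omega) (by omega) (by omega)
        · exact hmod _ _ _ _ _ _ (hsub 1 _ _ _ _ _ _ (h3 ![0, 0, 0] (by simp [Fin.forall_fin_succ])) hm)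
            (by omega) (by omega) (by omega)
      rw [isCode_iff h3]
      refine ⟨?_, forall_vec3 fun x y z hn => ?_⟩
      · rw [code, Submodule.span_le]
        rintro x (rfl | rfl)
        · exact h1
        · exact hd
      · refine ⟨_, mem_code.2 ⟨z, x - z, rfl⟩, hdvd _ _ _ _ _ _ (by omega) ?_ (by omega)⟩
        have h5 := (hs' _ _ _ (hsub (x - z) _ _ _ _ _ _ (hsub z _ _ _ _ _ _ hn h1) hd)).2.1
        omega
  · rw [isCode_iff h3]
    refine ⟨by rw [code, Submodule.span_le]; simpa using h1, forall_vec3 fun x y z hn => ?_⟩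
    have h4 : 3 ∣ z := hP _ hn 2 h2
    have h5 := (hs' _ _ _ (hsub x _ _ _ _ _ _ hn h1)).2.1
    exact ⟨_, mem_code.2 ⟨x, 0, rfl⟩, hdvd _ _ _ _ _ _ (by omega) (by omega) (by omega)⟩
  · rw [isCode_iff h3]
    refine ⟨by rw [code, Submodule.span_le]; simpa using h1, forall_vec3 fun x y z hn => ?_⟩
    have h4 : 3 ∣ y := hP _ hn 1 h1'
    have h5 := (hs' _ _ _ (hsub x _ _ _ _ _ _ hn h1)).2.2
    exact ⟨_, mem_code.2 ⟨x, 0, rfl⟩, hdvd _ _ _ _ _ _ (by omega) (by omega) (by omega)⟩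
  · simp at hw
  · simp at hw
  · simp at hw
  · rw [isCode_iff h3]
    refine ⟨by simp [code], fun n hn => ⟨0, by simp [code], fun j => ?_⟩⟩
    fin_cases j
    · simpa using hP n hn 0 h0
    · simpa using hP n hn 1 h1'
    · simpa using hP n hn 2 h2

end Codes

theorem χ_mem_Eis (g : Z3sq) (j : Fin 3) : χ g j ∈ Eis := by
  fin_cases j <;> exact ζ_pow_mem_Eis _

theorem mem_of_forall_div_mem {Λ : Submodule ℤ C3} {c : C3}
    (hc : ∀ j z, (Pi.single j z : C3) ∈ Λ ↔ z / c j ∈ Eis) {v : C3} (hv : ∀ j, v j / c j ∈ Eis) :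
    v ∈ Λ := by
  rw [← Finset.univ_sum_single v]
  exact Submodule.sum_mem _ fun j _ => (hc j _).2 (hv j)

open Classical in
/-- Up to scaling the coordinates, an admissible lattice with translation is one of the five
models, unless exactly the last two axes are not split off. -/
theorem IsAdmissible.exists_label {Λ : Submodule ℤ C3} {a : C3} (hΛ : IsAdmissible Λ a)
    (hS : ¬ (¬ HasNonsplitAxis Λ 0 ∧ HasNonsplitAxis Λ 1 ∧ HasNonsplitAxis Λ 2)) :
    ∃ (i : Label) (c : C3), (∀ j, c j ≠ 0) ∧
      (∀ v : C3, v ∈ Λ ↔ (fun j => v j / c j) ∈ modelLattice i) ∧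
      (fun j => a j / c j) - modelTranslation i ∈ modelLattice i := by
  -- τ is the third translation coordinate of the model in question. Both values satisfy (ζ² - 1)τ ≡
  -- -t, so the word coming from commutation has the same sign on all nonsplit axes.
  obtain ⟨τ, hτ1, hτ2, hτ3, hτ4⟩ : ∃ τ : ℂ, (∃ w, IsEisUnit w ∧ τ - w / 3 ∈ Eis) ∧
      ((ζ ^ 2 - 1) * τ + t ∈ Eis) ∧ (¬ HasNonsplitAxis Λ 1 → τ = 2 * ζ ^ 2 / 3) ∧
      (HasNonsplitAxis Λ 1 → τ = 2 / 3) := by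
    by_cases h : HasNonsplitAxis Λ 1
    · refine ⟨2 / 3, ⟨-1, IsEisUnit.one.neg, ?_⟩, mem_Eis.2 ⟨-1, 0, ?_⟩, fun h' => absurd h h',
        fun _ => rfl⟩
      · convert one_mem_Eis using 1
        ring
      · rw [ζ_sq, t]
        push_cast
        ring
    · refine ⟨2 * ζ ^ 2 / 3, ⟨-ζ ^ 2, (IsEisUnit.ζ_pow 2).neg, ?_⟩, mem_Eis.2 ⟨1, 2, ?_⟩,
        fun _ => rfl, fun h' => absurd h' h⟩
      · convert ζ_pow_mem_Eis 2 using 1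
        ring
      · rw [t]
        push_cast
        linear_combination (2 / 3 * (ζ ^ 2 - ζ - 1) : ℂ) * ζ_sq
  let β : C3 := ![1 / 3, 1 / 3, τ]
  have hβ : ∀ j, ∃ w, IsEisUnit w ∧ β j - w / 3 ∈ Eis := fun j => by
    fin_cases j
    · exact ⟨1, IsEisUnit.one, by simp [β]⟩
    · exact ⟨1, IsEisUnit.one, by simp [β]⟩
    · exact hτ1
  have hβ' : ∀ j, (χ k j - 1) * β j + t ∈ Eis := fun j => by
    have h1 : (ζ - 1) * (1 / 3) + t ∈ Eis := mem_Eis.2 ⟨0, 1, by rw [t]; push_cast; ring⟩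
    rw [χ_k]
    fin_cases j
    · exact h1
    · exact h1
    · exact hτ2
  choose c hc0 hc haβ hat using hΛ.exists_scaling hβ
  let N : Submodule ℤ (Fin 3 → ℤ) := Λ.comap (σ₁₂ := RingHom.id ℤ)
    { toFun := fun n j => c j * (n j * t)
      map_add' := fun m n => by ext j; simp; ring
      map_smul' := fun m n => by ext j; simp; ring }
  have hN : ∀ n : Fin 3 → ℤ, n ∈ N ↔ (fun j => c j * (n j * t) : C3) ∈ Λ := fun n => Iff.rfl
  have hcn : ∀ (n : Fin 3 → ℤ) j, c j * (n j * t) / c j = n j * t := fun n j =>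
    mul_div_cancel_left₀ _ (hc0 j)
  have hmem : ∀ {v : C3} {n : Fin 3 → ℤ}, (∀ j, v j / c j - n j * t ∈ Eis) → (v ∈ Λ ↔ n ∈ N) := by
    intro v n h
    have h1 : v - (fun j => c j * (n j * t) : C3) ∈ Λ := mem_of_forall_div_mem hc fun j => by
      rw [Pi.sub_apply, sub_div, hcn]
      exact h j
    rw [hN]
    constructor
    · intro hv
      simpa using sub_mem hv h1
    · intro hn
      simpa using add_mem h1 hn
  have hex : ∀ v ∈ Λ, ∃ n : Fin 3 → ℤ, ∀ j, v j / c j - n j * t ∈ Eis := fun v hv => by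
    choose n hn using fun j => exists_int_mul_t (hΛ.one_sub_ζ_mul_mem (hc j) hv)
    exact ⟨n, hn⟩
  have h3 : ∀ n : Fin 3 → ℤ, (∀ j, 3 ∣ n j) → n ∈ N := fun n hn =>
    (hN n).2 <| mem_of_forall_div_mem hc fun j => by
      rw [hcn]
      exact int_mul_t_mem_Eis.2 (hn j)
  have hsingle : ∀ (n : Fin 3 → ℤ) j, (Pi.single j (c j * (n j * t)) : C3) ∈ Λ → 3 ∣ n j :=
    fun n j h => by rwa [hc, hcn, int_mul_t_mem_Eis] at h
  have hs : ∀ n ∈ N, ∀ j, (∀ i, i ≠ j → 3 ∣ n i) → 3 ∣ n j := fun n hn j hi => by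
    refine hsingle n j ?_
    have h1 : (fun j => c j * (n j * t) : C3) - Pi.single j (c j * (n j * t)) ∈ Λ :=
      mem_of_forall_div_mem hc fun l => by
        by_cases hl : l = j
        · subst hl
          simp
        · rw [Pi.sub_apply, Pi.single_eq_of_ne hl, sub_zero, hcn]
          exact int_mul_t_mem_Eis.2 (hi l hl)
    simpa using sub_mem ((hN n).1 hn) h1
  have hP : ∀ n ∈ N, ∀ j, ¬ HasNonsplitAxis Λ j → 3 ∣ n j := fun n hn j hj => by
    refine hsingle n j ?_
    by_contra h
    exact hj ⟨_, (hN n).1 hn, h⟩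
  -- By the choice of β, the vector ρ₁(k)a - a represents minus this word.
  have h1 : (fun j => if HasNonsplitAxis Λ j then 1 else 0) ∈ N := by
    rw [← Submodule.neg_mem_iff]
    refine (hmem fun j => ?_).1 hΛ.comm
    simp only [Pi.neg_apply, Pi.sub_apply, ρ₁_mulVec]
    by_cases hj : HasNonsplitAxis Λ j
    · have h2 := add_mem (Eis_mul (sub_mem (χ_mem_Eis k j) one_mem_Eis) (haβ j hj)) (hβ' j)
      rw [if_pos hj]
      convert h2 using 1
      push_cast
      ring
    · rw [if_neg hj]
      have h2 : (Pi.single j ((ρ₁ k *ᵥ a - a) j) : C3) ∈ Λ := by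
        by_contra h
        exact hj ⟨_, hΛ.comm, h⟩
      rw [hc, Pi.sub_apply, ρ₁_mulVec] at h2
      simpa using h2
  have hfin : ∀ i, IsCode N (code i) → (∀ j, a j / c j - modelTranslation i j ∈ Eis) →
      ∃ (i : Label) (c : C3), (∀ j, c j ≠ 0) ∧
      (∀ v : C3, v ∈ Λ ↔ (fun j => v j / c j) ∈ modelLattice i) ∧
      (fun j => a j / c j) - modelTranslation i ∈ modelLattice i := fun i hi ht => by
    refine ⟨i, c, hc0, fun v => ⟨fun hv => ?_, fun hv => ?_⟩, ?_⟩
    · obtain ⟨n, hn⟩ := hex v hv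
      obtain ⟨m, hm, hnm⟩ := (hi n).1 ((hmem hn).1 hv)
      refine mem_modelLattice.2 ⟨m, hm, fun j => ?_⟩
      have h2 := add_mem (hn j) (int_mul_t_mem_Eis.2 (hnm j))
      push_cast at h2
      convert h2 using 1
      ring
    · obtain ⟨m, hm, hv⟩ := mem_modelLattice.1 hv
      exact (hmem hv).2 ((hi m).2 ⟨m, hm, fun j => by simp⟩)
    · rw [modelLattice_eq]
      exact cube_le_codeLattice _ (mem_eisensteinCube.2 ht)
  have haβ0 : HasNonsplitAxis Λ 0 → a 0 / c 0 - 1 / 3 ∈ Eis := haβ 0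
  have haβ1 : HasNonsplitAxis Λ 1 → a 1 / c 1 - 1 / 3 ∈ Eis := haβ 1
  have haβ2 : HasNonsplitAxis Λ 2 → a 2 / c 2 - τ ∈ Eis := haβ 2
  rcases exists_isCode h3 hs hP h1 with ⟨s0, s1, s2, hi⟩ | ⟨s0, s1, s2, hi⟩ | ⟨s0, s1, s2, hi⟩ | hbad |
    ⟨s0, s1, s2, hi | hi⟩
  · refine hfin _ hi fun j => ?_
    fin_cases j
    exacts [hat 0 s0, hat 1 s1, hat 2 s2]
  · refine hfin _ hi fun j => ?_
    fin_cases j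
    exacts [haβ0 s0, haβ1 s1, hat 2 s2]
  · rw [hτ3 s1] at haβ2
    refine hfin _ hi fun j => ?_
    fin_cases j
    exacts [haβ0 s0, hat 1 s1, haβ2 s2]
  · exact absurd hbad hS
  · rw [hτ4 s1] at haβ2
    refine hfin _ hi fun j => ?_
    fin_cases j
    exacts [haβ0 s0, haβ1 s1, haβ2 s2]
  · rw [hτ4 s1] at haβ2
    refine hfin _ hi fun j => ?_
    fin_cases j
    exacts [haβ0 s0, haβ1 s1, haβ2 s2]

/-! ### Interchanging the first two coordinates -/

/-- The automorphism `(a, b) ↦ (b, a)` of `ℤ₃²`. -/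
def swapZ3sq : Z3sq ≃* Z3sq := AddEquiv.toMultiplicative AddEquiv.prodComm

/-- The interchange of the first two coordinates of `ℂ³`. -/
def swapC3 : C3 ≃ₗ[ℂ] C3 := LinearEquiv.funCongrLeft ℂ ℂ (Equiv.swap 0 1)

theorem swapC3_apply (v : C3) (j : Fin 3) : swapC3 v j = v (Equiv.swap 0 1 j) := rfl

theorem swapC3_swapC3 (v : C3) : swapC3 (swapC3 v) = v := by
  ext j
  rw [swapC3_apply, swapC3_apply, Equiv.swap_apply_self]

theorem χ_swap (g : Z3sq) (j : Fin 3) : χ (swapZ3sq g) j = χ g (Equiv.swap 0 1 j) := by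
  fin_cases j
  · rfl
  · rfl
  · simp only [χ, swapZ3sq]
    change ζ ^ (g.toAdd.2 + g.toAdd.1).val = ζ ^ (g.toAdd.1 + g.toAdd.2).val
    rw [add_comm]

theorem swapC3_mulVec (g : Z3sq) (v : C3) :
    swapC3 (ρ₁ g *ᵥ v) = ρ₁ (swapZ3sq g) *ᵥ swapC3 v := by
  ext j
  simp only [swapC3_apply, ρ₁_mulVec, χ_swap]

theorem swapC3_single (j : Fin 3) (z : ℂ) :
    swapC3 (Pi.single j z) = Pi.single (Equiv.swap 0 1 j) z := by
  ext l
  rw [swapC3_apply]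
  by_cases hl : l = Equiv.swap 0 1 j
  · subst hl
    simp
  · rw [Pi.single_eq_of_ne hl, Pi.single_eq_of_ne]
    rintro rfl
    simp at hl

/-- The interchange turns (hk)⁻¹ into h and keeps k, so the new translation part comes from the
inverse of the lift of hk. -/
theorem IsAdmissible.swap {Λ : Submodule ℤ C3} {a : C3} (hΛ : IsAdmissible Λ a) :
    IsAdmissible (Λ.comap (swapC3.toLinearMap.restrictScalars ℤ))
      (swapC3 (-(ρ₁ (axisElt 1)⁻¹ *ᵥ a))) := by
  have hm : ∀ v : C3, v ∈ Λ.comap (swapC3.toLinearMap.restrictScalars ℤ) ↔ swapC3 v ∈ Λ :=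
    fun v => Iff.rfl
  refine ⟨fun j => ?_, fun g v hv => ?_, ?_, fun j => ?_, fun v hv j e => ?_⟩
  · obtain ⟨c, hc0, hc⟩ := hΛ.axis (Equiv.swap 0 1 j)
    exact ⟨c, hc0, fun z => by rw [hm, swapC3_single, hc]⟩
  · rw [hm] at hv ⊢
    rw [swapC3_mulVec]
    exact hΛ.mulVec _ _ hv
  · rw [hm, map_sub, swapC3_mulVec, swapC3_swapC3]
    have h1 : swapZ3sq k = k := rfl
    rw [h1]
    have h2 := neg_mem (hΛ.mulVec (axisElt 1)⁻¹ _ hΛ.comm)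
    convert h2 using 1
    rw [Matrix.mulVec_neg, ← ρ₁_mul_mulVec, Matrix.mulVec_sub, ← ρ₁_mul_mulVec,
      mul_comm k]
    abel
  · rw [hm, swapC3_single, swapC3_apply]
    have h1 := single_mul_mem hΛ.mulVec (hΛ.three (Equiv.swap 0 1 j))
      (neg_mem (χ_mem_Eis (axisElt 1)⁻¹ (Equiv.swap 0 1 j)))
    convert h1 using 2
    rw [Pi.neg_apply, ρ₁_mulVec]
    ring
  · rw [hm] at hv
    rw [swapC3_apply, Pi.neg_apply] at e
    obtain ⟨w, hw, hwj⟩ := exists_apply_eq_mul hΛ.mulVec hv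
      (neg_mem (χ_mem_Eis (axisElt 1) (Equiv.swap 0 1 j))) (Equiv.swap 0 1 j)
    refine hΛ.free w hw _ (hwj.trans ?_)
    rw [swapC3_apply, Equiv.swap_apply_self, e]
    have h1 := congrFun (ρ₁_mulVec_inv (axisElt 1) a) (Equiv.swap 0 1 j)
    rw [ρ₁_mulVec] at h1
    linear_combination h1

theorem hasNonsplitAxis_swap {Λ : Submodule ℤ C3} {j : Fin 3}
    (h : HasNonsplitAxis (Λ.comap (swapC3.toLinearMap.restrictScalars ℤ)) j) :
    HasNonsplitAxis Λ (Equiv.swap 0 1 j) := by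
  obtain ⟨v, hv, hvj⟩ := h
  refine ⟨swapC3 v, hv, fun h => hvj ?_⟩
  change swapC3 (Pi.single j (v j)) ∈ Λ
  rw [swapC3_single]
  rwa [swapC3_apply, Equiv.swap_apply_self] at h

/-! ### Biholomorphisms onto the models -/

namespace TorusAction

/-- Linear equivalences that respect the lattices and the translation parts induce
biholomorphisms of the quotients. -/
theorem biholomorphic_of_linearEquiv {A B : TorusAction Z3sq ρ₁} (L : C3 ≃ₗ[ℂ] C3)
    (θ : Z3sq ≃* Z3sq) {p a τ : C3} (hL : ∀ g v, L (ρ₁ (θ g) *ᵥ v) = ρ₁ g *ᵥ L v)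
    (hΛ : ∀ v, v ∈ A.lattice ↔ L v ∈ B.lattice)
    (hAh : A.IsLift (θ h) (a + p - ρ₁ (θ h) *ᵥ p)) (hAk : A.IsLift (θ k) (p - ρ₁ (θ k) *ᵥ p))
    (hBh : B.IsLift h τ) (hBk : B.IsLift k 0) (haτ : L a - τ ∈ B.lattice) :
    Biholomorphic A B := by
  let e := L.toContinuousLinearEquiv
  -- The point p, fixed by the lift of Φ(θ k), goes to the origin, which is fixed by the lift of
  -- Φ(k) on the other side.
  let F : C3 ≃ₜ C3 := (Homeomorph.addRight (-p)).trans e.toHomeomorph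
  have hF : ∀ z, F z = L (z - p) := fun z => by
    change L (z + -p) = _
    rw [sub_eq_add_neg]
  have hFs : ∀ z, F.symm z = e.symm z + p := fun z => by
    change e.symm z + - -p = _
    rw [neg_neg]
  refine biholomorphic_of_homeomorph F ?_ ?_
    (proj_eq_iff_of_generators F.toEquiv θ (fun x y => ?_) (fun z => ?_) fun z => ?_)
  · have : (F : C3 → C3) = fun z => e (z - p) := funext hF
    rw [this]
    exact e.differentiable.comp (differentiable_id.sub_const p)
  · have : (F.symm : C3 → C3) = fun z => e.symm z + p := funext hFs
    rw [this]
    exact e.symm.differentiable.add_const p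
  · change _ ↔ F x - F y ∈ B.lattice
    rw [hΛ, hF, hF, ← map_sub, sub_sub_sub_cancel_right]
  · refine ⟨_, hAh z, ?_⟩
    change B.Φ h (B.toTorus (F z)) = B.toTorus (F _)
    rw [hBh, toTorus_eq_iff, hF, hF]
    have h1 : ρ₁ h *ᵥ L (z - p) + τ -
        L (ρ₁ (θ h) *ᵥ z + (a + p - ρ₁ (θ h) *ᵥ p) - p) = -(L a - τ) := by
      rw [← hL, Matrix.mulVec_sub]
      simp only [map_sub, map_add]
      abel
    rw [h1]
    exact neg_mem haτ
  · refine ⟨_, hAk z, ?_⟩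
    change B.Φ k (B.toTorus (F z)) = B.toTorus (F _)
    rw [hBk, hF, hF, ← hL, Matrix.mulVec_sub]
    congr 1
    simp only [map_sub, map_add]
    abel

/-- The scaling of the coordinates `v ↦ (v₁ / c₁, v₂ / c₂, v₃ / c₃)`. -/
noncomputable def scaleC3 (c : C3) (hc : ∀ j, c j ≠ 0) : C3 ≃ₗ[ℂ] C3 :=
  LinearEquiv.piCongrRight fun j => LinearEquiv.smulOfNeZero ℂ ℂ (c j)⁻¹ (inv_ne_zero (hc j))

theorem scaleC3_apply (c : C3) (hc : ∀ j, c j ≠ 0) (v : C3) :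
    scaleC3 c hc v = fun j => v j / c j := by
  ext j
  simp [scaleC3, div_eq_inv_mul]

theorem scaleC3_mulVec (c : C3) (hc : ∀ j, c j ≠ 0) (g : Z3sq) (v : C3) :
    scaleC3 c hc (ρ₁ g *ᵥ v) = ρ₁ g *ᵥ scaleC3 c hc v := by
  ext j
  simp only [scaleC3_apply, ρ₁_mulVec, mul_div_assoc]

theorem _root_.TorusQuotient.IsModel.isLift {i : Label} {A : TorusAction Z3sq ρ₁}
    (hA : IsModel i A) : A.IsLift h (modelTranslation i) ∧ A.IsLift k 0 := by
  refine ⟨fun z => ?_, fun z => ?_⟩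
  · rw [hA.2.1, ρ₁_h]
  · rw [hA.2.2, ρ₁_k, add_zero]

/-- Every quotient by an action with finite fixed locus is biholomorphic to one of the models. -/
theorem FiniteFixedLocus.exists_biholomorphic {A : TorusAction Z3sq ρ₁} (hA : A.FiniteFixedLocus)
    {Y : Label → TorusAction Z3sq ρ₁} (hY : ∀ i, IsModel i (Y i)) : ∃ i, Biholomorphic A (Y i) := by
  obtain ⟨p, a, hadm, hax, hk⟩ := hA.exists_isAdmissible
  -- In this case the interchange moves the nonsplit axes to the first and third.
  by_cases hS : ¬ HasNonsplitAxis A.lattice 0 ∧ HasNonsplitAxis A.lattice 1 ∧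
      HasNonsplitAxis A.lattice 2
  · obtain ⟨i, c, hc0, hc, hτ⟩ := hadm.swap.exists_label fun h => hS.1 (hasNonsplitAxis_swap h.2.1)
    refine ⟨i, biholomorphic_of_linearEquiv (swapC3.trans (scaleC3 c hc0)) swapZ3sq (p := p)
      (a := -(ρ₁ (axisElt 1)⁻¹ *ᵥ a)) (fun g v => ?_) (fun v => ?_) ?_ hk (hY i).isLift.1
      (hY i).isLift.2 ?_⟩
    · have h1 : swapZ3sq (swapZ3sq g) = g := rfl
      rw [LinearEquiv.trans_apply, LinearEquiv.trans_apply, swapC3_mulVec, scaleC3_mulVec, h1]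
    · rw [LinearEquiv.trans_apply, scaleC3_apply, (hY i).1, ← hc]
      change _ ↔ swapC3 (swapC3 v) ∈ A.lattice
      rw [swapC3_swapC3]
    · have h1 : swapZ3sq h = (axisElt 1)⁻¹ := by decide
      rw [h1]
      have h2 := (hax 1).inv
      convert h2 using 1
      rw [Matrix.mulVec_sub, Matrix.mulVec_add, ρ₁_inv_mulVec]
      abel
    · rw [LinearEquiv.trans_apply, scaleC3_apply, (hY i).1]
      exact hτ
  · obtain ⟨i, c, hc0, hc, hτ⟩ := hadm.exists_label hS
    refine ⟨i, biholomorphic_of_linearEquiv (scaleC3 c hc0) (MulEquiv.refl _) (p := p) (a := a)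
      (scaleC3_mulVec c hc0) (fun v => ?_) (hax 0) hk (hY i).isLift.1 (hY i).isLift.2 ?_⟩
    · rw [scaleC3_apply, (hY i).1, hc]
    · rw [scaleC3_apply, (hY i).1]
      exact hτ

end TorusAction

/-! ### The diffeomorphism between `Y₄` and `Y₄'` -/

/-- The map `(z₁, z₂, z₃) ↦ (-z₁, conj z₃, conj z₂)`. -/
noncomputable def conjSwap : C3 ≃ₗ[ℝ] C3 where
  toFun z := ![-z 0, (starRingEnd ℂ) (z 2), (starRingEnd ℂ) (z 1)]
  map_add' z w := by
    ext j
    fin_cases j <;> simp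
    ring
  map_smul' r z := by
    ext j
    fin_cases j <;> simp
  invFun z := ![-z 0, (starRingEnd ℂ) (z 2), (starRingEnd ℂ) (z 1)]
  left_inv z := by
    ext j
    fin_cases j <;> simp
  right_inv z := by
    ext j
    fin_cases j <;> simp

theorem conjSwap_apply (z : C3) :
    conjSwap z = ![-z 0, (starRingEnd ℂ) (z 2), (starRingEnd ℂ) (z 1)] := rfl

theorem conjSwap_mem {v : C3} : v ∈ modelLattice .Y4 ↔ conjSwap v ∈ modelLattice .Y4' := by
  constructor
  · intro hv
    obtain ⟨n, hn, h⟩ := mem_modelLattice.1 hv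
    obtain ⟨x, y, rfl⟩ := mem_code.1 hn
    refine mem_modelLattice.2 ⟨_, mem_code.2 ⟨-x, 0, rfl⟩, fun j => ?_⟩
    have h0 := neg_mem (h 0)
    have h1 := conj_mem_Eis (h 1)
    have h2 := conj_mem_Eis (h 2)
    rw [conjSwap_apply]
    fin_cases j
    · simpa [sub_eq_add_neg, add_comm] using h0
    · simpa using h2
    · simpa [conj_t] using h1
  · intro hv
    obtain ⟨n, hn, h⟩ := mem_modelLattice.1 hv
    obtain ⟨x, y, rfl⟩ := mem_code.1 hn
    refine mem_modelLattice.2 ⟨_, mem_code.2 ⟨-x, 0, rfl⟩, fun j => ?_⟩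
    rw [conjSwap_apply] at h
    have h0 := neg_mem (h 0)
    have h1 := conj_mem_Eis (h 1)
    have h2 := conj_mem_Eis (h 2)
    fin_cases j
    · simpa [sub_eq_add_neg, add_comm] using h0
    · simpa [conj_t] using h2
    · simpa using h1

/-- The automorphism of `ℤ₃²` with `h ↦ h²` and `k ↦ k`. -/
def conjZ3sq : Z3sq ≃* Z3sq where
  -- From (a, b) = (a - b)h + ak, the image is 2(a - b)h + ak = (a, 2a - b).
  toFun g := Multiplicative.ofAdd (g.toAdd.1, 2 * g.toAdd.1 - g.toAdd.2)
  invFun g := Multiplicative.ofAdd (g.toAdd.1, 2 * g.toAdd.1 - g.toAdd.2)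
  left_inv := by decide
  right_inv := by decide
  map_mul' := by decide

namespace TorusAction

/-- Conjugating and exchanging the last two coordinates inverts ρ₁(h) and keeps ρ₁(k), so h
corresponds to h². The first translation coordinate of h² is 2/3, and the sign in -z₁ turns it into
-2/3 ≡ 1/3. -/
theorem exists_diffeomorphism_Y4 {A B : TorusAction Z3sq ρ₁} (hA : IsModel .Y4 A)
    (hB : IsModel .Y4' B) : ∃ f : A.X ≃ₜ B.X, IsDiffeomorphism f ∧
      ∀ z : C3, f (A.proj z) = B.proj ![-z 0, (starRingEnd ℂ) (z 2), (starRingEnd ℂ) (z 1)] := by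
  let e := conjSwap.toContinuousLinearEquiv
  have h0 := (hA.isLift.1.mul hA.isLift.1)
  refine exists_diffeomorphism_of_homeomorph e.toHomeomorph e.contDiff e.symm.contDiff
    (proj_eq_iff_of_generators e.toEquiv conjZ3sq (fun x y => ?_) (fun z => ⟨_, h0 z, ?_⟩)
      fun z => ⟨_, hA.isLift.2 z, ?_⟩)
  · change _ ↔ conjSwap x - conjSwap y ∈ B.lattice
    rw [← map_sub, hA.1, hB.1, conjSwap_mem]
  · change B.Φ h (B.toTorus (conjSwap z)) = B.toTorus (conjSwap _)
    rw [hB.isLift.1, toTorus_eq_iff, hB.1]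
    rw [modelLattice_eq]
    refine cube_le_codeLattice _ (mem_eisensteinCube.2 fun j => ?_)
    simp only [conjSwap_apply, Pi.add_apply, Pi.sub_apply, ρ₁_mul_mulVec, ρ₁_mulVec]
    have hχ0 : χ h 0 = 1 := by simp [χ, h]
    have hχ1 : χ h 1 = ζ ^ 2 := rfl
    have hχ2 : χ h 2 = ζ ^ 2 := rfl
    have hz : (starRingEnd ℂ) ζ = ζ ^ 2 := by rw [conj_ζ, ζ_sq]
    have h3 := ζ_pow_three
    fin_cases j
    · simp [modelTranslation, hχ0]
      convert one_mem_Eis using 1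
      ring
    · simp [modelTranslation, hχ1, hχ2, hz, conj_t]
      convert neg_mem (ζ_pow_mul_t_sub 2) using 1
      linear_combination (-(starRingEnd ℂ) (z 2) * (ζ ^ 5 + ζ ^ 2) + ζ * t) * h3 + t * ζ_sq
    · simp [modelTranslation, hχ1, hχ2, hz]
      convert ζ_pow_mem_Eis 2 using 1
      have h1 := ζ_sq
      have h2 : (starRingEnd ℂ) 3 = 3 := map_ofNat _ 3
      rw [h2]
      linear_combination (-(starRingEnd ℂ) (z 1) * (ζ ^ 5 + ζ ^ 2) - ζ / 3) * h3 - h1 / 3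
  · change B.Φ k (B.toTorus (conjSwap z)) = B.toTorus (conjSwap _)
    rw [hB.isLift.2, ρ₁_k]
    congr 1
    ext j
    simp only [conjSwap_apply]
    fin_cases j <;> simp [conj_ζ, Matrix.mulVec_diagonal]
    · exact Or.inl (by linear_combination -ζ_sq)
    · exact Or.inl ζ_sq

end TorusAction

end TorusQuotient

/-! ### The main theorem -/

open TorusQuotient TorusAction in
theorem proposition4p12 :
    ∃ Y : Label → TorusAction Z3sq ρ₁,
      -- `Y i` is the action given by the explicit data, with finite fixed locus and rigid
      (∀ i, IsModel i (Y i) ∧ (Y i).FiniteFixedLocus ∧ (Y i).IsRigid) ∧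
      -- every quotient by such an action is biholomorphic to one of the five
      (∀ A : TorusAction Z3sq ρ₁, A.FiniteFixedLocus → A.IsRigid →
        ∃ i, Biholomorphic A (Y i)) ∧
      -- the five quotients are pairwise not biholomorphic
      (∀ i j, i ≠ j → ¬ Biholomorphic (Y i) (Y j)) ∧
      -- the explicit diffeomorphism
      (∃ f : (Y .Y4).X ≃ₜ (Y .Y4').X, IsDiffeomorphism f ∧
        ∀ z : C3, f ((Y .Y4).proj z) =
          (Y .Y4').proj ![-z 0, (starRingEnd ℂ) (z 2), (starRingEnd ℂ) (z 1)]) ∧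
      -- there are no other diffeomorphisms between distinct quotients
      (∀ i j, i ≠ j → Diffeomorphic (Y i) (Y j) →
        (i = .Y4 ∧ j = .Y4') ∨ (i = .Y4' ∧ j = .Y4)) := by
  choose Y hY hfin using exists_model
  refine ⟨Y, fun i => ⟨hY i, hfin i, isRigid _⟩, fun A hA _ => hA.exists_biholomorphic hY,
    fun i j hij hbi => hij (eq_of_biholomorphic (hY i) (hY j) (hfin i) (hfin j) hbi),
    exists_diffeomorphism_Y4 (hY _) (hY _), fun i j hij hd => ?_⟩
  obtain ⟨f, -⟩ := hd
  exact (eq_or_of_homeomorph (hY i) (hY j) (hfin i) (hfin j) f).resolve_left hij
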